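/- **Setting.** Let $\Gamma$ be the infinite chain of rings of circumference $2\pi$: its vertices are indexed by $j\in\mathbb Z$, and the $j$-th ring consists of two edges (the upper and the lower half-circle) of length $\pi$, both running from vertex $j$ to vertex $j+1$. Let $A\in\mathbb R$ and let $\mathbf a=(a_j)_{j\in\mathbb Z}$ be a real sequence. On $L^2(\Gamma)$ consider the operator $-\Delta_{\mathbf a}$ acting as $-\mathcal D^2$ on each edge, where $\mathcal D=\frac{d}{dx}+iA$ on the upper and $\mathcal D=\frac{d}{dx}-iA$ on the lower half-circles. Its domain consists of the functions that belong to $H^2$ on each edge, satisfy $u,\mathcal D^2u\in L^2(\Gamma)$, are continuous at the vertices, and satisfy the $\delta$-coupling condition at every vertex $j$: the sum of the quasiderivatives $\mathcal D u$ along the two edges of ring $j$ (at their starting point) minus the sum along the two edges of ring $j-1$ (at their end point) equals $a_j\,u(j)$. Write $-\Delta_\alpha$ for $a_j\equiv\alpha\in\mathbb R$. For $\gamma_1,\gamma_2\in\mathbb R$ and $n\in\mathbb N_0$ let $-\Delta_{\alpha,n}$ be the operator whose coupling constants are $\alpha+\gamma_1$ at some vertex $j$, $\alpha+\gamma_2$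 at the vertex $j+n+1$ (so that there are exactly $n$ vertices in between), and $\alpha$ at all other vertices. A *gap* is a connected component of the complement in $\mathbb R$ of the essential spectrum of $-\Delta_\alpha$. Gaps are numbered as follows: the zeroth gap is the one that is unbounded from below; for $m\ge1$, gap number $2m-1$ is the one whose upper endpoint is $m^2$, and gap number $2m$ is the one whose lower endpoint is $m^2$ (the numbers $m^2$ are the infinitely degenerate eigenvalues of $-\Delta_\alpha$). For integer $A$ some of these gaps are closed (empty); the others keep their numbers, and the statements below concern the nonempty ones. **Theorem.** Let $A\in\mathbb Z$ and $\alpha,\gamma_1,\gamma_2\in\mathbb R$. 1. For every $n\in\mathbb N_0$ (and every $j$) the essential spectrum of $-\Delta_{\alpha,n}$ coincides with that of $-\Delta_\alpha$. Let $I$ be a gap. Then $I$ has exactly one number in the above numbering, and the following holds, where $N$, $C$, $c$ may depend on $I,A,\alpha,\gamma_1,\gamma_2$ but not on $n$ or $j$: 2. If $\gamma_1\gamma_2<0$, there is $N$ such that for all $n\ge N$ the operator $-\Delta_{\alpha,n}$ has exactly one eigenvalue in $I$, and it is simple. 3. If $\gamma_1,\gamma_2>0$, there is $N$ such that for all $n\ge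 N$ the operator $-\Delta_{\alpha,n}$ has exactly two eigenvalues in $I$, both simple, if the number of $I$ is odd, and no eigenvalue in $I$ if the number of $I$ is even. 4. If $\gamma_1,\gamma_2<0$, there is $N$ such that for all $n\ge N$ the operator $-\Delta_{\alpha,n}$ has exactly two eigenvalues in $I$, both simple, if the number of $I$ is even, and no eigenvalue in $I$ if the number of $I$ is odd. 5. If $\gamma_1=\gamma_2$, there are $C,c>0$ and $N$ such that for all $n\ge N$ any two eigenvalues $E,E'$ of $-\Delta_{\alpha,n}$ in $I$ satisfy $|E-E'|\le C e^{-cn}$. -/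

import Mathlib

open MeasureTheory Filter Topology Set
open scoped ENNReal

/-- The edges of the ring chain: `(j, true)` is the upper and `(j, false)` the lower half-circle of
the `j`-th ring. Every half-circle has length `π` and is parametrized by `[0, π]`, running from the
vertex `j` to the vertex `j + 1`. -/
abbrev ChainEdge : Type := ℤ × Bool

/-- Arc length on one half-circle. -/
noncomputable def arcMeasure : Measure ℝ := volume.restrict (Icc 0 Real.pi)

/-- The state space `L²(Γ)`, the Hilbert sum of the spaces `L²(0, π)` over all edges. -/
abbrev ChainL2 : Type := lp (fun _ : ChainEdge => Lp ℂ 2 arcMeasure) 2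

/-- The quasiderivative is `d/dx + i A` on the upper half-circles and `d/dx - i A` on the lower
ones. -/
def edgePotential (A : ℝ) (e : ChainEdge) : ℝ := if e.2 then A else -A

/-- `u` lies in the domain of the magnetic Laplacian with the field parameter `A` and with a
`δ`-coupling of strength `a j` at each vertex `j`, and `f = -𝒟² u`.

`U` is the continuously differentiable representative of `u` and `W = 𝒟 U`. The function `W` is
absolutely continuous with `𝒟 W = -f` almost everywhere, so that `U` belongs to `H²` of each edge.
At the vertices the function is continuous and the quasiderivatives satisfy the `δ`-condition. -/
def IsLaplacianPair (A : ℝ) (a : ℤ → ℝ) (u f : ChainL2) : Prop :=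
  ∃ U W : ChainEdge → ℝ → ℂ,
    (∀ e, (u e : ℝ → ℂ) =ᵐ[arcMeasure] U e) ∧
    (∀ e, ∀ x ∈ Icc (0 : ℝ) Real.pi,
      HasDerivWithinAt (U e) (W e x - Complex.I * (edgePotential A e : ℂ) * U e x)
        (Icc 0 Real.pi) x) ∧
    (∀ e, ContinuousOn (W e) (Icc 0 Real.pi)) ∧
    (∀ e, ∀ x ∈ Icc (0 : ℝ) Real.pi,
      W e x = W e 0 +
        ∫ t in (0 : ℝ)..x, (-(f e : ℝ → ℂ) t - Complex.I * (edgePotential A e : ℂ) * W e t)) ∧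
    (∀ j : ℤ, U (j, false) 0 = U (j, true) 0 ∧ U (j - 1, true) Real.pi = U (j, true) 0 ∧
      U (j - 1, false) Real.pi = U (j, true) 0) ∧
    (∀ j : ℤ, W (j, true) 0 + W (j, false) 0 - W (j - 1, true) Real.pi - W (j - 1, false) Real.pi
      = (a j : ℂ) * U (j, true) 0)

theorem intervalIntegrable_of_edge (f : Lp ℂ 2 arcMeasure) {x : ℝ} (hx : x ∈ Icc (0 : ℝ) Real.pi) :
    IntervalIntegrable (f : ℝ → ℂ) volume 0 x := by
  have : IsFiniteMeasure arcMeasure := by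
    unfold arcMeasure
    infer_instance
  have h1 : Integrable (f : ℝ → ℂ) arcMeasure := (Lp.memLp f).integrable (by norm_num)
  rw [intervalIntegrable_iff_integrableOn_Icc_of_le hx.1]
  exact IntegrableOn.mono_set h1 (Icc_subset_Icc_right hx.2)

theorem intervalIntegrable_of_continuousOn_edge {W : ℝ → ℂ}
    (hW : ContinuousOn W (Icc 0 Real.pi)) {x : ℝ} (hx : x ∈ Icc (0 : ℝ) Real.pi) :
    IntervalIntegrable W volume 0 x :=
  (hW.mono (by rw [uIcc_of_le hx.1]; exact Icc_subset_Icc_right hx.2)).intervalIntegrable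

theorem IsLaplacianPair.add {A : ℝ} {a : ℤ → ℝ} {u f v g : ChainL2}
    (h : IsLaplacianPair A a u f) (k : IsLaplacianPair A a v g) :
    IsLaplacianPair A a (u + v) (f + g) := by
  obtain ⟨U, W, h1, h2, h3, h4, h5, h6⟩ := h
  obtain ⟨V, X, k1, k2, k3, k4, k5, k6⟩ := k
  refine ⟨fun e x => U e x + V e x, fun e x => W e x + X e x, ?_, ?_, ?_, ?_, ?_, ?_⟩
  · intro e
    filter_upwards [Lp.coeFn_add (u e) (v e), h1 e, k1 e] with x hx ha hb
    rw [lp.coeFn_add, Pi.add_apply, hx, Pi.add_apply, ha, hb]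
  · intro e x hx
    exact ((h2 e x hx).add (k2 e x hx)).congr_deriv (by ring)
  · intro e
    exact (h3 e).add (k3 e)
  · intro e x hx
    have i1 : IntervalIntegrable (fun t => -(f e : ℝ → ℂ) t
        - Complex.I * (edgePotential A e : ℂ) * W e t) volume 0 x :=
      (intervalIntegrable_of_edge _ hx).neg.sub
        ((intervalIntegrable_of_continuousOn_edge (h3 e) hx).const_mul _)
    have i2 : IntervalIntegrable (fun t => -(g e : ℝ → ℂ) t
        - Complex.I * (edgePotential A e : ℂ) * X e t) volume 0 x :=
      (intervalIntegrable_of_edge _ hx).neg.sub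
        ((intervalIntegrable_of_continuousOn_edge (k3 e) hx).const_mul _)
    have key : (∫ t in (0 : ℝ)..x, (-((f + g) e : ℝ → ℂ) t
        - Complex.I * (edgePotential A e : ℂ) * (W e t + X e t)))
        = ∫ t in (0 : ℝ)..x, ((-(f e : ℝ → ℂ) t - Complex.I * (edgePotential A e : ℂ) * W e t)
          + (-(g e : ℝ → ℂ) t - Complex.I * (edgePotential A e : ℂ) * X e t)) := by
      apply intervalIntegral.integral_congr_ae
      have hc' := (ae_restrict_iff' measurableSet_Icc).1 (Lp.coeFn_add (f e) (g e))
      filter_upwards [hc'] with t ht htx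
      rw [uIoc_of_le hx.1] at htx
      rw [lp.coeFn_add, Pi.add_apply]
      have := ht ⟨htx.1.le, htx.2.trans hx.2⟩
      rw [this, Pi.add_apply]
      ring
    rw [key, intervalIntegral.integral_add i1 i2]
    show W e x + X e x = W e 0 + X e 0 + _
    rw [h4 e x hx, k4 e x hx]
    ring
  · intro j
    refine ⟨?_, ?_, ?_⟩
    · show U _ _ + V _ _ = U _ _ + V _ _
      rw [(h5 j).1, (k5 j).1]
    · show U _ _ + V _ _ = U _ _ + V _ _
      rw [(h5 j).2.1, (k5 j).2.1]
    · show U _ _ + V _ _ = U _ _ + V _ _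
      rw [(h5 j).2.2, (k5 j).2.2]
  · intro j
    linear_combination h6 j + k6 j

theorem IsLaplacianPair.smul {A : ℝ} {a : ℤ → ℝ} {u f : ChainL2} (c : ℂ)
    (h : IsLaplacianPair A a u f) : IsLaplacianPair A a (c • u) (c • f) := by
  obtain ⟨U, W, h1, h2, h3, h4, h5, h6⟩ := h
  refine ⟨fun e x => c * U e x, fun e x => c * W e x, ?_, ?_, ?_, ?_, ?_, ?_⟩
  · intro e
    filter_upwards [Lp.coeFn_smul c (u e), h1 e] with x hx ha
    rw [lp.coeFn_smul, Pi.smul_apply, hx, Pi.smul_apply, ha, smul_eq_mul]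
  · intro e x hx
    exact ((h2 e x hx).const_mul c).congr_deriv (by ring)
  · intro e
    exact continuousOn_const.mul (h3 e)
  · intro e x hx
    have key : (∫ t in (0 : ℝ)..x, (-((c • f) e : ℝ → ℂ) t
        - Complex.I * (edgePotential A e : ℂ) * (c * W e t)))
        = ∫ t in (0 : ℝ)..x,
          c * (-(f e : ℝ → ℂ) t - Complex.I * (edgePotential A e : ℂ) * W e t) := by
      apply intervalIntegral.integral_congr_ae
      have hc' := (ae_restrict_iff' measurableSet_Icc).1 (Lp.coeFn_smul c (f e))
      filter_upwards [hc'] with t ht htx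
      rw [uIoc_of_le hx.1] at htx
      rw [lp.coeFn_smul, Pi.smul_apply]
      have := ht ⟨htx.1.le, htx.2.trans hx.2⟩
      rw [this, Pi.smul_apply, smul_eq_mul]
      ring
    rw [key, intervalIntegral.integral_const_mul]
    show c * W e x = c * W e 0 + _
    rw [h4 e x hx]
    ring
  · intro j
    refine ⟨?_, ?_, ?_⟩
    · show c * U _ _ = c * U _ _
      rw [(h5 j).1]
    · show c * U _ _ = c * U _ _
      rw [(h5 j).2.1]
    · show c * U _ _ = c * U _ _
      rw [(h5 j).2.2]
  · intro j
    linear_combination c * h6 j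

theorem IsLaplacianPair.zero (A : ℝ) (a : ℤ → ℝ) : IsLaplacianPair A a 0 0 := by
  refine ⟨fun _ _ => 0, fun _ _ => 0, ?_, ?_, ?_, ?_, ?_, ?_⟩
  · intro e
    filter_upwards [Lp.coeFn_zero ℂ 2 arcMeasure] with x hx
    rw [lp.coeFn_zero, Pi.zero_apply, hx, Pi.zero_apply]
  · intro e x _
    exact (hasDerivWithinAt_const x (Icc 0 Real.pi) (0 : ℂ)).congr_deriv (by ring)
  · intro e
    exact continuousOn_const
  · intro e x hx
    have key : (∫ t in (0 : ℝ)..x, (-((0 : ChainL2) e : ℝ → ℂ) t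
        - Complex.I * (edgePotential A e : ℂ) * 0)) = ∫ t in (0 : ℝ)..x, (0 : ℂ) := by
      apply intervalIntegral.integral_congr_ae
      have hc' := (ae_restrict_iff' measurableSet_Icc).1 (Lp.coeFn_zero ℂ 2 arcMeasure)
      filter_upwards [hc'] with t ht htx
      rw [uIoc_of_le hx.1] at htx
      rw [lp.coeFn_zero, Pi.zero_apply]
      have := ht ⟨htx.1.le, htx.2.trans hx.2⟩
      rw [this, Pi.zero_apply]
      ring
    rw [key]
    simp
  · intro j
    simp
  · intro j
    simp

/-- The Hamiltonian of the chain with field parameter `A` and coupling constants `a`, given by its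
graph, the linear space of all pairs `(u, -𝒟² u)` with `u` in the domain. -/
noncomputable def chainHamiltonian (A : ℝ) (a : ℤ → ℝ) : Submodule ℂ (ChainL2 × ChainL2) where
  carrier := {p | IsLaplacianPair A a p.1 p.2}
  add_mem' := fun h k => IsLaplacianPair.add h k
  zero_mem' := IsLaplacianPair.zero A a
  smul_mem' := fun c _ h => IsLaplacianPair.smul c h

/-- The eigenspace `ker (T - E)` of an operator given by its graph. -/
noncomputable def graphEigenspace (T : Submodule ℂ (ChainL2 × ChainL2)) (E : ℝ) : Submodule ℂ ChainL2 :=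
  T.comap (LinearMap.prod LinearMap.id ((E : ℂ) • LinearMap.id))

/-- The essential spectrum of a self-adjoint operator given by its graph: the set of all real `E`
that admit a singular Weyl sequence, that is, unit vectors `u i` in the domain that converge weakly
to `0` and satisfy `(T - E) u i → 0` in norm. -/
def essentialSpectrum (T : Submodule ℂ (ChainL2 × ChainL2)) : Set ℝ :=
  {E | ∃ u f : ℕ → ChainL2, (∀ i, (u i, f i) ∈ T) ∧ (∀ i, ‖u i‖ = 1) ∧
    (∀ g : ChainL2, Tendsto (fun i => inner ℂ g (u i)) atTop (𝓝 0)) ∧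
    Tendsto (fun i => f i - (E : ℂ) • u i) atTop (𝓝 0)}

/-- A gap of the essential spectrum: a connected component of its complement in `ℝ`. -/
def IsSpectralGap (T : Submodule ℂ (ChainL2 × ChainL2)) (I : Set ℝ) : Prop :=
  ∃ E ∈ (essentialSpectrum T)ᶜ, I = connectedComponentIn (essentialSpectrum T)ᶜ E

/-- The numbering of the gaps of a chain with constant coupling. The zeroth gap is the one below
the whole spectrum; for `m ≥ 1` the gaps number `2 m - 1` and `2 m` are the ones whose upper,
respectively lower, end is the infinitely degenerate eigenvalue `m ^ 2`. This is the order in which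
the gaps follow each other for a noninteger field parameter; gaps that are closed for an integer
one keep their numbers. -/
def IsGapNumber (I : Set ℝ) (l : ℕ) : Prop :=
  (l = 0 ∧ ¬ BddBelow I) ∨
    ∃ m : ℕ, 1 ≤ m ∧
      ((l + 1 = 2 * m ∧ IsLUB I ((m : ℝ) ^ 2)) ∨ (l = 2 * m ∧ IsGLB I ((m : ℝ) ^ 2)))

/-- Coupling constants of the chain with two distant impurities: `α + γ₁` at the vertex `j`,
`α + γ₂` at the vertex `j + n + 1`, so that there are exactly `n` vertices in between, and `α` at
all other vertices. -/
noncomputable def distantCoupling (α γ₁ γ₂ : ℝ) (n : ℕ) (j : ℤ) (i : ℤ) : ℝ :=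
  if i = j then α + γ₁ else if i = j + n + 1 then α + γ₂ else α

/-- The periodic Hamiltonian `-Δ_α`. -/
noncomputable def periodicHamiltonian (A α : ℝ) : Submodule ℂ (ChainL2 × ChainL2) :=
  chainHamiltonian A (fun _ => α)

/-- The Hamiltonian `-Δ_{α,n}` with two impurities separated by `n` vertices, the first of them
being at the vertex `j`. -/
noncomputable def distantHamiltonian (A α γ₁ γ₂ : ℝ) (n : ℕ) (j : ℤ) :
    Submodule ℂ (ChainL2 × ChainL2) :=
  chainHamiltonian A (distantCoupling α γ₁ γ₂ n j)

/-- The eigenvalues of `T` that lie in `I`. -/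
def eigenvaluesIn (T : Submodule ℂ (ChainL2 × ChainL2)) (I : Set ℝ) : Set ℝ :=
  {E | E ∈ I ∧ graphEigenspace T E ≠ ⊥}

/-- `T` has precisely `r` eigenvalues in `I`, and all of them are simple. -/
def HasSimpleEigenvalues (T : Submodule ℂ (ChainL2 × ChainL2)) (I : Set ℝ) (r : ℕ) : Prop :=
  (eigenvaluesIn T I).encard = r ∧
    ∀ E ∈ eigenvaluesIn T I, Module.finrank ℂ (graphEigenspace T E) = 1

/-! Solving the equation on every edge reduces the operator to a scalar difference equation for the
vertex values `V j`. With `c`, `s` the values of `edgeCos`, `edgeSin` at `π`, an eigenfunction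
satisfies `σ (V (j+1) + V (j-1)) - 2 ξ V j = (s/2) (a j - α) V j`, where `ξ = c + α s / 4` is the
`discriminant` and `σ = (-1)^A`. Integrality of `A` makes both half-circles of a ring carry the same
sign `σ`, and only `σ² = 1` matters in the end.

Essential spectrum: if `|ξ| ≤ 1`, truncated plane waves, or states living on a single ring where `s
= 0`, give singular Weyl sequences far away from the impurities. If `|ξ| > 1`, the difference
operator is coercive, and the impurities contribute only finitely many vertex values, which tend to
zero along such a sequence. Hence the essential spectrum is `{|ξ| ≤ 1}` with or without impurities
(`essentialSpectrum_chainHamiltonian`).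

Eigenvalues: for `|ξ| > 1` take `|l| < 1` with `l + 1/l = 2 ξ`. Then `(σ l)^|i|` is a Green function
of the difference equation, an eigenfunction is a combination of two copies of it centred at the
impurities, and its two coefficients solve a `2 × 2` system whose determinant is the secular
equation (`graphEigenspace_ne_bot_iff`). The value at one impurity determines the eigenfunction, so
eigenvalues are simple.

Parity of the gaps: `ξ - 1` and `ξ + 1` equal `s` times `lowerFactor` and `upperFactor`. By
Wronskian identities both factors decrease strictly between consecutive squares, and a gap is an
interval where they have a common sign `ε`. The order of the two factors shows that `ε = 1` for the
gap at the left end of such an interval (even number) and `ε = -1` for the one at the right end (odd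
number). With `a`, `b` the roots of `ε` times the factors, `l = (b - a)/(b + a)` and the secular
equation becomes `(4ab - β₁)(4ab - β₂) = β₁ β₂ l^(2(n+1))`, where `βᵢ = -ε γᵢ`.

Counting: dividing by `β₁ β₂ (4ab)²` and completing the square splits this equation into two
branches `secularBranch (±1) = (1/β₁ + 1/β₂)/2`. Both are strictly monotone along the gap for every
`n` (`secularBranch_lt`), so each has at most one root, and the intermediate value theorem decides
about existence for large `n`. Opposite signs leave one branch, two positive `βᵢ` leave both, two
negative ones none. If `β₁ = β₂ = β > 0`, then `|4ab - β| = β |l|^(n+1)` is exponentially small on a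
compact part of the gap that contains all roots, and the slope of `(ab)²` is bounded below there. -/

/-! ### Fundamental solutions on an edge and monotonicity in the energy -/

/-- The solution of `y'' = -E y` with `y 0 = 1` and `y' 0 = 0`. -/
noncomputable def edgeCos (E x : ℝ) : ℝ := Real.cos (√E * x) * Real.cosh (√(-E) * x)

/-- The solution of `y'' = -E y` with `y 0 = 0` and `y' 0 = 1`. -/
noncomputable def edgeSin (E x : ℝ) : ℝ := ∫ t in (0 : ℝ)..x, edgeCos E t

theorem edgeCos_zero (E : ℝ) : edgeCos E 0 = 1 := by simp [edgeCos]

theorem edgeSin_zero (E : ℝ) : edgeSin E 0 = 0 := by simp [edgeSin]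

theorem continuous_edgeCos : Continuous (fun p : ℝ × ℝ => edgeCos p.1 p.2) := by
  unfold edgeCos
  have := Real.continuous_cosh
  fun_prop

theorem continuous_edgeCos_right (E : ℝ) : Continuous (edgeCos E) :=
  continuous_edgeCos.comp (by fun_prop : Continuous fun x : ℝ => (E, x))

theorem continuous_edgeCos_left (x : ℝ) : Continuous (fun E => edgeCos E x) :=
  continuous_edgeCos.comp (by fun_prop : Continuous fun E : ℝ => (E, x))

theorem continuous_edgeSin : Continuous (fun p : ℝ × ℝ => edgeSin p.1 p.2) := by
  unfold edgeSin
  exact intervalIntegral.continuous_parametric_intervalIntegral_of_continuous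
    (f := fun (p : ℝ × ℝ) t => edgeCos p.1 t)
    (continuous_edgeCos.comp (by fun_prop : Continuous fun q : (ℝ × ℝ) × ℝ => (q.1.1, q.2)))
    continuous_snd

theorem continuous_edgeSin_right (E : ℝ) : Continuous (edgeSin E) :=
  continuous_edgeSin.comp (by fun_prop : Continuous fun x : ℝ => (E, x))

theorem continuous_edgeSin_left (x : ℝ) : Continuous (fun E => edgeSin E x) :=
  continuous_edgeSin.comp (by fun_prop : Continuous fun E : ℝ => (E, x))

theorem hasDerivAt_edgeSin (E x : ℝ) : HasDerivAt (edgeSin E) (edgeCos E x) x :=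
  (continuous_edgeCos_right E).integral_hasStrictDerivAt 0 x |>.hasDerivAt

theorem edgeCos_of_nonneg {E : ℝ} (hE : 0 ≤ E) (x : ℝ) : edgeCos E x = Real.cos (√E * x) := by
  simp [edgeCos, Real.sqrt_eq_zero_of_nonpos (neg_nonpos.2 hE)]

theorem edgeCos_of_nonpos {E : ℝ} (hE : E ≤ 0) (x : ℝ) : edgeCos E x = Real.cosh (√(-E) * x) := by
  simp [edgeCos, Real.sqrt_eq_zero_of_nonpos hE]

theorem edgeSin_of_pos {E : ℝ} (hE : 0 < E) (x : ℝ) : edgeSin E x = Real.sin (√E * x) / √E := by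
  have h0 : √E ≠ 0 := (Real.sqrt_pos.2 hE).ne'
  unfold edgeSin
  have : ∀ t ∈ uIcc 0 x, HasDerivAt (fun t => Real.sin (√E * t) / √E) (edgeCos E t) t := by
    intro t _
    rw [edgeCos_of_nonneg hE.le]
    have := (((hasDerivAt_id t).const_mul (√E)).sin).div_const (√E)
    refine this.congr_deriv ?_
    simp only [id]
    field_simp
  rw [intervalIntegral.integral_eq_sub_of_hasDerivAt this
    ((continuous_edgeCos_right E).intervalIntegrable _ _)]
  simp

theorem edgeSin_of_neg {E : ℝ} (hE : E < 0) (x : ℝ) :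
    edgeSin E x = Real.sinh (√(-E) * x) / √(-E) := by
  have h0 : √(-E) ≠ 0 := (Real.sqrt_pos.2 (neg_pos.2 hE)).ne'
  unfold edgeSin
  have : ∀ t ∈ uIcc 0 x, HasDerivAt (fun t => Real.sinh (√(-E) * t) / √(-E)) (edgeCos E t) t := by
    intro t _
    rw [edgeCos_of_nonpos hE.le]
    have := (((hasDerivAt_id t).const_mul (√(-E))).sinh).div_const (√(-E))
    refine this.congr_deriv ?_
    simp only [id]
    field_simp
  rw [intervalIntegral.integral_eq_sub_of_hasDerivAt this
    ((continuous_edgeCos_right E).intervalIntegrable _ _)]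
  simp

theorem edgeSin_zero_left (x : ℝ) : edgeSin 0 x = x := by
  simp [edgeSin, edgeCos]

theorem hasDerivAt_edgeCos (E x : ℝ) : HasDerivAt (edgeCos E) (-E * edgeSin E x) x := by
  rcases lt_trichotomy E 0 with hE | hE | hE
  · have h0 : √(-E) ≠ 0 := (Real.sqrt_pos.2 (neg_pos.2 hE)).ne'
    have h1 : edgeCos E = fun x => Real.cosh (√(-E) * x) := funext (edgeCos_of_nonpos hE.le)
    rw [h1, edgeSin_of_neg hE]
    refine (((hasDerivAt_id x).const_mul (√(-E))).cosh).congr_deriv ?_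
    have h2 : √(-E) * √(-E) = -E := Real.mul_self_sqrt (neg_pos.2 hE).le
    simp only [id]
    field_simp
    rw [pow_two, h2]
    ring
  · subst hE
    have h1 : edgeCos 0 = fun _ => 1 := funext fun x => by simp [edgeCos]
    rw [h1]
    exact (hasDerivAt_const x (1 : ℝ)).congr_deriv (by simp)
  · have h0 : √E ≠ 0 := (Real.sqrt_pos.2 hE).ne'
    have h1 : edgeCos E = fun x => Real.cos (√E * x) := funext (edgeCos_of_nonneg hE.le)
    rw [h1, edgeSin_of_pos hE]
    refine (((hasDerivAt_id x).const_mul (√E)).cos).congr_deriv ?_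
    have h2 : √E * √E = E := Real.mul_self_sqrt hE.le
    simp only [id]
    field_simp
    rw [pow_two, h2]
    ring

theorem edgeCos_sq_add (E x : ℝ) : edgeCos E x ^ 2 + E * edgeSin E x ^ 2 = 1 := by
  have hd : ∀ y, HasDerivAt (fun x => edgeCos E x ^ 2 + E * edgeSin E x ^ 2) 0 y := fun y =>
    (((hasDerivAt_edgeCos E y).pow 2).add
      (((hasDerivAt_edgeSin E y).pow 2).const_mul E)).congr_deriv (by ring)
  have := is_const_of_deriv_eq_zero (fun y => (hd y).differentiableAt) (fun y => (hd y).deriv) x 0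
  simpa [edgeCos_zero, edgeSin_zero] using this

/-- Angle addition: the solution of `y'' = -E y` is determined by its Cauchy data. -/
theorem edge_add (E y x : ℝ) :
    edgeCos E (y + x) = edgeCos E y * edgeCos E x - E * edgeSin E y * edgeSin E x ∧
    edgeSin E (y + x) = edgeSin E y * edgeCos E x + edgeCos E y * edgeSin E x := by
  have dC : ∀ t, HasDerivAt (fun t => edgeCos E (y + x - t)) (E * edgeSin E (y + x - t)) t :=
    fun t => ((hasDerivAt_edgeCos E (y + x - t)).scomp t
      ((hasDerivAt_id t).const_sub (y + x))).congr_deriv (by simp)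
  have dS : ∀ t, HasDerivAt (fun t => edgeSin E (y + x - t)) (-edgeCos E (y + x - t)) t :=
    fun t => ((hasDerivAt_edgeSin E (y + x - t)).scomp t
      ((hasDerivAt_id t).const_sub (y + x))).congr_deriv (by simp)
  have h1 : ∀ t, HasDerivAt (fun t => edgeCos E (y + x - t) * edgeCos E t
      - E * edgeSin E (y + x - t) * edgeSin E t) 0 t := fun t =>
    (((dC t).mul (hasDerivAt_edgeCos E t)).sub
      (((dS t).const_mul E).mul (hasDerivAt_edgeSin E t))).congr_deriv (by ring)
  have h2 : ∀ t, HasDerivAt (fun t => edgeSin E (y + x - t) * edgeCos E t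
      + edgeCos E (y + x - t) * edgeSin E t) 0 t := fun t =>
    (((dS t).mul (hasDerivAt_edgeCos E t)).add
      ((dC t).mul (hasDerivAt_edgeSin E t))).congr_deriv (by ring)
  have k1 := is_const_of_deriv_eq_zero (fun t => (h1 t).differentiableAt)
    (fun t => (h1 t).deriv) 0 x
  have k2 := is_const_of_deriv_eq_zero (fun t => (h2 t).differentiableAt)
    (fun t => (h2 t).deriv) 0 x
  simp only [edgeCos_zero, edgeSin_zero, sub_zero, mul_one, mul_zero, add_zero,
    add_sub_cancel_right] at k1 k2
  exact ⟨k1, k2⟩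

theorem edgeCos_pi (E : ℝ) :
    edgeCos E Real.pi = edgeCos E (Real.pi / 2) ^ 2 - E * edgeSin E (Real.pi / 2) ^ 2 := by
  have := (edge_add E (Real.pi / 2) (Real.pi / 2)).1
  rw [add_halves] at this
  rw [this]; ring

theorem edgeSin_pi (E : ℝ) :
    edgeSin E Real.pi = 2 * edgeSin E (Real.pi / 2) * edgeCos E (Real.pi / 2) := by
  have := (edge_add E (Real.pi / 2) (Real.pi / 2)).2
  rw [add_halves] at this
  rw [this]; ring

/-- Divided by `edgeCos E x * edgeCos F x` at `x = π / 2`, this is the increment of `edgeTan`. Its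
derivative is therefore the integral of a square over a square. This identity and its sine analogue
are the source of all monotonicity in `E`. -/
theorem edge_wronskian_cos (E F x : ℝ) :
    E * edgeSin E x * edgeCos F x - F * edgeSin F x * edgeCos E x
      = (E - F) * ∫ t in (0 : ℝ)..x, edgeCos E t * edgeCos F t := by
  have hd : ∀ t ∈ uIcc 0 x, HasDerivAt
      (fun t => E * edgeSin E t * edgeCos F t - F * edgeSin F t * edgeCos E t)
      ((E - F) * (edgeCos E t * edgeCos F t)) t := fun t _ =>
    ((((hasDerivAt_edgeSin E t).const_mul E).mul (hasDerivAt_edgeCos F t)).sub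
      (((hasDerivAt_edgeSin F t).const_mul F).mul (hasDerivAt_edgeCos E t))).congr_deriv (by ring)
  have hc : Continuous fun t => (E - F) * (edgeCos E t * edgeCos F t) :=
    continuous_const.mul ((continuous_edgeCos_right E).mul (continuous_edgeCos_right F))
  rw [← intervalIntegral.integral_const_mul,
    intervalIntegral.integral_eq_sub_of_hasDerivAt hd (hc.intervalIntegrable _ _)]
  simp [edgeSin_zero]

theorem edge_wronskian_sin (E F x : ℝ) :
    edgeCos E x * edgeSin F x - edgeCos F x * edgeSin E x
      = -((E - F) * ∫ t in (0 : ℝ)..x, edgeSin E t * edgeSin F t) := by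
  have hd : ∀ t ∈ uIcc 0 x, HasDerivAt
      (fun t => edgeCos E t * edgeSin F t - edgeCos F t * edgeSin E t)
      (-(E - F) * (edgeSin E t * edgeSin F t)) t := fun t _ =>
    (((hasDerivAt_edgeCos E t).mul (hasDerivAt_edgeSin F t)).sub
      ((hasDerivAt_edgeCos F t).mul (hasDerivAt_edgeSin E t))).congr_deriv (by ring)
  have hc : Continuous fun t => -(E - F) * (edgeSin E t * edgeSin F t) :=
    continuous_const.mul ((continuous_edgeSin_right E).mul (continuous_edgeSin_right F))
  rw [← neg_mul, ← intervalIntegral.integral_const_mul,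
    intervalIntegral.integral_eq_sub_of_hasDerivAt hd (hc.intervalIntegrable _ _)]
  simp [edgeSin_zero]

/-- The Dirichlet-to-Neumann quantity of half an edge with a Neumann condition at its end. -/
noncomputable def edgeTan (E : ℝ) : ℝ := E * edgeSin E (Real.pi / 2) / edgeCos E (Real.pi / 2)

/-- The Dirichlet-to-Neumann quantity of half an edge with a Dirichlet condition at its end. -/
noncomputable def edgeCot (E : ℝ) : ℝ := edgeCos E (Real.pi / 2) / edgeSin E (Real.pi / 2)

theorem continuous_integral_edge_mul {g : ℝ → ℝ → ℝ}
    (hg : Continuous fun p : ℝ × ℝ => g p.1 p.2) (x : ℝ) :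
    Continuous (fun p : ℝ × ℝ => ∫ t in (0 : ℝ)..x, g p.1 t * g p.2 t) := by
  refine intervalIntegral.continuous_parametric_intervalIntegral_of_continuous'
    (f := fun (p : ℝ × ℝ) t => g p.1 t * g p.2 t) ?_ 0 x
  exact (hg.comp (by fun_prop : Continuous fun q : (ℝ × ℝ) × ℝ => (q.1.1, q.2))).mul
    (hg.comp (by fun_prop : Continuous fun q : (ℝ × ℝ) × ℝ => (q.1.2, q.2)))

/-- Lets the Wronskian identities yield derivatives in `E` without differentiating the fundamental
solutions in their parameter, since only continuity of the quotient is needed. -/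
theorem hasDerivAt_of_factor {f : ℝ → ℝ} {h : ℝ → ℝ} {E : ℝ} (hc : ContinuousAt h E)
    (hf : ∀ᶠ F in 𝓝 E, f F - f E = (F - E) * h F) : HasDerivAt f (h E) E := by
  rw [hasDerivAt_iff_tendsto_slope]
  refine (hc.tendsto.mono_left nhdsWithin_le_nhds).congr' ?_
  filter_upwards [hf.filter_mono nhdsWithin_le_nhds, self_mem_nhdsWithin] with F hF hne
  have : F - E ≠ 0 := sub_ne_zero.2 hne
  rw [slope_def_field, hF]
  field_simp

theorem hasDerivAt_edgeTan {E : ℝ} (hE : edgeCos E (Real.pi / 2) ≠ 0) :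
    HasDerivAt edgeTan ((∫ t in (0 : ℝ)..(Real.pi / 2), edgeCos E t * edgeCos E t)
      / (edgeCos E (Real.pi / 2) * edgeCos E (Real.pi / 2))) E := by
  have hC := continuous_edgeCos_left (Real.pi / 2)
  have hI := (continuous_integral_edge_mul continuous_edgeCos (Real.pi / 2)).comp
    (by fun_prop : Continuous fun F : ℝ => (F, E))
  refine hasDerivAt_of_factor (h := fun F => (∫ t in (0 : ℝ)..(Real.pi / 2),
      edgeCos F t * edgeCos E t) / (edgeCos F (Real.pi / 2) * edgeCos E (Real.pi / 2))) ?_ ?_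
  · exact hI.continuousAt.div (hC.continuousAt.mul continuousAt_const) (mul_ne_zero hE hE)
  · filter_upwards [hC.continuousAt.eventually_ne hE] with F hF
    have := edge_wronskian_cos F E (Real.pi / 2)
    unfold edgeTan
    rw [← mul_div_assoc, ← this]
    field_simp

theorem hasDerivAt_edgeCot {E : ℝ} (hE : edgeSin E (Real.pi / 2) ≠ 0) :
    HasDerivAt edgeCot (-(∫ t in (0 : ℝ)..(Real.pi / 2), edgeSin E t * edgeSin E t)
      / (edgeSin E (Real.pi / 2) * edgeSin E (Real.pi / 2))) E := by
  have hC := continuous_edgeSin_left (Real.pi / 2)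
  have hI := (continuous_integral_edge_mul continuous_edgeSin (Real.pi / 2)).comp
    (by fun_prop : Continuous fun F : ℝ => (F, E))
  refine hasDerivAt_of_factor (h := fun F => -(∫ t in (0 : ℝ)..(Real.pi / 2),
      edgeSin F t * edgeSin E t) / (edgeSin F (Real.pi / 2) * edgeSin E (Real.pi / 2))) ?_ ?_
  · exact hI.neg.continuousAt.div (hC.continuousAt.mul continuousAt_const) (mul_ne_zero hE hE)
  · filter_upwards [hC.continuousAt.eventually_ne hE] with F hF
    have := edge_wronskian_sin F E (Real.pi / 2)
    unfold edgeCot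
    rw [← mul_div_assoc, mul_neg, ← this]
    field_simp

theorem integral_edgeCos_sq_pos (E : ℝ) :
    0 < ∫ t in (0 : ℝ)..(Real.pi / 2), edgeCos E t * edgeCos E t := by
  refine intervalIntegral.integral_pos (by positivity)
    ((continuous_edgeCos_right E).mul (continuous_edgeCos_right E)).continuousOn
    (fun t _ => mul_self_nonneg _) ⟨0, ⟨le_rfl, by positivity⟩, by simp [edgeCos_zero]⟩

theorem integral_edgeSin_sq_pos {E : ℝ} (hE : edgeSin E (Real.pi / 2) ≠ 0) :
    0 < ∫ t in (0 : ℝ)..(Real.pi / 2), edgeSin E t * edgeSin E t :=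
  intervalIntegral.integral_pos (by positivity)
    ((continuous_edgeSin_right E).mul (continuous_edgeSin_right E)).continuousOn
    (fun t _ => mul_self_nonneg _)
    ⟨Real.pi / 2, ⟨by positivity, le_rfl⟩, mul_self_pos.2 hE⟩

theorem deriv_edgeTan_pos {E : ℝ} (hE : edgeCos E (Real.pi / 2) ≠ 0) : 0 < deriv edgeTan E := by
  rw [(hasDerivAt_edgeTan hE).deriv]
  exact div_pos (integral_edgeCos_sq_pos E) (mul_self_pos.2 hE)

theorem deriv_edgeCot_neg {E : ℝ} (hE : edgeSin E (Real.pi / 2) ≠ 0) : deriv edgeCot E < 0 := by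
  rw [(hasDerivAt_edgeCot hE).deriv]
  exact div_neg_of_neg_of_pos (neg_neg_of_pos (integral_edgeSin_sq_pos hE)) (mul_self_pos.2 hE)

/-- The derivative is continuous and positive, so it has a positive minimum on a compact interval.
Such lower slope bounds later convert closeness of the secular quantity into closeness of
eigenvalues. -/
theorem exists_edgeTan_slope {l r : ℝ} (h : ∀ E ∈ Icc l r, edgeCos E (Real.pi / 2) ≠ 0) :
    ∃ k > 0, ∀ E ∈ Icc l r, ∀ F ∈ Icc l r, k * |E - F| ≤ |edgeTan E - edgeTan F| := by
  have hcont : ContinuousOn (fun E => (∫ t in (0 : ℝ)..(Real.pi / 2), edgeCos E t * edgeCos E t)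
      / (edgeCos E (Real.pi / 2) * edgeCos E (Real.pi / 2))) (Icc l r) := by
    refine ContinuousOn.div ?_ ?_ fun E hE => mul_ne_zero (h E hE) (h E hE)
    · exact ((continuous_integral_edge_mul continuous_edgeCos (Real.pi / 2)).comp
        (by fun_prop : Continuous fun F : ℝ => (F, F))).continuousOn
    · exact ((continuous_edgeCos_left _).mul (continuous_edgeCos_left _)).continuousOn
  obtain ⟨k, hk, hkb⟩ : ∃ k > 0, ∀ E ∈ Icc l r, k ≤ deriv edgeTan E := by
    rcases (Icc l r).eq_empty_or_nonempty with he | hne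
    · exact ⟨1, one_pos, by simp [he]⟩
    · obtain ⟨E₀, hE₀, hmin⟩ := isCompact_Icc.exists_isMinOn hne hcont
      refine ⟨_, deriv_edgeTan_pos (h E₀ hE₀), fun E hE => ?_⟩
      rw [(hasDerivAt_edgeTan (h E hE)).deriv, (hasDerivAt_edgeTan (h E₀ hE₀)).deriv]
      exact hmin hE
  have mono : ∀ E ∈ Icc l r, ∀ F ∈ Icc l r, E ≤ F → k * (F - E) ≤ edgeTan F - edgeTan E :=
    (convex_Icc l r).mul_sub_le_image_sub_of_le_deriv
      (fun E hE => (hasDerivAt_edgeTan (h E hE)).continuousAt.continuousWithinAt)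
      (fun E hE => (hasDerivAt_edgeTan
        (h E (interior_subset hE))).differentiableAt.differentiableWithinAt)
      (fun E hE => hkb E (interior_subset hE))
  refine ⟨k, hk, fun E hE F hF => ?_⟩
  rcases le_total E F with hEF | hEF
  · rw [abs_sub_comm E, abs_sub_comm (edgeTan E), abs_of_nonneg (sub_nonneg.2 hEF)]
    exact (mono E hE F hF hEF).trans (le_abs_self _)
  · rw [abs_of_nonneg (sub_nonneg.2 hEF)]
    exact (mono F hF E hE hEF).trans (le_abs_self _)

/-! ### Green's identity and variation of constants with a magnetic gauge -/

/-- Integration by parts against a primitive of a merely integrable `F`: Fubini for `φ' t * F r` on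
the triangle `r ≤ t`. It is needed because the quasiderivative is only absolutely continuous. -/
theorem integral_mul_eq_sub_integral_deriv_mul_primitive {φ φ' F : ℝ → ℂ} {x : ℝ} (hx : 0 ≤ x)
    (hφ : ∀ t, HasDerivAt φ (φ' t) t) (hc : Continuous φ')
    (hF : IntervalIntegrable F volume 0 x) :
    ∫ t in (0 : ℝ)..x, φ t * F t
      = φ x * (∫ t in (0 : ℝ)..x, F t) - ∫ t in (0 : ℝ)..x, φ' t * ∫ r in (0 : ℝ)..t, F r := by
  have hFi : IntegrableOn F (Ioc 0 x) := (intervalIntegrable_iff_integrableOn_Ioc_of_le hx).1 hF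
  have hφi : IntegrableOn φ' (Ioc 0 x) :=
    (intervalIntegrable_iff_integrableOn_Ioc_of_le hx).1 (hc.intervalIntegrable _ _)
  have hφc : Continuous φ := continuous_iff_continuousAt.2 fun t => (hφ t).continuousAt
  have hprod : Integrable (Function.uncurry fun t r => φ' t * F r)
      ((volume.restrict (Ioc 0 x)).prod (volume.restrict (Ioc 0 x))) := hφi.mul_prod hFi
  have hmeas : MeasurableSet {p : ℝ × ℝ | p.2 ≤ p.1} := measurableSet_le measurable_snd measurable_fst
  have hind := hprod.indicator hmeas
  have hswap := integral_integral_swap (f := fun t r => ({p : ℝ × ℝ | p.2 ≤ p.1}).indicator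
    (Function.uncurry fun t r => φ' t * F r) (t, r)) hind
  have h1 : ∀ t ∈ Ioc 0 x, ∫ r in Ioc 0 x, ({p : ℝ × ℝ | p.2 ≤ p.1}).indicator
      (Function.uncurry fun t r => φ' t * F r) (t, r) = φ' t * ∫ r in (0 : ℝ)..t, F r := by
    intro t ht
    rw [intervalIntegral.integral_of_le ht.1.le, ← integral_const_mul]
    have : (fun r => ({p : ℝ × ℝ | p.2 ≤ p.1}).indicator
        (Function.uncurry fun t r => φ' t * F r) (t, r))
        = (Iic t).indicator (fun r => φ' t * F r) := by
      ext r
      simp [indicator, Function.uncurry]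
    rw [this, setIntegral_indicator measurableSet_Iic]
    congr 2
    ext r
    simp only [mem_inter_iff, mem_Ioc, mem_Iic]
    exact ⟨fun h => ⟨h.1.1, h.2⟩, fun h => ⟨⟨h.1, h.2.trans ht.2⟩, h.2⟩⟩
  have h2 : ∀ r ∈ Ioc 0 x, ∫ t in Ioc 0 x, ({p : ℝ × ℝ | p.2 ≤ p.1}).indicator
      (Function.uncurry fun t r => φ' t * F r) (t, r) = (φ x - φ r) * F r := by
    intro r hr
    have : (fun t => ({p : ℝ × ℝ | p.2 ≤ p.1}).indicator
        (Function.uncurry fun t r => φ' t * F r) (t, r))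
        = (Ici r).indicator (fun t => φ' t * F r) := by
      ext t
      simp [indicator, Function.uncurry]
    rw [this, setIntegral_indicator measurableSet_Ici, integral_mul_const]
    have hset : Ioc 0 x ∩ Ici r = Icc r x := by
      ext t
      simp only [mem_inter_iff, mem_Ioc, mem_Ici, mem_Icc]
      exact ⟨fun h => ⟨h.2, h.1.2⟩, fun h => ⟨⟨hr.1.trans_le h.1, h.2⟩, h.1⟩⟩
    rw [hset, integral_Icc_eq_integral_Ioc, ← intervalIntegral.integral_of_le hr.2,
      intervalIntegral.integral_eq_sub_of_hasDerivAt (fun t _ => hφ t) (hc.intervalIntegrable _ _)]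
  rw [setIntegral_congr_fun measurableSet_Ioc h1, setIntegral_congr_fun measurableSet_Ioc h2,
    ← intervalIntegral.integral_of_le hx, ← intervalIntegral.integral_of_le hx] at hswap
  rw [hswap, ← intervalIntegral.integral_const_mul, ← intervalIntegral.integral_sub]
  · exact intervalIntegral.integral_congr fun t _ => by ring
  · exact hF.const_mul _
  · simp only [sub_mul]
    exact (hF.const_mul _).sub (hF.continuousOn_mul hφc.continuousOn)

/-- The gauge factor that removes the magnetic potential on an edge. -/
noncomputable def edgePhase (p t : ℝ) : ℂ := Complex.exp (Complex.I * p * t)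

theorem edgePhase_zero (p : ℝ) : edgePhase p 0 = 1 := by simp [edgePhase]

theorem hasDerivAt_edgePhase (p t : ℝ) :
    HasDerivAt (edgePhase p) (Complex.I * p * edgePhase p t) t := by
  have h := ((Complex.hasDerivAt_exp (Complex.I * p * t)).comp (t : ℂ)
    ((hasDerivAt_id (t : ℂ)).const_mul (Complex.I * p))).comp_ofReal
  refine h.congr_deriv ?_
  simp only [edgePhase]
  ring

theorem continuous_edgePhase (p : ℝ) : Continuous (edgePhase p) :=
  continuous_iff_continuousAt.2 fun t => (hasDerivAt_edgePhase p t).continuousAt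

theorem norm_edgePhase (p t : ℝ) : ‖edgePhase p t‖ = 1 := by
  rw [edgePhase, show Complex.I * (p : ℂ) * t = ((p * t : ℝ) : ℂ) * Complex.I by push_cast; ring]
  exact Complex.norm_exp_ofReal_mul_I _

theorem edgePhase_neg_mul (p t : ℝ) : edgePhase (-p) t * edgePhase p t = 1 := by
  rw [edgePhase, edgePhase, ← Complex.exp_add]
  simp

/-- Green's identity on an initial part of an edge. -/
theorem edge_green {p : ℝ} {U W f : ℝ → ℂ}
    (hU : ∀ x ∈ Icc (0 : ℝ) Real.pi,
      HasDerivWithinAt U (W x - Complex.I * (p : ℂ) * U x) (Icc 0 Real.pi) x)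
    (hW : ContinuousOn W (Icc 0 Real.pi))
    (hf : IntervalIntegrable f volume 0 Real.pi)
    (hWf : ∀ x ∈ Icc (0 : ℝ) Real.pi, W x = W 0 +
      ∫ t in (0 : ℝ)..x, (-f t - Complex.I * (p : ℂ) * W t))
    {φ φ' φ'' : ℝ → ℝ} (hφ : ∀ t, HasDerivAt φ (φ' t) t) (hφ' : ∀ t, HasDerivAt φ' (φ'' t) t)
    (hc : Continuous φ'') {x : ℝ} (hx : x ∈ Icc (0 : ℝ) Real.pi) :
    ∫ t in (0 : ℝ)..x, edgePhase p t * φ t * f t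
      = -(edgePhase p x * φ x * W x) + φ 0 * W 0 + edgePhase p x * φ' x * U x - φ' 0 * U 0
        - ∫ t in (0 : ℝ)..x, edgePhase p t * φ'' t * U t := by
  have hφc : Continuous φ := continuous_iff_continuousAt.2 fun t => (hφ t).continuousAt
  have hφ'c : Continuous φ' := continuous_iff_continuousAt.2 fun t => (hφ' t).continuousAt
  have hec := continuous_edgePhase p
  have hsub : Icc 0 x ⊆ Icc 0 Real.pi := Icc_subset_Icc_right hx.2
  have hWx : ContinuousOn W (Icc 0 x) := hW.mono hsub
  have hUx : ContinuousOn U (Icc 0 x) := fun t ht => ((hU t (hsub ht)).continuousWithinAt).mono hsub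
  have toII : ∀ {g : ℝ → ℂ}, ContinuousOn g (Icc 0 x) → IntervalIntegrable g volume 0 x :=
    fun hg => (by rwa [uIcc_of_le hx.1] : ContinuousOn _ (uIcc 0 x)).intervalIntegrable
  have hfx : IntervalIntegrable f volume 0 x := hf.mono_set (by
    rw [uIcc_of_le hx.1, uIcc_of_le (hx.1.trans hx.2)]; exact hsub)
  have iF : IntervalIntegrable (fun t => -f t - Complex.I * (p : ℂ) * W t) volume 0 x :=
    hfx.neg.sub ((toII hWx).const_mul _)
  have dψ : ∀ t, HasDerivAt (fun t => edgePhase p t * (φ t : ℂ))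
      (Complex.I * p * edgePhase p t * φ t + edgePhase p t * φ' t) t := fun t =>
    (hasDerivAt_edgePhase p t).mul (hφ t).ofReal_comp
  have cψ' : Continuous fun t => Complex.I * p * edgePhase p t * (φ t : ℂ)
      + edgePhase p t * (φ' t : ℂ) := by fun_prop
  have key := integral_mul_eq_sub_integral_deriv_mul_primitive hx.1 dψ cψ' iF
  have e1 : ∫ t in (0 : ℝ)..x, (-f t - Complex.I * (p : ℂ) * W t) = W x - W 0 := by
    rw [hWf x hx]; ring
  have e2 : ∫ t in (0 : ℝ)..x, (Complex.I * p * edgePhase p t * (φ t : ℂ)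
      + edgePhase p t * (φ' t : ℂ)) * ∫ r in (0 : ℝ)..t, (-f r - Complex.I * (p : ℂ) * W r)
      = ∫ t in (0 : ℝ)..x, ((Complex.I * p * edgePhase p t * (φ t : ℂ)
        + edgePhase p t * (φ' t : ℂ)) * W t - (Complex.I * p * edgePhase p t * (φ t : ℂ)
        + edgePhase p t * (φ' t : ℂ)) * W 0) := by
    refine intervalIntegral.integral_congr fun t ht => ?_
    rw [uIcc_of_le hx.1] at ht
    have : ∫ r in (0 : ℝ)..t, (-f r - Complex.I * (p : ℂ) * W r) = W t - W 0 := by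
      rw [hWf t (hsub ht)]; ring
    simp only [this]
    ring
  have iφW : IntervalIntegrable (fun t => edgePhase p t * (φ t : ℂ) * W t) volume 0 x :=
    toII (ContinuousOn.mul (by fun_prop) hWx)
  have iφ'W : IntervalIntegrable (fun t => edgePhase p t * (φ' t : ℂ) * W t) volume 0 x :=
    toII (ContinuousOn.mul (by fun_prop) hWx)
  have iφf : IntervalIntegrable (fun t => edgePhase p t * (φ t : ℂ) * f t) volume 0 x :=
    hfx.continuousOn_mul (by fun_prop)
  have iφU : IntervalIntegrable (fun t => edgePhase p t * (φ'' t : ℂ) * U t) volume 0 x :=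
    toII (ContinuousOn.mul (by fun_prop) hUx)
  have e3 : ∫ t in (0 : ℝ)..x, ((Complex.I * p * edgePhase p t * (φ t : ℂ)
      + edgePhase p t * (φ' t : ℂ)) * W t - (Complex.I * p * edgePhase p t * (φ t : ℂ)
      + edgePhase p t * (φ' t : ℂ)) * W 0)
      = Complex.I * p * (∫ t in (0 : ℝ)..x, edgePhase p t * (φ t : ℂ) * W t)
        + (∫ t in (0 : ℝ)..x, edgePhase p t * (φ' t : ℂ) * W t)
        - (edgePhase p x * φ x - φ 0) * W 0 := by
    have e4 : (edgePhase p x * φ x - φ 0) = ∫ t in (0 : ℝ)..x,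
        (Complex.I * p * edgePhase p t * (φ t : ℂ) + edgePhase p t * (φ' t : ℂ)) := by
      rw [intervalIntegral.integral_eq_sub_of_hasDerivAt (fun t _ => dψ t)
        (cψ'.intervalIntegrable _ _)]
      simp [edgePhase_zero]
    rw [e4, ← intervalIntegral.integral_const_mul, ← intervalIntegral.integral_mul_const,
      ← intervalIntegral.integral_add (iφW.const_mul _) iφ'W, ← intervalIntegral.integral_sub]
    · exact intervalIntegral.integral_congr fun t _ => by ring
    · exact (iφW.const_mul _).add iφ'W
    · exact (cψ'.intervalIntegrable _ _).mul_const _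
  have e5 : ∫ t in (0 : ℝ)..x, edgePhase p t * (φ t : ℂ) * (-f t - Complex.I * (p : ℂ) * W t)
      = -(∫ t in (0 : ℝ)..x, edgePhase p t * (φ t : ℂ) * f t)
        - Complex.I * p * (∫ t in (0 : ℝ)..x, edgePhase p t * (φ t : ℂ) * W t) := by
    have iφf' : IntervalIntegrable (fun t => -(edgePhase p t * (φ t : ℂ) * f t)) volume 0 x :=
      iφf.neg
    rw [← intervalIntegral.integral_neg, ← intervalIntegral.integral_const_mul,
      ← intervalIntegral.integral_sub iφf' (iφW.const_mul _)]
    exact intervalIntegral.integral_congr fun t _ => by ring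
  -- The gauge factor turns the quasiderivative into an ordinary derivative, so the terms with `I *
  -- p` cancel.
  have e6 : ∫ t in (0 : ℝ)..x, (edgePhase p t * (φ'' t : ℂ) * U t
      + edgePhase p t * (φ' t : ℂ) * W t) = edgePhase p x * φ' x * U x - φ' 0 * U 0 := by
    rw [intervalIntegral.integral_eq_sub_of_hasDerivAt_of_le hx.1
      (f := fun t => edgePhase p t * (φ' t : ℂ) * U t)]
    · simp [edgePhase_zero]
    · exact ContinuousOn.mul (by fun_prop) hUx
    · intro t ht
      have hUt := (hU t (hsub ⟨ht.1.le, ht.2.le⟩)).hasDerivAt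
        (Icc_mem_nhds ht.1 (ht.2.trans_le hx.2))
      refine (((hasDerivAt_edgePhase p t).mul (hφ' t).ofReal_comp).mul hUt).congr_deriv ?_
      simp only [Pi.mul_apply]
      ring
    · exact iφU.add iφ'W
  rw [intervalIntegral.integral_add iφU iφ'W] at e6
  rw [e1, e2, e3, e5] at key
  linear_combination -key + e6

/-- Variation of constants on an edge. -/
theorem edge_variation {p : ℝ} {U W f : ℝ → ℂ}
    (hU : ∀ x ∈ Icc (0 : ℝ) Real.pi,
      HasDerivWithinAt U (W x - Complex.I * (p : ℂ) * U x) (Icc 0 Real.pi) x)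
    (hW : ContinuousOn W (Icc 0 Real.pi))
    (hf : IntervalIntegrable f volume 0 Real.pi)
    (hWf : ∀ x ∈ Icc (0 : ℝ) Real.pi, W x = W 0 +
      ∫ t in (0 : ℝ)..x, (-f t - Complex.I * (p : ℂ) * W t))
    (E : ℝ) {x : ℝ} (hx : x ∈ Icc (0 : ℝ) Real.pi) :
    edgePhase p x * U x = edgeCos E x * U 0 + edgeSin E x * W 0
        - ∫ t in (0 : ℝ)..x, edgePhase p t * edgeSin E (x - t) * (f t - E * U t) ∧
    edgePhase p x * W x = -(E * edgeSin E x) * U 0 + edgeCos E x * W 0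
        - ∫ t in (0 : ℝ)..x, edgePhase p t * edgeCos E (x - t) * (f t - E * U t) := by
  have dC : ∀ t, HasDerivAt (fun t => edgeCos E (x - t)) (E * edgeSin E (x - t)) t :=
    fun t => ((hasDerivAt_edgeCos E (x - t)).scomp t
      ((hasDerivAt_id t).const_sub x)).congr_deriv (by simp)
  have dS : ∀ t, HasDerivAt (fun t => edgeSin E (x - t)) (-edgeCos E (x - t)) t :=
    fun t => ((hasDerivAt_edgeSin E (x - t)).scomp t
      ((hasDerivAt_id t).const_sub x)).congr_deriv (by simp)
  have hCc : Continuous fun t => edgeCos E (x - t) :=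
    continuous_iff_continuousAt.2 fun t => (dC t).continuousAt
  have hSc : Continuous fun t => edgeSin E (x - t) :=
    continuous_iff_continuousAt.2 fun t => (dS t).continuousAt
  have hec := continuous_edgePhase p
  have hsub : Icc 0 x ⊆ Icc 0 Real.pi := Icc_subset_Icc_right hx.2
  have hUx : ContinuousOn U (Icc 0 x) := fun t ht => ((hU t (hsub ht)).continuousWithinAt).mono hsub
  have hUi : IntervalIntegrable U volume 0 x :=
    (by rwa [uIcc_of_le hx.1] : ContinuousOn U (uIcc 0 x)).intervalIntegrable
  have hfx : IntervalIntegrable f volume 0 x := hf.mono_set (by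
    rw [uIcc_of_le hx.1, uIcc_of_le (hx.1.trans hx.2)]; exact hsub)
  have split : ∀ {φ : ℝ → ℝ}, Continuous φ →
      ∫ t in (0 : ℝ)..x, edgePhase p t * φ t * (f t - E * U t)
      = (∫ t in (0 : ℝ)..x, edgePhase p t * φ t * f t)
        - ∫ t in (0 : ℝ)..x, edgePhase p t * (E * φ t : ℝ) * U t := by
    intro φ hφ
    rw [← intervalIntegral.integral_sub]
    · exact intervalIntegral.integral_congr fun t _ => by push_cast; ring
    · exact hfx.continuousOn_mul (by fun_prop)
    · exact hUi.continuousOn_mul (by fun_prop)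
  constructor
  · have g := edge_green hU hW hf hWf dS (φ'' := fun t => -(E * edgeSin E (x - t)))
      (fun t => (dC t).neg) (by fun_prop) hx
    rw [split hSc, g]
    have : ∫ t in (0 : ℝ)..x, edgePhase p t * ((-(E * edgeSin E (x - t)) : ℝ) : ℂ) * U t
        = -∫ t in (0 : ℝ)..x, edgePhase p t * ((E * edgeSin E (x - t) : ℝ) : ℂ) * U t := by
      rw [← intervalIntegral.integral_neg]
      exact intervalIntegral.integral_congr fun t _ => by push_cast; ring
    rw [this]
    simp only [sub_self, sub_zero, edgeSin_zero, edgeCos_zero]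
    push_cast
    ring
  · have g := edge_green hU hW hf hWf dC (φ'' := fun t => -(E * edgeCos E (x - t)))
      (fun t => ((dS t).const_mul E).congr_deriv (by ring)) (by fun_prop) hx
    rw [split hCc, g]
    have : ∫ t in (0 : ℝ)..x, edgePhase p t * ((-(E * edgeCos E (x - t)) : ℝ) : ℂ) * U t
        = -∫ t in (0 : ℝ)..x, edgePhase p t * ((E * edgeCos E (x - t) : ℝ) : ℂ) * U t := by
      rw [← intervalIntegral.integral_neg]
      exact intervalIntegral.integral_congr fun t _ => by push_cast; ring
    rw [this]
    simp only [sub_self, sub_zero, edgeSin_zero, edgeCos_zero]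
    push_cast
    ring

/-! ### Estimates on one edge and sums over the chain -/

instance isFiniteMeasure_arcMeasure : IsFiniteMeasure arcMeasure := by
  unfold arcMeasure
  infer_instance

theorem integral_arcMeasure (g : ℝ → ℂ) :
    ∫ t, g t ∂arcMeasure = ∫ t in (0 : ℝ)..Real.pi, g t := by
  rw [arcMeasure, integral_Icc_eq_integral_Ioc, intervalIntegral.integral_of_le Real.pi_pos.le]

theorem ae_arcMeasure_of_forall {P : ℝ → Prop} (h : ∀ x ∈ Icc (0 : ℝ) Real.pi, P x) :
    ∀ᵐ x ∂arcMeasure, P x :=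
  (ae_restrict_iff' measurableSet_Icc).2 (Eventually.of_forall h)

theorem memLp_arcMeasure {g : ℝ → ℂ} (hg : Continuous g) (p : ℝ≥0∞) : MemLp g p arcMeasure := by
  obtain ⟨C, hC⟩ := isCompact_Icc.exists_bound_of_continuousOn (hg.continuousOn (s := Icc 0 Real.pi))
  exact MemLp.of_bound hg.aestronglyMeasurable C (ae_arcMeasure_of_forall hC)

/-- A continuous function as an element of the Hilbert space of an edge. -/
noncomputable def arcVec (g : C(ℝ, ℂ)) : Lp ℂ 2 arcMeasure := (memLp_arcMeasure g.continuous 2).toLp g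

theorem coeFn_arcVec (g : C(ℝ, ℂ)) : (arcVec g : ℝ → ℂ) =ᵐ[arcMeasure] g :=
  MemLp.coeFn_toLp _

theorem inner_arcVec (g : C(ℝ, ℂ)) (F : Lp ℂ 2 arcMeasure) :
    inner ℂ (arcVec g) F = ∫ t in (0 : ℝ)..Real.pi, star (g t) * (F : ℝ → ℂ) t := by
  rw [L2.inner_def, ← integral_arcMeasure]
  refine integral_congr_ae ?_
  filter_upwards [coeFn_arcVec g] with t ht
  rw [ht, RCLike.inner_apply, mul_comm]
  rfl

theorem exists_norm_le_of_pointwise : ∃ K : ℝ, 0 < K ∧ ∀ (F : Lp ℂ 2 arcMeasure) (g : ℝ → ℂ) (B : ℝ),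
    0 ≤ B → (F : ℝ → ℂ) =ᵐ[arcMeasure] g → (∀ x ∈ Icc (0 : ℝ) Real.pi, ‖g x‖ ≤ B) → ‖F‖ ≤ K * B := by
  refine ⟨(measureUnivNNReal arcMeasure : ℝ) ^ ((2 : ℝ≥0∞).toReal)⁻¹ + 1, by positivity, fun F g B hB hF hg => ?_⟩
  have : ∀ᵐ x ∂arcMeasure, ‖(F : ℝ → ℂ) x‖ ≤ B := by
    filter_upwards [hF, ae_arcMeasure_of_forall hg] with x h1 h2
    rwa [h1]
  refine (Lp.norm_le_of_ae_bound hB this).trans ?_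
  nlinarith

theorem exists_integral_norm_le : ∃ K : ℝ, 0 < K ∧ ∀ F : Lp ℂ 2 arcMeasure,
    ∫ t in (0 : ℝ)..Real.pi, ‖(F : ℝ → ℂ) t‖ ≤ K * ‖F‖ := by
  refine ⟨(arcMeasure univ ^ (1 / (1 : ℝ≥0∞).toReal - 1 / (2 : ℝ≥0∞).toReal)).toReal + 1,
    by positivity, fun F => ?_⟩
  have hm := Lp.memLp F
  have hle := eLpNorm_le_eLpNorm_mul_rpow_measure_univ (μ := arcMeasure) (p := 1) (q := 2)
    (by norm_num) hm.1
  have hint : ∫ t in (0 : ℝ)..Real.pi, ‖(F : ℝ → ℂ) t‖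
      = (eLpNorm (F : ℝ → ℂ) 1 arcMeasure).toReal := by
    rw [intervalIntegral.integral_of_le Real.pi_pos.le, ← integral_Icc_eq_integral_Ioc,
      eLpNorm_one_eq_lintegral_enorm, ← integral_toReal]
    · simp [arcMeasure]
    · exact hm.1.enorm
    · exact Eventually.of_forall fun x => by simp
  have hfin : arcMeasure univ ^ (1 / (1 : ℝ≥0∞).toReal - 1 / (2 : ℝ≥0∞).toReal) ≠ ∞ :=
    ENNReal.rpow_ne_top_of_nonneg (by norm_num) (measure_ne_top _ _)
  rw [hint]
  calc _ ≤ (eLpNorm (F : ℝ → ℂ) 2 arcMeasure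
        * arcMeasure univ ^ (1 / (1 : ℝ≥0∞).toReal - 1 / (2 : ℝ≥0∞).toReal)).toReal :=
        ENNReal.toReal_mono (ENNReal.mul_ne_top hm.2.ne hfin) hle
    _ = ‖F‖ * (arcMeasure univ ^ (1 / (1 : ℝ≥0∞).toReal - 1 / (2 : ℝ≥0∞).toReal)).toReal := by
        rw [ENNReal.toReal_mul, Lp.norm_def]
    _ ≤ _ := by nlinarith [norm_nonneg F]

theorem exists_norm_integral_mul_le : ∃ K : ℝ, 0 < K ∧ ∀ (F : Lp ℂ 2 arcMeasure) (k : ℝ → ℂ)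
    (B x : ℝ), 0 ≤ B → x ∈ Icc (0 : ℝ) Real.pi → (∀ t ∈ Icc (0 : ℝ) x, ‖k t‖ ≤ B) →
    ‖∫ t in (0 : ℝ)..x, k t * (F : ℝ → ℂ) t‖ ≤ K * B * ‖F‖ := by
  obtain ⟨K, hK, h⟩ := exists_integral_norm_le
  refine ⟨K, hK, fun F k B x hB hx hk => ?_⟩
  have hi := intervalIntegrable_of_edge F (right_mem_Icc.2 Real.pi_pos.le)
  have hix := intervalIntegrable_of_edge F hx
  have h1 : ‖∫ t in (0 : ℝ)..x, k t * (F : ℝ → ℂ) t‖ ≤ ∫ t in (0 : ℝ)..x, B * ‖(F : ℝ → ℂ) t‖ := by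
    refine intervalIntegral.norm_integral_le_of_norm_le hx.1 ?_ (hix.norm.const_mul _)
    refine Eventually.of_forall fun t ht => ?_
    rw [norm_mul]
    exact mul_le_mul_of_nonneg_right (hk t ⟨ht.1.le, ht.2⟩) (norm_nonneg _)
  have h2 : ∫ t in (0 : ℝ)..x, B * ‖(F : ℝ → ℂ) t‖ ≤ ∫ t in (0 : ℝ)..Real.pi, B * ‖(F : ℝ → ℂ) t‖ :=
    intervalIntegral.integral_mono_interval le_rfl hx.1 hx.2
      (Eventually.of_forall fun t => mul_nonneg hB (norm_nonneg _)) (hi.norm.const_mul _)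
  rw [intervalIntegral.integral_const_mul] at h1
  rw [intervalIntegral.integral_const_mul, intervalIntegral.integral_const_mul] at h2
  nlinarith [mul_le_mul_of_nonneg_left (h F) hB]

theorem ChainL2.hasSum_norm_sq (u : ChainL2) : HasSum (fun e => ‖u e‖ ^ 2) (‖u‖ ^ 2) := by
  have := lp.hasSum_norm (p := 2) (by norm_num) u
  simpa using this

theorem hasSum_edge {q : ℤ → ℝ} {T : ℝ} (h : HasSum q T) :
    HasSum (fun e : ChainEdge => q e.1) (2 * T) := by
  have hs : HasSum (fun x : ℤ ⊕ ℤ => Sum.elim q q x) (T + T) := HasSum.sum (by simpa using h) (by simpa using h)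
  have := (Equiv.hasSum_iff ((Equiv.prodComm ℤ Bool).trans (Equiv.boolProdEquivSum ℤ))).2 hs
  rw [two_mul]
  convert this using 1
  ext ⟨j, b⟩
  cases b <;> rfl

theorem hasSum_shift {q : ℤ → ℝ} {T : ℝ} (h : HasSum q T) (k : ℤ) :
    HasSum (fun j => q (j + k)) T :=
  (Equiv.hasSum_iff (Equiv.addRight k)).2 h

/-! ### Regular representatives and the holonomy of a ring -/

/-- `U` and `W` are the regular representatives of `u` and of its quasiderivative that witness
membership of `(u, f)` in the graph of the Hamiltonian. -/
def IsRepresentative (A : ℝ) (a : ℤ → ℝ) (u f : ChainL2) (U W : ChainEdge → ℝ → ℂ) : Prop :=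
    (∀ e, (u e : ℝ → ℂ) =ᵐ[arcMeasure] U e) ∧
    (∀ e, ∀ x ∈ Icc (0 : ℝ) Real.pi,
      HasDerivWithinAt (U e) (W e x - Complex.I * (edgePotential A e : ℂ) * U e x)
        (Icc 0 Real.pi) x) ∧
    (∀ e, ContinuousOn (W e) (Icc 0 Real.pi)) ∧
    (∀ e, ∀ x ∈ Icc (0 : ℝ) Real.pi,
      W e x = W e 0 +
        ∫ t in (0 : ℝ)..x, (-(f e : ℝ → ℂ) t - Complex.I * (edgePotential A e : ℂ) * W e t)) ∧
    (∀ j : ℤ, U (j, false) 0 = U (j, true) 0 ∧ U (j - 1, true) Real.pi = U (j, true) 0 ∧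
      U (j - 1, false) Real.pi = U (j, true) 0) ∧
    (∀ j : ℤ, W (j, true) 0 + W (j, false) 0 - W (j - 1, true) Real.pi - W (j - 1, false) Real.pi
      = (a j : ℂ) * U (j, true) 0)

theorem isLaplacianPair_iff {A : ℝ} {a : ℤ → ℝ} {u f : ChainL2} :
    IsLaplacianPair A a u f ↔ ∃ U W, IsRepresentative A a u f U W := Iff.rfl

/-- The common value of the gauge factors at the end of an edge for an integer field. -/
noncomputable def holonomy (A : ℤ) : ℂ := (-1) ^ A

theorem holonomy_mul_self (A : ℤ) : holonomy A * holonomy A = 1 := by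
  rw [holonomy, ← mul_zpow]
  simp

/-- This is where integrality of the field parameter enters: `exp (iπA)` and `exp (-iπA)` coincide,
so the upper and the lower edge transport vertex values with the same sign and the vertex equation
is the same as without a field up to that sign. -/
theorem edgePhase_pi (A : ℤ) (e : ChainEdge) : edgePhase (edgePotential A e) Real.pi = holonomy A := by
  have h : ∀ B : ℤ, edgePhase (B : ℝ) Real.pi = (-1) ^ B := by
    intro B
    rw [edgePhase, ← Complex.exp_pi_mul_I, ← Complex.exp_int_mul]
    congr 1
    push_cast
    ring
  unfold edgePotential holonomy
  split_ifs
  · exact h A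
  · have := h (-A)
    push_cast at this
    rw [this, zpow_neg, ← inv_zpow]
    norm_num

namespace IsRepresentative

variable {A : ℤ} {a : ℤ → ℝ} {u f : ChainL2} {U W : ChainEdge → ℝ → ℂ}

theorem value_zero (h : IsRepresentative A a u f U W) (e : ChainEdge) :
    U e 0 = U (e.1, true) 0 := by
  obtain ⟨j, b⟩ := e
  cases b
  · exact (h.2.2.2.2.1 j).1
  · rfl

theorem value_pi (h : IsRepresentative A a u f U W) (e : ChainEdge) :
    U e Real.pi = U (e.1 + 1, true) 0 := by
  obtain ⟨j, b⟩ := e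
  have := h.2.2.2.2.1 (j + 1)
  rw [add_sub_cancel_right] at this
  cases b
  · exact this.2.2
  · exact this.2.1

theorem variation (h : IsRepresentative A a u f U W) (E : ℝ) (e : ChainEdge) {x : ℝ}
    (hx : x ∈ Icc (0 : ℝ) Real.pi) :
    edgePhase (edgePotential A e) x * U e x = edgeCos E x * U e 0 + edgeSin E x * W e 0
        - ∫ t in (0 : ℝ)..x, edgePhase (edgePotential A e) t * edgeSin E (x - t)
          * ((f - (E : ℂ) • u : ChainL2) e : ℝ → ℂ) t ∧
    edgePhase (edgePotential A e) x * W e x = -(E * edgeSin E x) * U e 0 + edgeCos E x * W e 0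
        - ∫ t in (0 : ℝ)..x, edgePhase (edgePotential A e) t * edgeCos E (x - t)
          * ((f - (E : ℂ) • u : ChainL2) e : ℝ → ℂ) t := by
  obtain ⟨h1, h2, h3, h4, -, -⟩ := h
  have key := edge_variation (h2 e) (h3 e)
    (intervalIntegrable_of_edge (f e) (right_mem_Icc.2 Real.pi_pos.le)) (h4 e) E hx
  have hg : ((f - (E : ℂ) • u : ChainL2) e : ℝ → ℂ)
      =ᵐ[arcMeasure] fun t => (f e : ℝ → ℂ) t - E * U e t := by
    have := Lp.coeFn_sub (f e) ((E : ℂ) • u e)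
    filter_upwards [this, Lp.coeFn_smul (E : ℂ) (u e), h1 e] with t k1 k2 k3
    rw [lp.coeFn_sub, Pi.sub_apply, lp.coeFn_smul, Pi.smul_apply, k1, Pi.sub_apply, k2,
      Pi.smul_apply, k3, smul_eq_mul]
  have hcong : ∀ k : ℝ → ℂ, ∫ t in (0 : ℝ)..x, k t * ((f e : ℝ → ℂ) t - E * U e t)
      = ∫ t in (0 : ℝ)..x, k t * ((f - (E : ℂ) • u : ChainL2) e : ℝ → ℂ) t := by
    intro k
    apply intervalIntegral.integral_congr_ae
    filter_upwards [(ae_restrict_iff' measurableSet_Icc).1 hg] with t ht htx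
    rw [uIoc_of_le hx.1] at htx
    rw [ht ⟨htx.1.le, htx.2.trans hx.2⟩]
  rw [← hcong, ← hcong]
  exact key

end IsRepresentative

/-! ### Vertex values as bounded functionals of the graph norm -/

/-- A cubic with unit slope at the beginning of an edge and no other Cauchy data at its ends. -/
noncomputable def bump (x : ℝ) : ℝ := x * (Real.pi - x) ^ 2 / Real.pi ^ 2

noncomputable def bumpDeriv (x : ℝ) : ℝ := ((Real.pi - x) ^ 2 - 2 * x * (Real.pi - x)) / Real.pi ^ 2

noncomputable def bumpDerivTwo (x : ℝ) : ℝ := (6 * x - 4 * Real.pi) / Real.pi ^ 2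

theorem hasDerivAt_bump (x : ℝ) : HasDerivAt bump (bumpDeriv x) x := by
  refine (((hasDerivAt_id x).mul (((hasDerivAt_id x).const_sub Real.pi).pow 2)).div_const
    (Real.pi ^ 2)).congr_deriv ?_
  simp [bumpDeriv]
  ring

theorem hasDerivAt_bumpDeriv (x : ℝ) : HasDerivAt bumpDeriv (bumpDerivTwo x) x := by
  refine (((((hasDerivAt_id x).const_sub Real.pi).pow 2).sub
    (((hasDerivAt_id x).const_mul 2).mul ((hasDerivAt_id x).const_sub Real.pi))).div_const
    (Real.pi ^ 2)).congr_deriv ?_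
  simp [bumpDerivTwo]
  ring

theorem continuous_bump : Continuous bump := by unfold bump; fun_prop

theorem continuous_bumpDerivTwo : Continuous bumpDerivTwo := by unfold bumpDerivTwo; fun_prop

theorem bump_values : bump 0 = 0 ∧ bump Real.pi = 0 ∧ bumpDeriv 0 = 1 ∧ bumpDeriv Real.pi = 0 := by
  have := Real.pi_pos.ne'
  refine ⟨by simp [bump], by simp [bump], ?_, by simp [bumpDeriv]⟩
  simp [bumpDeriv, this]

/-- The continuous function `x ↦ conj (edgePhase p x * φ x)`. -/
noncomputable def conjPhaseMul (p : ℝ) (φ : ℝ → ℝ) (hφ : Continuous φ) : C(ℝ, ℂ) :=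
  ⟨fun x => star (edgePhase p x * φ x), by have := continuous_edgePhase p; fun_prop⟩

/-- Green's identity against `bump`: its Cauchy data are chosen so that `U e 0` is the only boundary
term that survives. -/
theorem IsRepresentative.nodal_value {A : ℝ} {a : ℤ → ℝ} {u f : ChainL2} {U W : ChainEdge → ℝ → ℂ}
    (h : IsRepresentative A a u f U W) (e : ChainEdge) :
    U e 0 = -inner ℂ (arcVec (conjPhaseMul (edgePotential A e) bump continuous_bump)) (f e)
      - inner ℂ (arcVec (conjPhaseMul (edgePotential A e) bumpDerivTwo continuous_bumpDerivTwo))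
        (u e) := by
  obtain ⟨h1, h2, h3, h4, -, -⟩ := h
  have key := edge_green (h2 e) (h3 e)
    (intervalIntegrable_of_edge (f e) (right_mem_Icc.2 Real.pi_pos.le)) (h4 e)
    hasDerivAt_bump hasDerivAt_bumpDeriv continuous_bumpDerivTwo (right_mem_Icc.2 Real.pi_pos.le)
  obtain ⟨b1, b2, b3, b4⟩ := bump_values
  rw [b1, b2, b3, b4] at key
  rw [inner_arcVec, inner_arcVec]
  have hU : ∫ t in (0 : ℝ)..Real.pi, star (conjPhaseMul (edgePotential A e) bumpDerivTwo
      continuous_bumpDerivTwo t) * (u e : ℝ → ℂ) t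
      = ∫ t in (0 : ℝ)..Real.pi, edgePhase (edgePotential A e) t * bumpDerivTwo t * U e t := by
    rw [← integral_arcMeasure, ← integral_arcMeasure]
    refine integral_congr_ae ?_
    filter_upwards [h1 e] with t ht
    rw [ht]
    simp [conjPhaseMul]
  have hf : ∫ t in (0 : ℝ)..Real.pi, star (conjPhaseMul (edgePotential A e) bump
      continuous_bump t) * (f e : ℝ → ℂ) t
      = ∫ t in (0 : ℝ)..Real.pi, edgePhase (edgePotential A e) t * bump t * (f e : ℝ → ℂ) t := by
    refine intervalIntegral.integral_congr fun t _ => ?_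
    simp [conjPhaseMul]
  rw [hU, hf, key]
  push_cast
  ring

/-- Makes vertex values tend to zero along singular Weyl sequences and makes evaluation at a vertex
linear on eigenspaces. -/
theorem exists_nodal_functional (A : ℝ) (e : ChainEdge) : ∃ g₁ g₂ : ChainL2,
    ∀ (a : ℤ → ℝ) (u f : ChainL2) (U W : ChainEdge → ℝ → ℂ), IsRepresentative A a u f U W →
      U e 0 = inner ℂ g₁ u + inner ℂ g₂ f := by
  refine ⟨-lp.single 2 e (arcVec (conjPhaseMul (edgePotential A e) bumpDerivTwo
    continuous_bumpDerivTwo)), -lp.single 2 e (arcVec (conjPhaseMul (edgePotential A e) bump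
    continuous_bump)), fun a u f U W h => ?_⟩
  rw [h.nodal_value e, inner_neg_left, inner_neg_left, lp.inner_single_left, lp.inner_single_left]
  ring

theorem exists_nodal_bound (A : ℝ) : ∃ K : ℝ, 0 < K ∧ ∀ (a : ℤ → ℝ) (u f : ChainL2)
    (U W : ChainEdge → ℝ → ℂ), IsRepresentative A a u f U W →
      ∀ e, ‖U e 0‖ ≤ K * (‖f e‖ + ‖u e‖) := by
  set c : ℝ → ℝ := fun p => ‖arcVec (conjPhaseMul p bump continuous_bump)‖
    + ‖arcVec (conjPhaseMul p bumpDerivTwo continuous_bumpDerivTwo)‖ with hc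
  have hc0 : ∀ p, 0 ≤ c p := fun p => by positivity
  refine ⟨c A + c (-A) + 1, by linarith [hc0 A, hc0 (-A)], fun a u f U W h e => ?_⟩
  have hce : c (edgePotential A e) ≤ c A + c (-A) + 1 := by
    unfold edgePotential
    split_ifs <;> linarith [hc0 A, hc0 (-A)]
  rw [h.nodal_value e]
  refine (norm_sub_le _ _).trans ?_
  rw [norm_neg]
  have k1 := norm_inner_le_norm (𝕜 := ℂ) (arcVec (conjPhaseMul (edgePotential A e) bump
    continuous_bump)) (f e)
  have k2 := norm_inner_le_norm (𝕜 := ℂ) (arcVec (conjPhaseMul (edgePotential A e) bumpDerivTwo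
    continuous_bumpDerivTwo)) (u e)
  have n1 := norm_nonneg (arcVec (conjPhaseMul (edgePotential A e) bump continuous_bump))
  have n2 := norm_nonneg (arcVec (conjPhaseMul (edgePotential A e) bumpDerivTwo
    continuous_bumpDerivTwo))
  simp only [hc] at hce
  have n3 := norm_nonneg (f e)
  have n4 := norm_nonneg (u e)
  calc _ ≤ _ := add_le_add k1 k2
    _ ≤ (‖arcVec (conjPhaseMul (edgePotential A e) bump continuous_bump)‖
        + ‖arcVec (conjPhaseMul (edgePotential A e) bumpDerivTwo continuous_bumpDerivTwo)‖)
        * (‖f e‖ + ‖u e‖) := by nlinarith [mul_nonneg n1 n4, mul_nonneg n2 n3]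
    _ ≤ _ := mul_le_mul_of_nonneg_right hce (by positivity)

/-! ### The difference equation for the vertex values -/

/-- Half the trace of the transfer matrix of the chain with the constant coupling `α`, up to the
holonomy. -/
noncomputable def discriminant (α E : ℝ) : ℝ := edgeCos E Real.pi + α / 4 * edgeSin E Real.pi

theorem exists_bound_phase_mul (p : ℝ) {k : ℝ → ℝ} (hk : Continuous k) :
    ∃ B : ℝ, 0 < B ∧ ∀ x ∈ Icc (0 : ℝ) Real.pi, ∀ t ∈ Icc (0 : ℝ) x,
      ‖edgePhase p t * (k (x - t) : ℂ)‖ ≤ B := by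
  obtain ⟨C, hC⟩ := isCompact_Icc.exists_bound_of_continuousOn (hk.continuousOn (s := Icc 0 Real.pi))
  refine ⟨|C| + 1, by positivity, fun x hx t ht => ?_⟩
  rw [norm_mul, norm_edgePhase, one_mul, Complex.norm_real]
  have := hC (x - t) ⟨by linarith [ht.2], by linarith [ht.1, hx.2]⟩
  linarith [le_abs_self C]

theorem exists_duhamel_bound (A E : ℝ) : ∃ K : ℝ, 0 < K ∧ ∀ (F : Lp ℂ 2 arcMeasure) (e : ChainEdge)
    (x : ℝ), x ∈ Icc (0 : ℝ) Real.pi →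
    ‖∫ t in (0 : ℝ)..x, edgePhase (edgePotential A e) t * edgeSin E (x - t) * (F : ℝ → ℂ) t‖ ≤ K * ‖F‖ ∧
    ‖∫ t in (0 : ℝ)..x, edgePhase (edgePotential A e) t * edgeCos E (x - t) * (F : ℝ → ℂ) t‖
      ≤ K * ‖F‖ := by
  obtain ⟨K, hK, h⟩ := exists_norm_integral_mul_le
  have hB : ∀ k : ℝ → ℝ, Continuous k → ∃ B : ℝ, 0 < B ∧ ∀ e : ChainEdge, ∀ x ∈ Icc (0 : ℝ) Real.pi,
      ∀ t ∈ Icc (0 : ℝ) x, ‖edgePhase (edgePotential A e) t * (k (x - t) : ℂ)‖ ≤ B := by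
    intro k hk
    obtain ⟨B₁, h₁, k₁⟩ := exists_bound_phase_mul A hk
    obtain ⟨B₂, h₂, k₂⟩ := exists_bound_phase_mul (-A) hk
    refine ⟨B₁ + B₂, by positivity, fun e x hx t ht => ?_⟩
    unfold edgePotential
    split_ifs
    · linarith [k₁ x hx t ht]
    · linarith [k₂ x hx t ht]
  obtain ⟨B₁, h₁, k₁⟩ := hB _ (continuous_edgeSin_right E)
  obtain ⟨B₂, h₂, k₂⟩ := hB _ (continuous_edgeCos_right E)
  refine ⟨K * (B₁ + B₂), by positivity, fun F e x hx => ⟨?_, ?_⟩⟩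
  · refine (h F _ B₁ x h₁.le hx (k₁ e x hx)).trans ?_
    gcongr
    linarith
  · refine (h F _ B₂ x h₂.le hx (k₂ e x hx)).trans ?_
    gcongr
    linarith

namespace IsRepresentative

variable {A : ℤ} {a : ℤ → ℝ} {u f : ChainL2} {U W : ChainEdge → ℝ → ℂ}

theorem slope_eq (h : IsRepresentative A a u f U W) (E : ℝ) (e : ChainEdge) :
    edgeSin E Real.pi * W e 0 = holonomy A * U (e.1 + 1, true) 0
      - edgeCos E Real.pi * U (e.1, true) 0
      + ∫ t in (0 : ℝ)..Real.pi, edgePhase (edgePotential A e) t * edgeSin E (Real.pi - t)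
          * ((f - (E : ℂ) • u : ChainL2) e : ℝ → ℂ) t := by
  have := (h.variation E e (right_mem_Icc.2 Real.pi_pos.le)).1
  rw [edgePhase_pi, h.value_pi e, h.value_zero e] at this
  linear_combination -this

/-- The `δ`-condition times `edgeSin E π` contains only slopes that vertex values determine:
outgoing ones by `slope_eq`, incoming ones by transport along ring `j - 1`. The identity `c² + E s²
= 1` cleans up the coefficient of `U (j - 1, true) 0`, and the right side collects the Duhamel terms
of the residual `f - E u`. -/
theorem vertex_eq (h : IsRepresentative A a u f U W) (E : ℝ) (j : ℤ) :
    2 * holonomy A * (U (j + 1, true) 0 + U (j - 1, true) 0)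
      - (4 * edgeCos E Real.pi + edgeSin E Real.pi * a j) * U (j, true) 0
    = holonomy A * edgeCos E Real.pi * (∑ b : Bool,
        ∫ t in (0 : ℝ)..Real.pi, edgePhase (edgePotential A (j - 1, b)) t * edgeSin E (Real.pi - t)
          * ((f - (E : ℂ) • u : ChainL2) (j - 1, b) : ℝ → ℂ) t)
      - holonomy A * edgeSin E Real.pi * (∑ b : Bool,
        ∫ t in (0 : ℝ)..Real.pi, edgePhase (edgePotential A (j - 1, b)) t * edgeCos E (Real.pi - t)
          * ((f - (E : ℂ) • u : ChainL2) (j - 1, b) : ℝ → ℂ) t)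
      - ∑ b : Bool, ∫ t in (0 : ℝ)..Real.pi, edgePhase (edgePotential A (j, b)) t
          * edgeSin E (Real.pi - t) * ((f - (E : ℂ) • u : ChainL2) (j, b) : ℝ → ℂ) t := by
  have hσ := holonomy_mul_self A
  have hp : (edgeCos E Real.pi : ℂ) ^ 2 + E * (edgeSin E Real.pi : ℂ) ^ 2 = 1 := by
    exact_mod_cast edgeCos_sq_add E Real.pi
  have s1 := h.slope_eq E (j, true)
  have s2 := h.slope_eq E (j, false)
  have s3 := h.slope_eq E (j - 1, true)
  have s4 := h.slope_eq E (j - 1, false)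
  have v3 := (h.variation E (j - 1, true) (right_mem_Icc.2 Real.pi_pos.le)).2
  have v4 := (h.variation E (j - 1, false) (right_mem_Icc.2 Real.pi_pos.le)).2
  have hd := h.2.2.2.2.2 j
  rw [edgePhase_pi, h.value_zero] at v3 v4
  simp only [sub_add_cancel] at s3 s4 v3 v4
  simp only [Fintype.sum_bool]
  set σ := holonomy A
  set c := (edgeCos E Real.pi : ℂ)
  set s := (edgeSin E Real.pi : ℂ)
  linear_combination -s1 - s2 + (σ * c) * s3 + (σ * c) * s4 + (σ * s) * v3 + (σ * s) * v4 + s * hd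
    + (-s * W (j - 1, true) Real.pi - s * W (j - 1, false) Real.pi + 2 * c * U (j, true) 0) * hσ
    - 2 * σ * U (j - 1, true) 0 * hp

end IsRepresentative

theorem norm_holonomy (A : ℤ) : ‖holonomy A‖ = 1 := by simp [holonomy]

theorem exists_vertex_bound (A : ℤ) (E : ℝ) : ∃ K : ℝ, 0 < K ∧ ∀ (a : ℤ → ℝ) (u f : ChainL2)
    (U W : ChainEdge → ℝ → ℂ), IsRepresentative A a u f U W → ∀ j : ℤ,
    ‖2 * holonomy A * (U (j + 1, true) 0 + U (j - 1, true) 0)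
      - (4 * edgeCos E Real.pi + edgeSin E Real.pi * a j) * U (j, true) 0‖
    ≤ K * (‖(f - (E : ℂ) • u : ChainL2) (j, true)‖ + ‖(f - (E : ℂ) • u : ChainL2) (j, false)‖
      + ‖(f - (E : ℂ) • u : ChainL2) (j - 1, true)‖
      + ‖(f - (E : ℂ) • u : ChainL2) (j - 1, false)‖) := by
  obtain ⟨K, hK, hb⟩ := exists_duhamel_bound A E
  refine ⟨K * (|edgeCos E Real.pi| + |edgeSin E Real.pi| + 1), by positivity,
    fun a u f U W h j => ?_⟩
  rw [h.vertex_eq E j]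
  set g : ChainL2 := f - (E : ℂ) • u
  have hpi := right_mem_Icc.2 Real.pi_pos.le
  have bS := fun e => (hb (g e) e Real.pi hpi).1
  have bC := fun e => (hb (g e) e Real.pi hpi).2
  simp only [Fintype.sum_bool]
  have hc := abs_nonneg (edgeCos E Real.pi)
  have hs := abs_nonneg (edgeSin E Real.pi)
  refine (norm_sub_le _ _).trans (le_trans (add_le_add (norm_sub_le _ _) le_rfl) ?_)
  simp only [norm_mul, norm_holonomy, one_mul, Complex.norm_real, Real.norm_eq_abs]
  have t1 := (norm_add_le _ _).trans (add_le_add (bS (j - 1, true)) (bS (j - 1, false)))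
  have t2 := (norm_add_le _ _).trans (add_le_add (bC (j - 1, true)) (bC (j - 1, false)))
  have t3 := (norm_add_le _ _).trans (add_le_add (bS (j, true)) (bS (j, false)))
  refine (add_le_add (add_le_add (mul_le_mul_of_nonneg_left t1 hc)
    (mul_le_mul_of_nonneg_left t2 hs)) t3).trans ?_
  have n1 := mul_nonneg hK.le (norm_nonneg (g (j, true)))
  have n2 := mul_nonneg hK.le (norm_nonneg (g (j, false)))
  have n3 := mul_nonneg hK.le (norm_nonneg (g (j - 1, true)))
  have n4 := mul_nonneg hK.le (norm_nonneg (g (j - 1, false)))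
  nlinarith [mul_nonneg hc n1, mul_nonneg hc n2, mul_nonneg hs n1, mul_nonneg hs n2]

/-- The starting slope is recovered from the two end values by dividing by `edgeSin E π`. Where this
vanishes the bound fails, since there are Dirichlet eigenfunctions on the edge. -/
theorem exists_edge_norm_bound (A : ℤ) {E : ℝ} (hs : edgeSin E Real.pi ≠ 0) :
    ∃ K : ℝ, 0 < K ∧ ∀ (a : ℤ → ℝ) (u f : ChainL2) (U W : ChainEdge → ℝ → ℂ),
    IsRepresentative A a u f U W → ∀ e : ChainEdge,
    ‖u e‖ ≤ K * (‖U (e.1, true) 0‖ + ‖U (e.1 + 1, true) 0‖ + ‖(f - (E : ℂ) • u : ChainL2) e‖) := by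
  obtain ⟨K, hK, hb⟩ := exists_duhamel_bound A E
  obtain ⟨K', hK', hn⟩ := exists_norm_le_of_pointwise
  obtain ⟨C₁, hC₁⟩ := isCompact_Icc.exists_bound_of_continuousOn
    ((continuous_edgeCos_right E).continuousOn (s := Icc 0 Real.pi))
  obtain ⟨C₂, hC₂⟩ := isCompact_Icc.exists_bound_of_continuousOn
    ((continuous_edgeSin_right E).continuousOn (s := Icc 0 Real.pi))
  set C := max C₁ C₂ with hCdef
  have hpi := right_mem_Icc.2 Real.pi_pos.le
  have hC0 : 0 ≤ C := (norm_nonneg _).trans ((hC₁ _ hpi).trans (le_max_left _ _))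
  set D := (1 + |edgeCos E Real.pi| + K) / |edgeSin E Real.pi| with hD
  have hsp := abs_pos.2 hs
  have hD0 : 0 ≤ D := by positivity
  refine ⟨K' * (C + C * D + K), by positivity, fun a u f U W h e => ?_⟩
  set g : ChainL2 := f - (E : ℂ) • u
  set S := ‖U (e.1, true) 0‖ + ‖U (e.1 + 1, true) 0‖ + ‖g e‖ with hS
  have hS0 : 0 ≤ S := by positivity
  have n1 := norm_nonneg (U (e.1, true) 0)
  have n2 := norm_nonneg (U (e.1 + 1, true) 0)
  have n3 := norm_nonneg (g e)
  have hW : ‖W e 0‖ ≤ D * S := by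
    have := congrArg norm (h.slope_eq E e)
    rw [norm_mul, Complex.norm_real, Real.norm_eq_abs] at this
    rw [hD, div_mul_eq_mul_div, le_div_iff₀ hsp, mul_comm, this]
    refine (norm_add_le _ _).trans ((add_le_add (norm_sub_le _ _)
      (hb (g e) e Real.pi hpi).1).trans ?_)
    rw [norm_mul, norm_mul, norm_holonomy, Complex.norm_real, Real.norm_eq_abs]
    have hc := abs_nonneg (edgeCos E Real.pi)
    rw [hS]
    nlinarith [mul_nonneg hc n2, mul_nonneg hc n3, mul_nonneg hK.le n1, mul_nonneg hK.le n2]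
  rw [mul_assoc]
  refine hn (u e) (U e) _ (by positivity) (h.1 e) fun x hx => ?_
  have hv := (h.variation E e hx).1
  have : ‖U e x‖ = ‖edgePhase (edgePotential A e) x * U e x‖ := by
    rw [norm_mul, norm_edgePhase, one_mul]
  rw [this, hv, h.value_zero e]
  refine (norm_sub_le _ _).trans ((add_le_add (norm_add_le _ _) (hb (g e) e x hx).1).trans ?_)
  rw [norm_mul, norm_mul, Complex.norm_real, Complex.norm_real]
  have c1 : ‖edgeCos E x‖ ≤ C := (hC₁ x hx).trans (le_max_left _ _)
  have c2 : ‖edgeSin E x‖ ≤ C := (hC₂ x hx).trans (le_max_right _ _)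
  calc _ ≤ C * ‖U (e.1, true) 0‖ + C * (D * S) + K * ‖g e‖ := by gcongr
    _ ≤ C * S + C * (D * S) + K * S := by
      have hs1 : ‖U (e.1, true) 0‖ ≤ S := by rw [hS]; linarith
      have hs3 : ‖g e‖ ≤ S := by rw [hS]; linarith
      gcongr
    _ = _ := by ring

/-! ### Coercivity off the bands -/

/-- Multiply by `x j` and sum. The neighbours cost at most `2 X` by the inequality of means, and
Young's inequality with weight `(M - 2) / 2` absorbs the source term into half of the remaining `(M
- 2) X`. -/
theorem sum_sq_le_of_subharmonic {M : ℝ} (hM : 2 < M) {x h : ℤ → ℝ} (hx : ∀ j, 0 ≤ x j)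
    (hle : ∀ j, M * x j ≤ x (j + 1) + x (j - 1) + h j) {X H : ℝ}
    (hX : HasSum (fun j => x j ^ 2) X) (hH : HasSum (fun j => h j ^ 2) H) :
    X ≤ H / (M - 2) ^ 2 := by
  have hδ : 0 < M - 2 := by linarith
  have h1 := hasSum_shift hX 1
  have h2 := hasSum_shift hX (-1)
  have hR := (((h1.add hX).add (h2.add hX)).mul_left (1 / 2)).add
    ((hX.mul_left ((M - 2) / 2)).add (hH.mul_left (1 / (2 * (M - 2)))))
  have key := hasSum_le (fun j => ?_) (hX.mul_left M) hR
  · have : (M - 2) / 2 * X ≤ 1 / (2 * (M - 2)) * H := by linarith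
    rw [le_div_iff₀ (by positivity)]
    have h3 : (M - 2) / 2 * X * (2 * (M - 2)) ≤ 1 / (2 * (M - 2)) * H * (2 * (M - 2)) :=
      mul_le_mul_of_nonneg_right this (by positivity)
    have h4 : 1 / (2 * (M - 2)) * H * (2 * (M - 2)) = H := by field_simp
    rw [h4] at h3
    linarith
  · have a1 := mul_le_mul_of_nonneg_right (hle j) (hx j)
    have a2 : h j * x j ≤ (M - 2) / 2 * x j ^ 2 + 1 / (2 * (M - 2)) * h j ^ 2 := by
      have : 0 ≤ ((M - 2) * x j - h j) ^ 2 / (2 * (M - 2)) := by positivity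
      have e : ((M - 2) * x j - h j) ^ 2 / (2 * (M - 2))
          = (M - 2) / 2 * x j ^ 2 + 1 / (2 * (M - 2)) * h j ^ 2 - h j * x j := by
        field_simp
        ring
      linarith
    show M * x j ^ 2 ≤ 1 / 2 * (x (j + 1) ^ 2 + x j ^ 2 + (x (j + -1) ^ 2 + x j ^ 2)) + _
    rw [← sub_eq_add_neg]
    nlinarith [sq_nonneg (x (j + 1) - x j), sq_nonneg (x (j - 1) - x j)]

/-- If the sine vanishes, `c² + E s² = 1` leaves `c = ±1`, and the discriminant is `±1` whatever `α`
is. -/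
theorem edgeSin_pi_ne_zero_of_gap {α E : ℝ} (h : 1 < |discriminant α E|) : edgeSin E Real.pi ≠ 0 := by
  intro hs
  have h1 := edgeCos_sq_add E Real.pi
  rw [discriminant, hs, mul_zero, add_zero] at h
  rw [hs] at h1
  have : edgeCos E Real.pi ^ 2 = 1 := by linarith
  rw [← sq_abs] at this
  nlinarith [abs_nonneg (edgeCos E Real.pi)]

theorem IsRepresentative.exists_nodal_sum {A : ℝ} {a : ℤ → ℝ} {u f : ChainL2}
    {U W : ChainEdge → ℝ → ℂ} (h : IsRepresentative A a u f U W) :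
    ∃ X, HasSum (fun j => ‖U (j, true) 0‖ ^ 2) X := by
  obtain ⟨K, hK, hb⟩ := exists_nodal_bound A
  have hs : Summable fun j : ℤ => 2 * K ^ 2 * (‖f (j, true)‖ ^ 2 + ‖u (j, true)‖ ^ 2) := by
    have inj : Function.Injective fun j : ℤ => ((j, true) : ChainEdge) :=
      fun i j hij => (Prod.mk.inj hij).1
    exact (((ChainL2.hasSum_norm_sq f).summable.comp_injective inj).add
      ((ChainL2.hasSum_norm_sq u).summable.comp_injective inj)).mul_left _
  refine ⟨_, (Summable.of_nonneg_of_le (fun j => by positivity) (fun j => ?_) hs).hasSum⟩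
  have h1 := hb a u f U W h (j, true)
  have h2 := pow_le_pow_left₀ (norm_nonneg _) h1 2
  refine h2.trans ?_
  nlinarith [mul_nonneg (sq_nonneg K) (sq_nonneg (‖f (j, true)‖ - ‖u (j, true)‖))]

/-- Off the spectrum of the periodic chain, the graph norm is controlled by the residual and the
values at the finitely many perturbed vertices. -/
theorem exists_gap_estimate (A : ℤ) {α E : ℝ} (hE : 1 < |discriminant α E|) {a : ℤ → ℝ}
    {F : Finset ℤ} (ha : ∀ j ∉ F, a j = α) :
    ∃ K : ℝ, 0 < K ∧ ∀ (u f : ChainL2) (U W : ChainEdge → ℝ → ℂ), IsRepresentative A a u f U W →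
      ‖u‖ ^ 2 ≤ K * (‖f - (E : ℂ) • u‖ ^ 2 + ∑ j ∈ F, ‖U (j, true) 0‖ ^ 2) := by
  have hs := edgeSin_pi_ne_zero_of_gap hE
  obtain ⟨K₁, hK₁, hb₁⟩ := exists_vertex_bound A E
  obtain ⟨K₂, hK₂, hb₂⟩ := exists_edge_norm_bound A hs
  set M := 2 * |discriminant α E| with hM
  have hM2 : 2 < M := by linarith
  obtain ⟨B, hB0, hB⟩ : ∃ B : ℝ, 0 ≤ B ∧ ∀ j, |edgeSin E Real.pi * (a j - α)| ≤ B := by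
    refine ⟨∑ j ∈ F, |edgeSin E Real.pi * (a j - α)|, Finset.sum_nonneg fun _ _ => abs_nonneg _,
      fun j => ?_⟩
    by_cases hj : j ∈ F
    · exact Finset.single_le_sum (f := fun j => |edgeSin E Real.pi * (a j - α)|)
        (fun _ _ => abs_nonneg _) hj
    · rw [ha j hj, sub_self, mul_zero, abs_zero]
      exact Finset.sum_nonneg fun _ _ => abs_nonneg _
  set C := 2 * K₁ ^ 2 + B ^ 2 + 1 with hC
  have hδ : 0 < (M - 2) ^ 2 := by
    have : 0 < M - 2 := by linarith
    positivity
  -- The 3 comes from squaring three summands, and `4 X` counts two edges per ring and two end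
  -- vertices per edge, where `X ≤ 2 C / (M - 2)² * (‖g‖² + P)`. The constant leaves some room.
  refine ⟨3 * K₂ ^ 2 * (4 * (4 * C / (M - 2) ^ 2) + 1), by positivity, fun u f U W h => ?_⟩
  set g : ChainL2 := f - (E : ℂ) • u with hg
  obtain ⟨X, hX⟩ := h.exists_nodal_sum
  have hX0 : 0 ≤ X := hX.nonneg fun _ => by positivity
  set P := ∑ j ∈ F, ‖U (j, true) 0‖ ^ 2 with hP
  have hP0 : 0 ≤ P := Finset.sum_nonneg fun _ _ => by positivity
  have hgs := ChainL2.hasSum_norm_sq g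
  set w : ℤ → ℝ := fun j => ‖g (j, true)‖ ^ 2 + ‖g (j, false)‖ ^ 2 with hw
  have hwsum : HasSum w (‖g‖ ^ 2) := by
    have := (Equiv.prodComm ℤ Bool).symm.hasSum_iff.2 hgs
    refine (hgs.prod_fiberwise fun j => ?_)
    simpa [hw] using hasSum_fintype (fun b : Bool => ‖g (j, b)‖ ^ 2)
  set r : ℤ → ℝ := fun j => if j ∈ F then ‖U (j, true) 0‖ ^ 2 else 0 with hr
  have hrsum : HasSum r P := by
    have : HasSum r (∑ j ∈ F, r j) := hasSum_sum_of_ne_finset_zero fun j hj => by simp [hr, hj]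
    have hrP : ∑ j ∈ F, r j = P := Finset.sum_congr rfl fun j hj => by simp [hr, hj]
    rwa [hrP] at this
  set η : ℤ → ℝ := fun j => 1 / 2 * (K₁ * (‖g (j, true)‖ + ‖g (j, false)‖ + ‖g (j - 1, true)‖
      + ‖g (j - 1, false)‖) + |edgeSin E Real.pi * (a j - α)| * ‖U (j, true) 0‖) with hη
  have hηle : ∀ j, η j ^ 2 ≤ C * (w j + w (j + -1) + r j) := by
    intro j
    have hBr : (|edgeSin E Real.pi * (a j - α)| * ‖U (j, true) 0‖) ^ 2 ≤ B ^ 2 * r j := by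
      by_cases hj : j ∈ F
      · simp only [hr, hj, if_true]
        rw [mul_pow]
        gcongr
        exact hB j
      · rw [ha j hj]
        simp [hr, hj]
    have h4 : (‖g (j, true)‖ + ‖g (j, false)‖ + ‖g (j - 1, true)‖ + ‖g (j - 1, false)‖) ^ 2
        ≤ 4 * (w j + w (j + -1)) := by
      simp only [hw, ← sub_eq_add_neg]
      nlinarith [sq_nonneg (‖g (j, true)‖ - ‖g (j, false)‖),
        sq_nonneg (‖g (j, true)‖ - ‖g (j - 1, true)‖), sq_nonneg (‖g (j, true)‖ - ‖g (j - 1, false)‖),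
        sq_nonneg (‖g (j, false)‖ - ‖g (j - 1, true)‖),
        sq_nonneg (‖g (j, false)‖ - ‖g (j - 1, false)‖),
        sq_nonneg (‖g (j - 1, true)‖ - ‖g (j - 1, false)‖)]
    have hw0 : 0 ≤ w j + w (j + -1) := by simp only [hw]; positivity
    have hr0 : 0 ≤ r j := by simp only [hr]; split_ifs <;> positivity
    set y := ‖g (j, true)‖ + ‖g (j, false)‖ + ‖g (j - 1, true)‖ + ‖g (j - 1, false)‖
    set z := |edgeSin E Real.pi * (a j - α)| * ‖U (j, true) 0‖
    have e1 : η j ^ 2 ≤ 1 / 2 * (K₁ ^ 2 * y ^ 2 + z ^ 2) := by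
      simp only [hη]
      nlinarith [sq_nonneg (K₁ * y - z)]
    have e2 := mul_le_mul_of_nonneg_left h4 (sq_nonneg K₁)
    rw [hC]
    nlinarith [mul_nonneg (sq_nonneg K₁) hr0, mul_nonneg (sq_nonneg B) hw0,
      mul_nonneg (sq_nonneg B) hr0]
  have hmaj := ((hwsum.add (hasSum_shift hwsum (-1))).add hrsum).mul_left C
  have hηs : Summable fun j => η j ^ 2 := Summable.of_nonneg_of_le (fun _ => sq_nonneg _) hηle
    hmaj.summable
  have hηsum : ∑' j, η j ^ 2 ≤ 2 * C * (‖g‖ ^ 2 + P) := by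
    have := hasSum_le hηle hηs.hasSum hmaj
    have hC0 : 0 ≤ C := by positivity
    nlinarith [mul_nonneg hC0 hP0]
  -- The excess coupling at the vertices of `F` is moved into the source `η`, so that the constant
  -- `M` holds at every vertex.
  have hsub : ∀ j, M * ‖U (j, true) 0‖ ≤ ‖U (j + 1, true) 0‖ + ‖U (j - 1, true) 0‖ + η j := by
    intro j
    have hv := hb₁ a u f U W h j
    have e : ((4 * discriminant α E : ℝ) : ℂ) * U (j, true) 0
        = 2 * holonomy A * (U (j + 1, true) 0 + U (j - 1, true) 0)
        - (2 * holonomy A * (U (j + 1, true) 0 + U (j - 1, true) 0)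
        - (4 * edgeCos E Real.pi + edgeSin E Real.pi * a j) * U (j, true) 0)
        - ((edgeSin E Real.pi * (a j - α) : ℝ) : ℂ) * U (j, true) 0 := by
      rw [discriminant]
      push_cast
      ring
    have e2 := congrArg norm e
    rw [norm_mul, Complex.norm_real, Real.norm_eq_abs, abs_mul, abs_of_pos (by norm_num : (0:ℝ) < 4)]
      at e2
    have e3 := (norm_sub_le (2 * holonomy A * (U (j + 1, true) 0 + U (j - 1, true) 0)
        - (2 * holonomy A * (U (j + 1, true) 0 + U (j - 1, true) 0)
        - (4 * edgeCos E Real.pi + edgeSin E Real.pi * a j) * U (j, true) 0))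
        (((edgeSin E Real.pi * (a j - α) : ℝ) : ℂ) * U (j, true) 0)).trans
        (add_le_add (norm_sub_le _ _) le_rfl)
    rw [← e2, norm_mul ((edgeSin E Real.pi * (a j - α) : ℝ) : ℂ), Complex.norm_real,
      Real.norm_eq_abs, norm_mul, norm_mul, norm_holonomy, Complex.norm_two] at e3
    have e4 := norm_add_le (U (j + 1, true) 0) (U (j - 1, true) 0)
    simp only [hη, hM]
    linarith
  have hXle := sum_sq_le_of_subharmonic hM2 (fun j => norm_nonneg (U (j, true) 0)) hsub hX hηs.hasSum
  have hXle' : X ≤ 2 * C / (M - 2) ^ 2 * (‖g‖ ^ 2 + P) := by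
    refine hXle.trans ?_
    rw [div_mul_eq_mul_div]
    gcongr
  have hedge : ∀ e : ChainEdge, ‖u e‖ ^ 2 ≤ 3 * K₂ ^ 2 * (‖U (e.1, true) 0‖ ^ 2
      + ‖U (e.1 + 1, true) 0‖ ^ 2 + ‖g e‖ ^ 2) := by
    intro e
    refine (pow_le_pow_left₀ (norm_nonneg _) (hb₂ a u f U W h e) 2).trans ?_
    rw [mul_pow, mul_comm 3, mul_assoc]
    refine mul_le_mul_of_nonneg_left ?_ (sq_nonneg _)
    nlinarith [sq_nonneg (‖U (e.1, true) 0‖ - ‖U (e.1 + 1, true) 0‖),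
      sq_nonneg (‖U (e.1, true) 0‖ - ‖g e‖), sq_nonneg (‖U (e.1 + 1, true) 0‖ - ‖g e‖)]
  have hfin := hasSum_le hedge (ChainL2.hasSum_norm_sq u) ((((hasSum_edge hX).add
    (hasSum_edge (hasSum_shift hX 1))).add hgs).mul_left (3 * K₂ ^ 2))
  refine hfin.trans ?_
  rw [mul_assoc (3 * K₂ ^ 2)]
  refine mul_le_mul_of_nonneg_left ?_ (by positivity)
  have e5 : 2 * X + 2 * X ≤ 4 * (4 * C / (M - 2) ^ 2) * (‖g‖ ^ 2 + P) := by
    have n : 0 ≤ 2 * C / (M - 2) ^ 2 * (‖g‖ ^ 2 + P) := by positivity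
    have e6 : 4 * (4 * C / (M - 2) ^ 2) * (‖g‖ ^ 2 + P)
        = 8 * (2 * C / (M - 2) ^ 2 * (‖g‖ ^ 2 + P)) := by ring
    rw [e6]
    linarith
  nlinarith

/-! ### Construction of elements of the domain -/

/-- The continuous function `x ↦ edgePhase p x * φ x`. -/
noncomputable def phaseMul (p : ℝ) (φ : ℝ → ℝ) (hφ : Continuous φ) : C(ℝ, ℂ) :=
  ⟨fun x => edgePhase p x * φ x, by have := continuous_edgePhase p; fun_prop⟩

/-- The gauge parameter takes only the two values `±A`, so the norms of the edge profiles are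
bounded uniformly and square summable coefficients give a vector. -/
theorem exists_chain_vector (A : ℝ) {φ : ℝ → ℝ} (hφ : Continuous φ) : ∃ K : ℝ, 0 < K ∧
    ∀ c : ChainEdge → ℂ, Summable (fun e => ‖c e‖ ^ 2) → ∃ v : ChainL2,
      (∀ e, v e = c e • arcVec (phaseMul (-edgePotential A e) φ hφ)) ∧
      ‖v‖ ^ 2 ≤ K * ∑' e, ‖c e‖ ^ 2 := by
  set k := ‖arcVec (phaseMul (-A) φ hφ)‖ + ‖arcVec (phaseMul (- -A) φ hφ)‖ with hk
  have hke : ∀ e, ‖arcVec (phaseMul (-edgePotential A e) φ hφ)‖ ≤ k := by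
    intro e
    unfold edgePotential
    split_ifs
    · exact le_add_of_nonneg_right (norm_nonneg _)
    · exact le_add_of_nonneg_left (norm_nonneg _)
  refine ⟨k ^ 2 + 1, by positivity, fun c hc => ?_⟩
  have hle : ∀ e, ‖c e • arcVec (phaseMul (-edgePotential A e) φ hφ)‖ ^ 2 ≤ k ^ 2 * ‖c e‖ ^ 2 := by
    intro e
    rw [norm_smul, mul_pow, mul_comm]
    exact mul_le_mul_of_nonneg_right (pow_le_pow_left₀ (norm_nonneg _) (hke e) 2) (sq_nonneg _)
  have hs : Summable fun e => ‖c e • arcVec (phaseMul (-edgePotential A e) φ hφ)‖ ^ 2 :=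
    Summable.of_nonneg_of_le (fun _ => sq_nonneg _) hle (hc.mul_left _)
  have hmem : Memℓp (fun e => c e • arcVec (phaseMul (-edgePotential A e) φ hφ)) 2 :=
    memℓp_gen (by simpa using hs)
  refine ⟨⟨_, hmem⟩, fun e => rfl, ?_⟩
  refine (hasSum_le hle (ChainL2.hasSum_norm_sq ⟨_, hmem⟩) (hc.hasSum.mul_left _)).trans ?_
  have : 0 ≤ ∑' e, ‖c e‖ ^ 2 := tsum_nonneg fun _ => sq_nonneg _
  nlinarith

/-- Elements of the domain with prescribed Cauchy data on the edges. -/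
theorem exists_domain_element (A : ℤ) (E : ℝ) : ∃ K : ℝ, 0 < K ∧
    ∀ (a : ℤ → ℝ) (p q d : ChainEdge → ℂ), Summable (fun e => ‖p e‖ ^ 2) →
    Summable (fun e => ‖q e‖ ^ 2) → Summable (fun e => ‖d e‖ ^ 2) →
    (∀ j, p (j, false) = p (j, true)) →
    (∀ e, holonomy A * (edgeCos E Real.pi * p e + edgeSin E Real.pi * q e) = p (e.1 + 1, true)) →
    (∀ j, q (j, true) + d (j, true) + (q (j, false) + d (j, false))
      - holonomy A * (-(E * edgeSin E Real.pi) * p (j - 1, true) + edgeCos E Real.pi * q (j - 1, true))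
      - holonomy A * (-(E * edgeSin E Real.pi) * p (j - 1, false)
        + edgeCos E Real.pi * q (j - 1, false)) = a j * p (j, true)) →
    ∃ (u f : ChainL2) (U W : ChainEdge → ℝ → ℂ), IsRepresentative A a u f U W ∧
      (∀ e, U e 0 = p e) ∧ (∀ e, W e 0 = q e + d e) ∧
      (∀ e, p e = 0 → q e = 0 → d e = 0 → u e = 0) ∧
      ‖f - (E : ℂ) • u‖ ^ 2 ≤ K * ∑' e, ‖d e‖ ^ 2 := by
  obtain ⟨_, _, h1⟩ := exists_chain_vector A (continuous_edgeCos_right E)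
  obtain ⟨_, _, h2⟩ := exists_chain_vector A (continuous_edgeSin_right E)
  obtain ⟨_, _, h3⟩ := exists_chain_vector A continuous_bump
  have hχ : Continuous fun x => bumpDerivTwo x + E * bump x :=
    continuous_bumpDerivTwo.add (continuous_const.mul continuous_bump)
  obtain ⟨K, hK, h4⟩ := exists_chain_vector A hχ
  refine ⟨K, hK, fun a p q d hp hq hd hc hn hδ => ?_⟩
  obtain ⟨v₁, e₁, -⟩ := h1 p hp
  obtain ⟨v₂, e₂, -⟩ := h2 q hq
  obtain ⟨v₃, e₃, -⟩ := h3 d hd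
  obtain ⟨v₄, e₄, n₄⟩ := h4 d hd
  obtain ⟨b1, b2, b3, b4⟩ := bump_values
  set γ : ChainEdge → ℝ → ℂ := fun e => edgePhase (-edgePotential A e) with hγ
  -- In this gauge `p` and `q` carry an exact solution at energy `E`. The `bump` term changes the
  -- initial slope by `d` and no other Cauchy datum, and it alone produces the residual `-v₄`.
  set U : ChainEdge → ℝ → ℂ := fun e x =>
    γ e x * (p e * edgeCos E x + q e * edgeSin E x + d e * bump x) with hU
  set W : ChainEdge → ℝ → ℂ := fun e x =>
    γ e x * (-(E * p e) * edgeSin E x + q e * edgeCos E x + d e * bumpDeriv x) with hW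
  have hγd : ∀ e x, HasDerivAt (γ e) (-(Complex.I * edgePotential A e) * γ e x) x := fun e x =>
    (hasDerivAt_edgePhase _ x).congr_deriv (by push_cast; ring)
  have hγ0 : ∀ e, γ e 0 = 1 := fun e => edgePhase_zero _
  have hγπ : ∀ e, γ e Real.pi = holonomy A := fun e => by
    have h := edgePhase_neg_mul (edgePotential A e) Real.pi
    rw [edgePhase_pi] at h
    have h' := holonomy_mul_self A
    calc γ e Real.pi = γ e Real.pi * (holonomy A * holonomy A) := by rw [h', mul_one]
      _ = _ := by rw [← mul_assoc]; simp only [hγ]; rw [h, one_mul]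
  have hue : ∀ e, ((v₁ + v₂ + v₃ : ChainL2) e : ℝ → ℂ) =ᵐ[arcMeasure] U e := by
    intro e
    have e5 : (v₁ + v₂ + v₃ : ChainL2) e = p e • arcVec (phaseMul (-edgePotential A e) (edgeCos E)
          (continuous_edgeCos_right E)) + q e • arcVec (phaseMul (-edgePotential A e) (edgeSin E)
          (continuous_edgeSin_right E)) + d e • arcVec (phaseMul (-edgePotential A e) bump
          continuous_bump) := by
      rw [lp.coeFn_add, Pi.add_apply, lp.coeFn_add, Pi.add_apply, e₁, e₂, e₃]
    rw [e5]
    filter_upwards [Lp.coeFn_add (p e • arcVec (phaseMul (-edgePotential A e) (edgeCos E)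
          (continuous_edgeCos_right E)) + q e • arcVec (phaseMul (-edgePotential A e) (edgeSin E)
          (continuous_edgeSin_right E))) (d e • arcVec (phaseMul (-edgePotential A e) bump
          continuous_bump)), Lp.coeFn_add (p e • arcVec (phaseMul (-edgePotential A e) (edgeCos E)
          (continuous_edgeCos_right E))) (q e • arcVec (phaseMul (-edgePotential A e) (edgeSin E)
          (continuous_edgeSin_right E))),
      Lp.coeFn_smul (p e) (arcVec (phaseMul (-edgePotential A e) (edgeCos E)
          (continuous_edgeCos_right E))),
      Lp.coeFn_smul (q e) (arcVec (phaseMul (-edgePotential A e) (edgeSin E)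
          (continuous_edgeSin_right E))),
      Lp.coeFn_smul (d e) (arcVec (phaseMul (-edgePotential A e) bump continuous_bump)),
      coeFn_arcVec (phaseMul (-edgePotential A e) (edgeCos E) (continuous_edgeCos_right E)),
      coeFn_arcVec (phaseMul (-edgePotential A e) (edgeSin E) (continuous_edgeSin_right E)),
      coeFn_arcVec (phaseMul (-edgePotential A e) bump continuous_bump)]
      with x k1 k2 k3 k4 k5 k6 k7 k8
    simp only [Pi.add_apply, Pi.smul_apply] at k1 k2 k3 k4 k5
    rw [k1, k2, k3, k4, k5, k6, k7, k8]
    simp only [phaseMul, hU, hγ, ContinuousMap.coe_mk, smul_eq_mul]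
    ring
  set u : ChainL2 := v₁ + v₂ + v₃ with hu
  have hfe : ∀ e, (((E : ℂ) • u - v₄ : ChainL2) e : ℝ → ℂ) =ᵐ[arcMeasure]
      fun x => E * U e x - d e * (γ e x * ((bumpDerivTwo x + E * bump x : ℝ) : ℂ)) := by
    intro e
    rw [lp.coeFn_sub, Pi.sub_apply, lp.coeFn_smul, Pi.smul_apply, e₄]
    filter_upwards [Lp.coeFn_sub ((E : ℂ) • u e) (d e • arcVec (phaseMul (-edgePotential A e) _ hχ)),
      Lp.coeFn_smul (E : ℂ) (u e), Lp.coeFn_smul (d e) (arcVec (phaseMul (-edgePotential A e) _ hχ)),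
      coeFn_arcVec (phaseMul (-edgePotential A e) _ hχ), hue e] with x k1 k2 k3 k4 k5
    simp only [Pi.sub_apply, Pi.smul_apply] at k1 k2 k3
    rw [k1, k2, k3, k4, k5]
    simp only [phaseMul, hγ, ContinuousMap.coe_mk, smul_eq_mul]
  have hWd : ∀ e x, HasDerivAt (W e) (-(E * U e x - d e * (γ e x * ((bumpDerivTwo x
      + E * bump x : ℝ) : ℂ))) - Complex.I * (edgePotential A e : ℂ) * W e x) x := by
    intro e x
    refine ((hγd e x).mul ((((hasDerivAt_edgeSin E x).ofReal_comp.const_mul (-(E * p e))).add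
      ((hasDerivAt_edgeCos E x).ofReal_comp.const_mul (q e))).add
      ((hasDerivAt_bumpDeriv x).ofReal_comp.const_mul (d e)))).congr_deriv ?_
    simp only [hU, hW, Pi.add_apply]
    push_cast
    ring
  have hWc : ∀ e, Continuous (W e) := fun e =>
    continuous_iff_continuousAt.2 fun x => (hWd e x).continuousAt
  have hUd : ∀ e x, HasDerivAt (U e) (W e x - Complex.I * (edgePotential A e : ℂ) * U e x) x := by
    intro e x
    refine ((hγd e x).mul ((((hasDerivAt_edgeCos E x).ofReal_comp.const_mul (p e)).add
      ((hasDerivAt_edgeSin E x).ofReal_comp.const_mul (q e))).add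
      ((hasDerivAt_bump x).ofReal_comp.const_mul (d e)))).congr_deriv ?_
    simp only [hU, hW, Pi.add_apply]
    push_cast
    ring
  have hUc : ∀ e, Continuous (U e) := fun e =>
    continuous_iff_continuousAt.2 fun x => (hUd e x).continuousAt
  have hU0 : ∀ e, U e 0 = p e := fun e => by
    simp [hU, hγ0, edgeCos_zero, edgeSin_zero, b1]
  have hUπ : ∀ e, U e Real.pi = p (e.1 + 1, true) := fun e => by
    rw [← hn e]
    simp only [hU, hγπ, b2]
    push_cast
    ring
  have hW0 : ∀ e, W e 0 = q e + d e := fun e => by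
    simp [hW, hγ0, edgeCos_zero, edgeSin_zero, b3]
  have hWπ : ∀ e, W e Real.pi = holonomy A * (-(E * edgeSin E Real.pi) * p e
      + edgeCos E Real.pi * q e) := fun e => by
    simp only [hW, hγπ, b4]
    push_cast
    ring
  refine ⟨u, (E : ℂ) • u - v₄, U, W, ⟨hue, fun e x _ => (hUd e x).hasDerivWithinAt,
    fun e => (hWc e).continuousOn, ?_, ?_, ?_⟩, hU0, hW0, ?_, ?_⟩
  · intro e x hx
    have hγc : Continuous (γ e) := continuous_edgePhase _
    have hUce := hUc e
    have hWce := hWc e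
    have hcont : Continuous fun x => -(E * U e x - d e * (γ e x * ((bumpDerivTwo x
      + E * bump x : ℝ) : ℂ))) - Complex.I * (edgePotential A e : ℂ) * W e x := by
      have := Complex.continuous_ofReal.comp hχ
      simp only [Function.comp_def] at this
      fun_prop
    have hint := intervalIntegral.integral_eq_sub_of_hasDerivAt (fun t _ => hWd e t)
      (hcont.intervalIntegrable 0 x)
    have hcong : ∫ t in (0 : ℝ)..x, (-(((E : ℂ) • u - v₄ : ChainL2) e : ℝ → ℂ) t
        - Complex.I * (edgePotential A e : ℂ) * W e t)
        = ∫ t in (0 : ℝ)..x, (-(E * U e t - d e * (γ e t * ((bumpDerivTwo t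
      + E * bump t : ℝ) : ℂ))) - Complex.I * (edgePotential A e : ℂ) * W e t) := by
      apply intervalIntegral.integral_congr_ae
      filter_upwards [(ae_restrict_iff' measurableSet_Icc).1 (hfe e)] with t ht htx
      rw [uIoc_of_le hx.1] at htx
      rw [ht ⟨htx.1.le, htx.2.trans hx.2⟩]
    rw [hcong, hint]
    ring
  · intro j
    refine ⟨?_, ?_, ?_⟩
    · rw [hU0, hU0, hc]
    · rw [hU0, hUπ]
      simp
    · rw [hU0, hUπ]
      simp
  · intro j
    rw [hU0, hW0, hW0, hWπ, hWπ]
    exact hδ j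
  · intro e z1 z2 z3
    rw [hu, lp.coeFn_add, Pi.add_apply, lp.coeFn_add, Pi.add_apply, e₁, e₂, e₃, z1, z2, z3]
    simp
  · rw [sub_sub_cancel_left, norm_neg]
    exact n₄

/-- Elements of the domain with prescribed vertex values. The residual measures the failure of the
difference equation. -/
theorem exists_domain_element_of_nodal (A : ℤ) {E : ℝ} (hs : edgeSin E Real.pi ≠ 0) :
    ∃ K : ℝ, 0 < K ∧ ∀ (a : ℤ → ℝ) (V : ℤ → ℂ), Summable (fun j => ‖V j‖ ^ 2) →
    ∀ D : ℤ → ℂ, (∀ j, 2 * holonomy A * (V (j + 1) + V (j - 1))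
      - (4 * edgeCos E Real.pi + edgeSin E Real.pi * a j) * V j = D j) →
    Summable (fun j => ‖D j‖ ^ 2) →
    ∃ (u f : ChainL2) (U W : ChainEdge → ℝ → ℂ), IsRepresentative A a u f U W ∧
      (∀ e, U e 0 = V e.1) ∧ (∀ e, V e.1 = 0 → V (e.1 + 1) = 0 → D e.1 = 0 → u e = 0) ∧
      ‖f - (E : ℂ) • u‖ ^ 2 ≤ K * ∑' j, ‖D j‖ ^ 2 := by
  obtain ⟨K, hK, h⟩ := exists_domain_element A E
  have hs' : (edgeSin E Real.pi : ℂ) ≠ 0 := by exact_mod_cast hs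
  refine ⟨K * (2 * ‖(edgeSin E Real.pi : ℂ)‖⁻¹ ^ 2), by positivity, fun a V hV D hD hDs => ?_⟩
  set σ := holonomy A
  have hσ : σ * σ = 1 := holonomy_mul_self A
  set c := (edgeCos E Real.pi : ℂ)
  set s := (edgeSin E Real.pi : ℂ)
  have hp : c ^ 2 + E * s ^ 2 = 1 := by
    have := edgeCos_sq_add E Real.pi
    simp only [c, s]
    exact_mod_cast this
  have hV1 : Summable (fun j => ‖V (j + 1)‖ ^ 2) := (hasSum_shift hV.hasSum 1).summable
  have hqs : Summable fun e : ChainEdge => ‖(σ * V (e.1 + 1) - c * V e.1) / s‖ ^ 2 := by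
    refine Summable.of_nonneg_of_le (fun _ => sq_nonneg _) (fun e => ?_)
      ((((hasSum_edge hV1.hasSum).summable).add ((hasSum_edge hV.hasSum).summable.mul_left
        (‖c‖ ^ 2))).mul_left (2 * ‖s‖⁻¹ ^ 2))
    rw [norm_div, div_eq_mul_inv, mul_pow]
    have := norm_sub_le (σ * V (e.1 + 1)) (c * V e.1)
    rw [norm_mul, norm_mul, norm_holonomy, one_mul] at this
    have h2 := pow_le_pow_left₀ (norm_nonneg _) this 2
    have h3 : ‖σ * V (e.1 + 1) - c * V e.1‖ ^ 2 ≤ 2 * (‖V (e.1 + 1)‖ ^ 2 + ‖c‖ ^ 2 * ‖V e.1‖ ^ 2) := by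
      nlinarith [sq_nonneg (‖V (e.1 + 1)‖ - ‖c‖ * ‖V e.1‖)]
    have := mul_le_mul_of_nonneg_right h3 (sq_nonneg ‖s‖⁻¹)
    linarith
  have hds := ((hasSum_edge hDs.hasSum).mul_left (‖s‖⁻¹ ^ 2))
  have hds' : ∀ e : ChainEdge, ‖-(D e.1 / (2 * s))‖ ^ 2 ≤ ‖s‖⁻¹ ^ 2 * ‖D e.1‖ ^ 2 := by
    intro e
    rw [norm_neg, norm_div, norm_mul, Complex.norm_two, div_pow, mul_pow]
    have : 0 < ‖s‖ := norm_pos_iff.2 hs'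
    rw [inv_pow, inv_mul_eq_div]
    exact div_le_div_of_nonneg_left (sq_nonneg _) (by positivity) (by nlinarith [sq_nonneg ‖s‖])
  have hdsum : Summable fun e : ChainEdge => ‖-(D e.1 / (2 * s))‖ ^ 2 :=
    Summable.of_nonneg_of_le (fun _ => sq_nonneg _) hds' hds.summable
  -- The slope `q` is the one for which the edge solution takes the prescribed values at both ends.
  -- The defect `D` is shared equally by the two edges starting at the vertex, hence the denominator
  -- `2 * s`.
  obtain ⟨u, f, U, W, hrep, hU, -, hz, hn⟩ := h a (fun e => V e.1)
    (fun e => (σ * V (e.1 + 1) - c * V e.1) / s) (fun e => -(D e.1 / (2 * s)))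
    (hasSum_edge hV.hasSum).summable hqs hdsum (fun _ => rfl) (fun e => by
      have : c * V e.1 + s * ((σ * V (e.1 + 1) - c * V e.1) / s) = σ * V (e.1 + 1) := by
        field_simp
        ring
      show σ * (c * V e.1 + s * ((σ * V (e.1 + 1) - c * V e.1) / s)) = V (e.1 + 1)
      rw [this, ← mul_assoc, hσ, one_mul]) (fun j => by
      have hDj := hD j
      simp only [sub_add_cancel]
      rw [← hDj]
      field_simp
      linear_combination (-4 * c * V j) * hσ + 4 * σ * V (j - 1) * hp)
  refine ⟨u, f, U, W, hrep, hU, fun e h1 h2 h3 => hz e h1 ?_ ?_, ?_⟩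
  · simp [h1, h2]
  · simp [h3]
  · refine hn.trans ?_
    rw [mul_assoc]
    refine mul_le_mul_of_nonneg_left ?_ hK.le
    refine (hasSum_le hds' hdsum.hasSum hds).trans_eq ?_
    ring

/-! ### The essential spectrum -/

theorem tendsto_inner_of_support_escaping {u : ℕ → ChainL2} (hn : ∀ i, ‖u i‖ ≤ 1)
    (hsupp : ∀ (i : ℕ) (e : ChainEdge), e.1 ≤ i → u i e = 0) (g : ChainL2) :
    Tendsto (fun i => inner ℂ g (u i)) atTop (𝓝 0) := by
  rw [Metric.tendsto_atTop]
  intro ε hε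
  have hg := lp.hasSum_single (p := 2) (by norm_num) g
  obtain ⟨S, hS⟩ := (Metric.tendsto_atTop.1 hg) ε hε
  specialize hS S le_rfl
  obtain ⟨N, hN⟩ : ∃ N : ℕ, ∀ e ∈ S, e.1 ≤ N := by
    refine ⟨∑ e ∈ S, e.1.natAbs, fun e he => ?_⟩
    have := Finset.single_le_sum (f := fun e : ChainEdge => e.1.natAbs) (fun _ _ => Nat.zero_le _) he
    omega
  refine ⟨N, fun i hi => ?_⟩
  have h0 : inner ℂ (∑ e ∈ S, lp.single 2 e (g e)) (u i) = 0 := by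
    rw [sum_inner]
    refine Finset.sum_eq_zero fun e he => ?_
    rw [lp.inner_single_left, hsupp i e ((hN e he).trans (by exact_mod_cast hi)), inner_zero_right]
  have h1 : inner ℂ g (u i) = inner ℂ (g - ∑ e ∈ S, lp.single 2 e (g e)) (u i) := by
    rw [inner_sub_left, h0, sub_zero]
  rw [dist_zero_right, h1]
  refine (norm_inner_le_norm _ _).trans_lt ?_
  rw [dist_comm, dist_eq_norm] at hS
  calc _ ≤ ‖g - ∑ e ∈ S, lp.single 2 e (g e)‖ * 1 := by gcongr; exact hn i
    _ < ε := by rwa [mul_one]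

/-- Approximate eigenvectors supported ever further to the right converge weakly to zero
automatically once normalized. -/
theorem mem_essentialSpectrum_of_localized {T : Submodule ℂ (ChainL2 × ChainL2)} {E : ℝ}
    (h : ∀ (N : ℕ) (ε : ℝ), 0 < ε → ∃ p ∈ T, p.1 ≠ 0 ∧ ‖p.2 - (E : ℂ) • p.1‖ ≤ ε * ‖p.1‖ ∧
      ∀ e : ChainEdge, e.1 ≤ N → p.1 e = 0) : E ∈ essentialSpectrum T := by
  choose p hp h0 hle hsupp using fun N : ℕ => h N (1 / (N + 1)) (by positivity)
  have hnorm : ∀ i, 0 < ‖(p i).1‖ := fun i => norm_pos_iff.2 (h0 i)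
  have hunit : ∀ i, ‖((‖(p i).1‖⁻¹ : ℝ) : ℂ) • (p i).1‖ = 1 := fun i => by
    rw [norm_smul, Complex.norm_real, norm_inv, norm_norm, inv_mul_cancel₀ (hnorm i).ne']
  refine ⟨fun i => ((‖(p i).1‖⁻¹ : ℝ) : ℂ) • (p i).1, fun i => ((‖(p i).1‖⁻¹ : ℝ) : ℂ) • (p i).2,
    fun i => T.smul_mem _ (hp i), hunit, ?_, ?_⟩
  · refine tendsto_inner_of_support_escaping (fun i => (hunit i).le) fun i e he => ?_
    rw [lp.coeFn_smul, Pi.smul_apply, hsupp i e he, smul_zero]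
  · rw [tendsto_zero_iff_norm_tendsto_zero]
    refine squeeze_zero (fun _ => norm_nonneg _) (fun i => ?_) tendsto_one_div_add_atTop_nhds_zero_nat
    rw [smul_comm, ← smul_sub, norm_smul, Complex.norm_real, norm_inv, norm_norm,
      inv_mul_le_iff₀ (hnorm i), mul_comm]
    exact hle i

/-- A sine on the upper edge of one ring and minus the sine on the lower one vanishes at both
vertices, and the slopes cancel there. This is an exact eigenfunction on any single ring, whatever
the couplings are. -/
theorem mem_essentialSpectrum_of_edgeSin_eq_zero (A : ℤ) (a : ℤ → ℝ) {E : ℝ}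
    (hs : edgeSin E Real.pi = 0) : E ∈ essentialSpectrum (chainHamiltonian A a) := by
  refine mem_essentialSpectrum_of_localized fun N ε hε => ?_
  obtain ⟨K, hK, h⟩ := exists_domain_element A E
  set q : ChainEdge → ℂ := fun e => if e.1 = N + 1 then (if e.2 then 1 else -1) else 0 with hq
  have hqf : ∀ j : ℤ, q (j, false) = -q (j, true) := by
    intro j
    by_cases hj : j = N + 1 <;> simp [hq, hj]
  have hqs : Summable fun e => ‖q e‖ ^ 2 := by
    refine summable_of_ne_finset_zero (s := ({((N : ℤ) + 1, true), ((N : ℤ) + 1, false)} : Finset ChainEdge)) fun e he => ?_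
    have he' : e.1 ≠ N + 1 := by
      obtain ⟨j, b⟩ := e
      rintro rfl
      cases b <;> simp at he
    simp [hq, he']
  obtain ⟨u, f, U, W, hrep, hU, hW, hz, hn⟩ := h a 0 q 0 (by simp) hqs
    (by simp) (fun _ => rfl) (by simp [hs])
    (fun j => by rw [hqf j, hqf (j - 1)]; simp [hs])
  have hfu : f - (E : ℂ) • u = 0 := by
    have hn' : ‖f - (E : ℂ) • u‖ ^ 2 ≤ 0 := hn.trans_eq (by simp)
    exact norm_eq_zero.1 (pow_eq_zero_iff two_ne_zero |>.1 (le_antisymm hn' (sq_nonneg _)))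
  refine ⟨(u, f), ⟨U, W, hrep⟩, fun hu0 => ?_, ?_, fun e he => ?_⟩
  -- If `u` were zero, its continuous representative would vanish on the edge and so would `edgeSin
  -- E`, contradicting its unit slope at `0`.
  · simp only at hu0
    have hv := fun x hx => (hrep.variation E ((N : ℤ) + 1, true) (x := x) hx).1
    have h1 : (U ((N : ℤ) + 1, true)) =ᵐ[arcMeasure] 0 := by
      refine (hrep.1 ((N : ℤ) + 1, true)).symm.trans ?_
      rw [hu0]
      exact Lp.coeFn_zero _ _ _
    have hUc : ContinuousOn (U ((N : ℤ) + 1, true)) (Icc 0 Real.pi) :=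
      fun x hx => (hrep.2.1 ((N : ℤ) + 1, true) x hx).continuousWithinAt
    have hU0 : EqOn (U ((N : ℤ) + 1, true)) 0 (Icc 0 Real.pi) :=
      Measure.eqOn_Icc_of_ae_eq volume Real.pi_pos.ne h1 hUc continuousOn_const
    have hint : ∀ x ∈ Icc (0 : ℝ) Real.pi, edgeSin E x = 0 := by
      intro x hx
      have := hv x hx
      rw [hU0 hx, hfu, hU, hW] at this
      have hzero : ∫ t in (0 : ℝ)..x, edgePhase (edgePotential A ((N : ℤ) + 1, true)) t
          * edgeSin E (x - t) * ((0 : ChainL2) ((N : ℤ) + 1, true) : ℝ → ℂ) t = 0 := by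
        have : ∫ t in (0 : ℝ)..x, edgePhase (edgePotential A ((N : ℤ) + 1, true)) t
          * edgeSin E (x - t) * ((0 : ChainL2) ((N : ℤ) + 1, true) : ℝ → ℂ) t
          = ∫ t in (0 : ℝ)..x, (0 : ℂ) := by
          apply intervalIntegral.integral_congr_ae
          filter_upwards [(ae_restrict_iff' measurableSet_Icc).1 (Lp.coeFn_zero ℂ 2 arcMeasure)]
            with t ht htx
          rw [uIoc_of_le hx.1] at htx
          rw [lp.coeFn_zero, Pi.zero_apply, ht ⟨htx.1.le, htx.2.trans hx.2⟩]
          simp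
        simpa using this
      rw [hzero] at this
      have h9 : (0 : ℂ) = (edgeSin E x : ℂ) := by simpa [hq] using this
      exact_mod_cast h9.symm
    have hC : HasDerivWithinAt (edgeSin E) 1 (Icc 0 Real.pi) 0 := by
      simpa [edgeCos_zero] using (hasDerivAt_edgeSin E 0).hasDerivWithinAt (s := Icc 0 Real.pi)
    have h0 : HasDerivWithinAt (edgeSin E) 0 (Icc 0 Real.pi) 0 :=
      (hasDerivWithinAt_const 0 (Icc 0 Real.pi) (0 : ℝ)).congr (fun x hx => hint x hx)
        (hint 0 (left_mem_Icc.2 Real.pi_pos.le))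
    have := (uniqueDiffOn_Icc Real.pi_pos 0 (left_mem_Icc.2 Real.pi_pos.le)).eq_deriv _ hC h0
    norm_num at this
  · simp only
    rw [hfu, norm_zero]
    positivity
  · refine hz e rfl ?_ rfl
    have : e.1 ≠ N + 1 := by
      have : e.1 ≤ N := he
      omega
    simp [hq, this]

/-- For `|ξ| ≤ 1` there is `ω` of modulus one with `ω + ω⁻¹ = 2 ξ`, and `(σ ω)^j` solves the
unperturbed difference equation. Cut off to `M` sites beyond all impurities, it fails to do so only
next to the two cuts, while its norm grows with `M`. -/
theorem mem_essentialSpectrum_of_abs_discriminant_le (A : ℤ) {a : ℤ → ℝ} {α E : ℝ} {J : ℕ}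
    (ha : ∀ j : ℤ, J ≤ j → a j = α) (hs : edgeSin E Real.pi ≠ 0) (hE : |discriminant α E| ≤ 1) :
    E ∈ essentialSpectrum (chainHamiltonian A a) := by
  refine mem_essentialSpectrum_of_localized fun N ε hε => ?_
  obtain ⟨K, hK, h⟩ := exists_domain_element_of_nodal A hs
  obtain ⟨K', hK', hb⟩ := exists_nodal_bound A
  -- the residual of a truncated plane wave does not depend on its length
  set B := K * 256 with hB
  -- The `M` vertex values of modulus one are bounded by the norms of `u` and of the residual. Since
  -- the latter is at most `B` in square, this size of `M` forces `‖u‖² > B / ε²`.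
  obtain ⟨M, hM⟩ := exists_nat_gt (3 * K' ^ 2 * ((1 + |E|) ^ 2 * (B / ε ^ 2) + B))
  set P : ℤ := N + J + 1 with hP
  set ω : ℂ := Complex.exp (Real.arccos (discriminant α E) * Complex.I) with hω
  have hω0 : ω ≠ 0 := Complex.exp_ne_zero _
  have hωn : ‖ω‖ = 1 := Complex.norm_exp_ofReal_mul_I _
  have hωs : ω + ω⁻¹ = 2 * discriminant α E := by
    have := Complex.two_cos (Real.arccos (discriminant α E))
    rw [← Complex.ofReal_cos, Real.cos_arccos (abs_le.1 hE).1 (abs_le.1 hE).2] at this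
    rw [this, hω, ← Complex.exp_neg]
    ring_nf
  set σ := holonomy A with hσdef
  have hσ : σ * σ = 1 := holonomy_mul_self A
  have hσ0 : σ ≠ 0 := fun h0 => by rw [h0, mul_zero] at hσ; exact zero_ne_one hσ
  have hσi : σ⁻¹ = σ := by field_simp; rw [pow_two, hσ]
  set V : ℤ → ℂ := fun j => if P < j ∧ j ≤ P + M then (σ * ω) ^ j else 0 with hV
  have hVn : ∀ j, ‖V j‖ ≤ 1 := by
    intro j
    simp only [hV]
    split_ifs
    · rw [norm_zpow, norm_mul, norm_holonomy, hωn]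
      simp
    · simp
  have hVout : ∀ j ∉ Finset.Ioc P (P + M), V j = 0 := fun j hj => by
    simp only [Finset.mem_Ioc] at hj
    simp [hV, hj]
  have hVs : Summable fun j => ‖V j‖ ^ 2 :=
    summable_of_ne_finset_zero (s := Finset.Ioc P (P + M)) fun j hj => by simp [hVout j hj]
  set D : ℤ → ℂ := fun j => 2 * σ * (V (j + 1) + V (j - 1))
      - (4 * edgeCos E Real.pi + edgeSin E Real.pi * a j) * V j with hD
  have hDξ : ∀ j, D j = 2 * σ * (V (j + 1) + V (j - 1)) - 4 * discriminant α E * V j := by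
    intro j
    simp only [hD]
    by_cases hj : P < j
    · rw [ha j (by omega), discriminant]
      push_cast
      ring
    · have : V j = 0 := hVout j (by simp [hj])
      rw [this]
      ring
  have hDn : ∀ j, ‖D j‖ ≤ 8 := by
    intro j
    rw [hDξ]
    have h1 := norm_sub_le (2 * σ * (V (j + 1) + V (j - 1))) (4 * discriminant α E * V j)
    rw [norm_mul, norm_mul, norm_mul, norm_mul, norm_holonomy, Complex.norm_two, Complex.norm_real,
      Real.norm_eq_abs] at h1
    have h2 := norm_add_le (V (j + 1)) (V (j - 1))
    have h3 : ‖(4 : ℂ)‖ = 4 := by norm_num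
    rw [h3] at h1
    have h4 : |discriminant α E| * ‖V j‖ ≤ 1 * 1 :=
      mul_le_mul hE (hVn j) (norm_nonneg _) zero_le_one
    linarith [hVn (j + 1), hVn (j - 1)]
  have hDout : ∀ j ∉ ({P, P + 1, P + M, P + M + 1} : Finset ℤ), D j = 0 := by
    intro j hj
    simp only [Finset.mem_insert, Finset.mem_singleton, not_or] at hj
    obtain ⟨j1, j2, j3, j4⟩ := hj
    rw [hDξ]
    by_cases hin : P < j ∧ j ≤ P + M
    · have i1 : P < j + 1 ∧ j + 1 ≤ P + M := by omega
      have i2 : P < j - 1 ∧ j - 1 ≤ P + M := by omega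
      simp only [hV, hin, i1, i2, and_self, if_true]
      have hσω : σ * ω ≠ 0 := mul_ne_zero hσ0 hω0
      rw [zpow_add_one₀ hσω, zpow_sub_one₀ hσω, mul_inv, hσi]
      linear_combination (2 * (σ * ω) ^ j) * (ω + ω⁻¹) * hσ + 2 * (σ * ω) ^ j * hωs
    · have i1 : ¬(P < j + 1 ∧ j + 1 ≤ P + M) := by omega
      have i2 : ¬(P < j - 1 ∧ j - 1 ≤ P + M) := by omega
      simp only [hV, hin, i1, i2, if_false]
      ring
  have hDs : Summable fun j => ‖D j‖ ^ 2 :=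
    summable_of_ne_finset_zero (s := {P, P + 1, P + M, P + M + 1}) fun j hj => by simp [hDout j hj]
  -- At most four sites contribute, each at most `8²`.
  have hDsum : ∑' j, ‖D j‖ ^ 2 ≤ 256 := by
    rw [tsum_eq_sum (s := {P, P + 1, P + M, P + M + 1}) fun j hj => by simp [hDout j hj]]
    refine (Finset.sum_le_card_nsmul _ _ 64 fun j _ => ?_).trans ?_
    · nlinarith [hDn j, norm_nonneg (D j)]
    · have : ({P, P + 1, P + M, P + M + 1} : Finset ℤ).card ≤ 4 := Finset.card_le_four
      rw [nsmul_eq_mul]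
      have : (({P, P + 1, P + M, P + M + 1} : Finset ℤ).card : ℝ) ≤ 4 := by exact_mod_cast this
      linarith
  obtain ⟨u, f, U, W, hrep, hU, hz, hn⟩ := h a V hVs D (fun _ => rfl) hDs
  set g : ChainL2 := f - (E : ℂ) • u with hg
  have hgB : ‖g‖ ^ 2 ≤ B := hn.trans (mul_le_mul_of_nonneg_left hDsum hK.le)
  have inj : Function.Injective fun j : ℤ => ((j, true) : ChainEdge) :=
    fun i j hij => (Prod.mk.inj hij).1
  have hlow : (M : ℝ) ≤ 3 * K' ^ 2 * ((1 + |E|) ^ 2 * ‖u‖ ^ 2 + ‖g‖ ^ 2) := by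
    have hpt : ∀ j : ℤ, ‖V j‖ ^ 2 ≤ 3 * K' ^ 2 * ((1 + |E|) ^ 2 * ‖u (j, true)‖ ^ 2
        + ‖g (j, true)‖ ^ 2) := by
      intro j
      have h1 := hb a u f U W hrep (j, true)
      rw [hU] at h1
      have h2 : ‖f (j, true)‖ ≤ ‖g (j, true)‖ + |E| * ‖u (j, true)‖ := by
        have : f (j, true) = g (j, true) + (E : ℂ) • u (j, true) := by
          rw [hg, lp.coeFn_sub, Pi.sub_apply, lp.coeFn_smul, Pi.smul_apply, sub_add_cancel]
        rw [this]
        refine (norm_add_le _ _).trans ?_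
        rw [norm_smul, Complex.norm_real, Real.norm_eq_abs]
      have h3 : ‖V j‖ ≤ K' * (‖g (j, true)‖ + (1 + |E|) * ‖u (j, true)‖) :=
        h1.trans (mul_le_mul_of_nonneg_left (by linarith) hK'.le)
      refine (pow_le_pow_left₀ (norm_nonneg _) h3 2).trans ?_
      rw [mul_pow, mul_comm (3 : ℝ), mul_assoc]
      refine mul_le_mul_of_nonneg_left ?_ (sq_nonneg _)
      nlinarith [sq_nonneg (‖g (j, true)‖ - (1 + |E|) * ‖u (j, true)‖), sq_nonneg ‖g (j, true)‖,
        sq_nonneg ((1 + |E|) * ‖u (j, true)‖)]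
    have hus := (ChainL2.hasSum_norm_sq u).summable
    have hgs := (ChainL2.hasSum_norm_sq g).summable
    have hsum := hasSum_le hpt hVs.hasSum ((((hus.comp_injective inj).hasSum.mul_left
      ((1 + |E|) ^ 2)).add (hgs.comp_injective inj).hasSum).mul_left (3 * K' ^ 2))
    have hVM : ∑' j, ‖V j‖ ^ 2 = M := by
      rw [tsum_eq_sum (s := Finset.Ioc P (P + M)) fun j hj => by simp [hVout j hj],
        Finset.sum_congr rfl (g := fun _ => (1 : ℝ)) fun j hj => ?_]
      · simp
      · have hj' := Finset.mem_Ioc.1 hj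
        simp only [hV, hj', and_self, if_true]
        rw [norm_zpow, norm_mul, norm_holonomy, hωn]
        simp
    rw [hVM] at hsum
    refine hsum.trans (mul_le_mul_of_nonneg_left (add_le_add (mul_le_mul_of_nonneg_left ?_
      (sq_nonneg _)) ?_) (by positivity))
    · rw [← (ChainL2.hasSum_norm_sq u).tsum_eq]
      exact tsum_comp_le_tsum_of_inj hus (fun _ => sq_nonneg _) inj
    · rw [← (ChainL2.hasSum_norm_sq g).tsum_eq]
      exact tsum_comp_le_tsum_of_inj hgs (fun _ => sq_nonneg _) inj
  have hubig : B / ε ^ 2 < ‖u‖ ^ 2 := by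
    by_contra hcon
    push Not at hcon
    have : 3 * K' ^ 2 * ((1 + |E|) ^ 2 * ‖u‖ ^ 2 + ‖g‖ ^ 2)
        ≤ 3 * K' ^ 2 * ((1 + |E|) ^ 2 * (B / ε ^ 2) + B) := by gcongr
    linarith
  have hB0 : 0 ≤ B := by positivity
  refine ⟨(u, f), ⟨U, W, hrep⟩, fun hu0 => ?_, ?_, fun e he => ?_⟩
  · simp only at hu0
    rw [hu0, norm_zero] at hubig
    have : 0 ≤ B / ε ^ 2 := by positivity
    norm_num at hubig
    linarith
  · simp only
    rw [← hg]
    refine abs_le_of_sq_le_sq' ?_ (by positivity) |>.2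
    rw [div_lt_iff₀ (by positivity)] at hubig
    rw [mul_pow]
    linarith
  · have he' : e.1 ≤ N := he
    refine hz e (hVout _ ?_) (hVout _ ?_) ?_
    · simp only [Finset.mem_Ioc]; omega
    · simp only [Finset.mem_Ioc]; omega
    · have z1 : V e.1 = 0 := hVout _ (by simp only [Finset.mem_Ioc]; omega)
      have z2 : V (e.1 + 1) = 0 := hVout _ (by simp only [Finset.mem_Ioc]; omega)
      have z3 : V (e.1 - 1) = 0 := hVout _ (by simp only [Finset.mem_Ioc]; omega)
      rw [hDξ, z1, z2, z3]
      ring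

/-- Along a singular Weyl sequence the residual and the finitely many vertex values in `F` tend to
zero, so the gap estimate contradicts the unit norms. -/
theorem not_mem_essentialSpectrum_of_gap (A : ℤ) {a : ℤ → ℝ} {α E : ℝ} {F : Finset ℤ}
    (ha : ∀ j ∉ F, a j = α) (hE : 1 < |discriminant α E|) :
    E ∉ essentialSpectrum (chainHamiltonian A a) := by
  rintro ⟨u, f, hT, hn, hw, hr⟩
  obtain ⟨K, hK, hb⟩ := exists_gap_estimate A hE ha
  choose U W hrep using fun i => isLaplacianPair_iff.1 (hT i)
  have hval : ∀ j : ℤ, Tendsto (fun i => ‖U i (j, true) 0‖ ^ 2) atTop (𝓝 0) := by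
    intro j
    obtain ⟨g₁, g₂, hg⟩ := exists_nodal_functional A (j, true)
    have h1 : Tendsto (fun i => inner ℂ g₁ (u i) + (inner ℂ g₂ (f i - (E : ℂ) • u i)
        + E * inner ℂ g₂ (u i))) atTop (𝓝 (0 + (0 + E * 0))) := by
      refine (hw g₁).add (Tendsto.add ?_ ((hw g₂).const_mul _))
      have := (tendsto_const_nhds (x := g₂)).inner (𝕜 := ℂ) hr
      rwa [inner_zero_right] at this
    have h2 : (fun i => U i (j, true) 0) = fun i => inner ℂ g₁ (u i)
        + (inner ℂ g₂ (f i - (E : ℂ) • u i) + E * inner ℂ g₂ (u i)) := by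
      ext i
      rw [hg a (u i) (f i) (U i) (W i) (hrep i), inner_sub_right, inner_smul_right]
      ring
    rw [← h2] at h1
    simpa using h1.norm.pow 2
  have h3 : Tendsto (fun i => K * (‖f i - (E : ℂ) • u i‖ ^ 2 + ∑ j ∈ F, ‖U i (j, true) 0‖ ^ 2))
      atTop (𝓝 (K * (0 + ∑ j ∈ F, 0))) := by
    refine Tendsto.const_mul _ (Tendsto.add ?_ (tendsto_finsetSum _ fun j _ => hval j))
    simpa using hr.norm.pow 2
  have h4 : (1 : ℝ) ≤ K * (0 + ∑ j ∈ F, 0) := by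
    refine ge_of_tendsto' h3 fun i => ?_
    have := hb (u i) (f i) (U i) (W i) (hrep i)
    rwa [hn i, one_pow] at this
  norm_num at h4

/-- The essential spectrum of a chain whose coupling is constant up to finitely many vertices. -/
theorem essentialSpectrum_chainHamiltonian (A : ℤ) {a : ℤ → ℝ} {α : ℝ} {F : Finset ℤ}
    (ha : ∀ j ∉ F, a j = α) :
    essentialSpectrum (chainHamiltonian A a) = {E | |discriminant α E| ≤ 1} := by
  ext E
  change _ ↔ |discriminant α E| ≤ 1
  constructor
  · intro h
    by_contra hcon
    exact not_mem_essentialSpectrum_of_gap A ha (not_le.1 hcon) h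
  · intro h
    by_cases hs : edgeSin E Real.pi = 0
    · exact mem_essentialSpectrum_of_edgeSin_eq_zero A a hs
    · refine mem_essentialSpectrum_of_abs_discriminant_le A (J := ∑ j ∈ F, j.natAbs + 1)
        (fun j hj => ha j fun hjF => ?_) hs h
      have := Finset.single_le_sum (f := fun j : ℤ => j.natAbs) (fun _ _ => Nat.zero_le _) hjF
      omega

/-! ### Two impurities: Green function and secular determinant -/

/-- A square summable solution of the homogeneous difference equation in a gap vanishes. -/
theorem eq_zero_of_difference_eq {σ : ℂ} (hσ : ‖σ‖ = 1) {ξ : ℝ} (hξ : 1 < |ξ|) {V : ℤ → ℂ}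
    (hV : Summable fun j => ‖V j‖ ^ 2)
    (h : ∀ j, σ * (V (j + 1) + V (j - 1)) - 2 * ξ * V j = 0) (j : ℤ) : V j = 0 := by
  have hle : ∀ j, 2 * |ξ| * ‖V j‖ ≤ ‖V (j + 1)‖ + ‖V (j - 1)‖ + (fun _ => (0 : ℝ)) j := by
    intro j
    have e := congrArg norm (sub_eq_zero.1 (h j))
    rw [norm_mul, norm_mul, norm_mul, hσ, one_mul, Complex.norm_two, Complex.norm_real,
      Real.norm_eq_abs] at e
    have := norm_add_le (V (j + 1)) (V (j - 1))
    simp only [add_zero]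
    linarith
  have hX := sum_sq_le_of_subharmonic (by linarith : 2 < 2 * |ξ|) (fun j => norm_nonneg (V j)) hle
    hV.hasSum (H := 0) (by simp)
  rw [zero_div] at hX
  have h1 := (hV.le_tsum j fun _ _ => sq_nonneg _).trans hX
  exact norm_eq_zero.1 (pow_eq_zero_iff two_ne_zero |>.1 (le_antisymm h1 (sq_nonneg _)))

/-- The decaying Green function of the difference equation. -/
def latticeGreen (μ : ℂ) (i : ℤ) : ℂ := μ ^ i.natAbs

theorem latticeGreen_zero (μ : ℂ) : latticeGreen μ 0 = 1 := by simp [latticeGreen]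

/-- Away from the origin both `(σ l)^i` and its reflection solve the equation, as `σ² = 1` reduces
it to `l² + 1 = 2 ξ l`. At the origin there remains `2 l - 2 ξ = l - l⁻¹`. -/
theorem latticeGreen_difference {σ l : ℂ} (hσ : σ * σ = 1) (hl : l ≠ 0) {ξ : ℂ}
    (h : l + l⁻¹ = 2 * ξ) (i : ℤ) :
    σ * (latticeGreen (σ * l) (i + 1) + latticeGreen (σ * l) (i - 1)) - 2 * ξ * latticeGreen (σ * l) i
      = if i = 0 then l - l⁻¹ else 0 := by
  have hpos : ∀ n : ℕ, σ * ((σ * l) ^ (n + 2) + (σ * l) ^ n) - 2 * ξ * (σ * l) ^ (n + 1) = 0 := by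
    intro n
    have h' : l * l + 1 = 2 * ξ * l := by rw [← h]; field_simp
    have e : σ * ((σ * l) ^ (n + 2) + (σ * l) ^ n) - 2 * ξ * (σ * l) ^ (n + 1)
        = (σ * l) ^ n * σ * ((σ * σ) * (l * l) + 1 - 2 * ξ * l) := by ring
    rw [e, hσ, one_mul, h', sub_self, mul_zero]
  unfold latticeGreen
  rcases lt_trichotomy i 0 with hi | hi | hi
  · obtain ⟨n, rfl⟩ : ∃ n : ℕ, i = -(n + 1 : ℤ) := ⟨(-i - 1).toNat, by omega⟩
    rw [if_neg (by omega), show (-(n + 1 : ℤ) + 1).natAbs = n by omega,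
      show (-(n + 1 : ℤ) - 1).natAbs = n + 2 by omega, show (-(n + 1 : ℤ)).natAbs = n + 1 by omega]
    rw [← hpos n]
    ring
  · subst hi
    simp only [zero_add, zero_sub, Int.natAbs_neg, Int.natAbs_one, pow_one, Int.natAbs_zero,
      pow_zero, if_true]
    linear_combination 2 * l * hσ + h
  · obtain ⟨n, rfl⟩ : ∃ n : ℕ, i = (n + 1 : ℤ) := ⟨(i - 1).toNat, by omega⟩
    rw [if_neg (by omega), show ((n + 1 : ℤ) + 1).natAbs = n + 2 by omega,
      show ((n + 1 : ℤ) - 1).natAbs = n by omega, show ((n + 1 : ℤ)).natAbs = n + 1 by omega]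
    exact hpos n

theorem summable_latticeGreen {μ : ℂ} (hμ : ‖μ‖ < 1) (k : ℤ) :
    Summable fun i => ‖latticeGreen μ (i - k)‖ ^ 2 := by
  have h0 : Summable fun i : ℤ => ‖latticeGreen μ i‖ ^ 2 := by
    have hg : Summable fun n : ℕ => (‖μ‖ ^ 2) ^ n :=
      summable_geometric_of_lt_one (sq_nonneg _) (by nlinarith [norm_nonneg μ])
    refine Summable.of_nat_of_neg ?_ ?_
    · refine hg.congr fun n => ?_
      simp [latticeGreen, ← pow_mul, mul_comm]
    · refine hg.congr fun n => ?_
      simp [latticeGreen, ← pow_mul, mul_comm]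
  have := (hasSum_shift h0.hasSum (-k)).summable
  simpa [← sub_eq_add_neg] using this

theorem summable_norm_sq_add {V W : ℤ → ℂ} (hV : Summable fun j => ‖V j‖ ^ 2)
    (hW : Summable fun j => ‖W j‖ ^ 2) (x y : ℂ) :
    Summable fun j => ‖x * V j + y * W j‖ ^ 2 := by
  refine Summable.of_nonneg_of_le (fun _ => sq_nonneg _) (fun j => ?_)
    ((hV.mul_left (2 * ‖x‖ ^ 2)).add (hW.mul_left (2 * ‖y‖ ^ 2)))
  have h1 := norm_add_le (x * V j) (y * W j)
  rw [norm_mul, norm_mul] at h1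
  have h2 := pow_le_pow_left₀ (norm_nonneg _) h1 2
  nlinarith [sq_nonneg (‖x‖ * ‖V j‖ - ‖y‖ * ‖W j‖)]

section TwoImpurities

variable {A : ℤ} {α γ₁ γ₂ E l : ℝ} {n : ℕ} {j : ℤ}

theorem distantCoupling_left (α γ₁ γ₂ : ℝ) (n : ℕ) (j : ℤ) :
    distantCoupling α γ₁ γ₂ n j j = α + γ₁ := by simp [distantCoupling]

theorem distantCoupling_right (α γ₁ γ₂ : ℝ) (n : ℕ) (j : ℤ) :
    distantCoupling α γ₁ γ₂ n j (j + n + 1) = α + γ₂ := by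
  unfold distantCoupling
  rw [if_neg (by omega), if_pos rfl]

theorem distantCoupling_of_not_mem (α γ₁ γ₂ : ℝ) (n : ℕ) (j : ℤ) :
    ∀ i ∉ ({j, j + n + 1} : Finset ℤ), distantCoupling α γ₁ γ₂ n j i = α := by
  intro i hi
  simp only [Finset.mem_insert, Finset.mem_singleton, not_or] at hi
  unfold distantCoupling
  rw [if_neg hi.1, if_neg hi.2]

theorem IsRepresentative.difference_eq {a : ℤ → ℝ} {u : ChainL2} {U W : ChainEdge → ℝ → ℂ}
    (h : IsRepresentative A a u ((E : ℂ) • u) U W) (α : ℝ) (i : ℤ) :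
    holonomy A * (U (i + 1, true) 0 + U (i - 1, true) 0) - 2 * discriminant α E * U (i, true) 0
      = ((edgeSin E Real.pi / 2 * (a i - α) : ℝ) : ℂ) * U (i, true) 0 := by
  obtain ⟨K, hK, hb⟩ := exists_vertex_bound A E
  have := hb a u _ U W h i
  rw [sub_self] at this
  simp only [lp.coeFn_zero, Pi.zero_apply, norm_zero, add_zero, mul_zero] at this
  have h0 := norm_le_zero_iff.1 this
  rw [discriminant]
  push_cast
  linear_combination 1 / 2 * h0

/-- The eigenvalue equation of two impurities. -/
theorem nodal_eq_of_eigenvector (hl0 : l ≠ 0) (hl1 : |l| < 1) (hl : l + l⁻¹ = 2 * discriminant α E)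
    (hE : 1 < |discriminant α E|) {u : ChainL2} {U W : ChainEdge → ℝ → ℂ}
    (h : IsRepresentative A (distantCoupling α γ₁ γ₂ n j) u ((E : ℂ) • u) U W) (i : ℤ) :
    (l - (l : ℂ)⁻¹) * U (i, true) 0
      = ((edgeSin E Real.pi / 2 * γ₁ : ℝ) : ℂ) * U (j, true) 0
          * latticeGreen (holonomy A * l) (i - j)
        + ((edgeSin E Real.pi / 2 * γ₂ : ℝ) : ℂ) * U (j + n + 1, true) 0
          * latticeGreen (holonomy A * l) (i - (j + n + 1)) := by
  set σ := holonomy A with hσd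
  have hσ : σ * σ = 1 := holonomy_mul_self A
  have hσn : ‖σ‖ = 1 := norm_holonomy A
  set x := ((edgeSin E Real.pi / 2 * γ₁ : ℝ) : ℂ) * U (j, true) 0 with hx
  set y := ((edgeSin E Real.pi / 2 * γ₂ : ℝ) : ℂ) * U (j + n + 1, true) 0 with hy
  have hlc : (l : ℂ) + (l : ℂ)⁻¹ = 2 * (discriminant α E : ℂ) := by exact_mod_cast hl
  have hl0c : (l : ℂ) ≠ 0 := by exact_mod_cast hl0
  obtain ⟨X, hX⟩ := h.exists_nodal_sum
  have hμ : ‖σ * l‖ < 1 := by rwa [norm_mul, hσn, one_mul, Complex.norm_real]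
  set κ : ℂ := l - (l : ℂ)⁻¹ with hκ
  set G := latticeGreen (σ * l) with hG
  -- The difference of the two sides is square summable and solves the homogeneous equation. The
  -- padding `0 * 0` only brings it into the shape of `summable_norm_sq_add`.
  have key := eq_zero_of_difference_eq hσn hE
    (V := fun i => 1 * (κ * U (i, true) 0 + 0 * 0)
      + (-1) * (x * G (i - j) + y * G (i - (j + n + 1)))) (summable_norm_sq_add
      (summable_norm_sq_add hX.summable (W := fun _ => 0) (by simp) _ _)
      (summable_norm_sq_add (summable_latticeGreen hμ _) (summable_latticeGreen hμ _) _ _) _ _)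
    (fun i => ?_) i
  · simp only [one_mul, mul_zero, add_zero] at key
    linear_combination key
  · have d0 := h.difference_eq α i
    have d1 := latticeGreen_difference hσ hl0c hlc (i - j)
    have d2 := latticeGreen_difference hσ hl0c hlc (i - (j + n + 1))
    rw [show i - j + 1 = i + 1 - j by ring, show i - j - 1 = i - 1 - j by ring] at d1
    rw [show i - (j + n + 1) + 1 = i + 1 - (j + n + 1) by ring,
      show i - (j + n + 1) - 1 = i - 1 - (j + n + 1) by ring] at d2
    have hrhs : κ * (((edgeSin E Real.pi / 2 * (distantCoupling α γ₁ γ₂ n j i - α) : ℝ) : ℂ)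
        * U (i, true) 0) = x * (if i - j = 0 then κ else 0)
          + y * (if i - (j + n + 1) = 0 then κ else 0) := by
      by_cases h1 : i = j
      · subst h1
        rw [distantCoupling_left, if_pos (by ring), if_neg (by omega), hx]
        push_cast
        ring
      · by_cases h2 : i = j + n + 1
        · subst h2
          rw [distantCoupling_right, if_neg (by omega), if_pos (by ring), hy]
          push_cast
          ring
        · rw [distantCoupling_of_not_mem _ _ _ _ _ _ (by simp [h1, h2]), if_neg (by omega),
            if_neg (by omega)]
          simp
    linear_combination κ * d0 - x * d1 - y * d2 + hrhs

theorem eq_zero_of_nodal_eq_zero {a : ℤ → ℝ} (hs : edgeSin E Real.pi ≠ 0) {u : ChainL2}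
    {U W : ChainEdge → ℝ → ℂ} (h : IsRepresentative A a u ((E : ℂ) • u) U W)
    (h0 : ∀ i : ℤ, U (i, true) 0 = 0) : u = 0 := by
  obtain ⟨K, hK, hb⟩ := exists_edge_norm_bound A hs
  ext e : 2
  have := hb a u _ U W h e
  rw [sub_self, h0, h0] at this
  simp only [lp.coeFn_zero, Pi.zero_apply, norm_zero, add_zero, mul_zero] at this
  simpa using this

theorem inv_ne_self_of_abs_lt_one (hl0 : l ≠ 0) (hl1 : |l| < 1) : (l : ℂ) - (l : ℂ)⁻¹ ≠ 0 := by
  have : l - l⁻¹ ≠ 0 := by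
    intro h
    have h2 : l * l = 1 := by
      field_simp at h
      nlinarith
    have := abs_mul_abs_self l
    nlinarith [abs_nonneg l]
  exact_mod_cast this

/-- With a vanishing value at `j`, the representation evaluated at `j` contains only the
contribution of the other impurity, whose coefficient must vanish as well. Then all vertex values
are zero. -/
theorem left_ne_zero_of_eigenvector (hl0 : l ≠ 0) (hl1 : |l| < 1)
    (hl : l + l⁻¹ = 2 * discriminant α E) (hE : 1 < |discriminant α E|) (h2 : γ₂ ≠ 0)
    {u : ChainL2} {U W : ChainEdge → ℝ → ℂ}
    (h : IsRepresentative A (distantCoupling α γ₁ γ₂ n j) u ((E : ℂ) • u) U W)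
    (hx : U (j, true) 0 = 0) : u = 0 := by
  have hs := edgeSin_pi_ne_zero_of_gap hE
  have hσ := holonomy_mul_self A
  have hσ0 : holonomy A ≠ 0 := fun h0 => by rw [h0, mul_zero] at hσ; exact zero_ne_one hσ
  have hκ := inv_ne_self_of_abs_lt_one hl0 hl1
  have hn := fun i => nodal_eq_of_eigenvector hl0 hl1 hl hE h i
  have hy : U (j + n + 1, true) 0 = 0 := by
    have := hn j
    rw [hx] at this
    have hG : latticeGreen (holonomy A * l) (j - (j + n + 1)) ≠ 0 :=
      pow_ne_zero _ (mul_ne_zero hσ0 (by exact_mod_cast hl0))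
    have hg : ((edgeSin E Real.pi / 2 * γ₂ : ℝ) : ℂ) ≠ 0 := by
      exact_mod_cast mul_ne_zero (div_ne_zero hs two_ne_zero) h2
    simpa [hG, hg, hs, h2] using this
  refine eq_zero_of_nodal_eq_zero hs h fun i => ?_
  have := hn i
  rw [hx, hy] at this
  simpa [hκ] using this

theorem holonomy_pow_mul_self (A : ℤ) (N : ℕ) (l : ℂ) :
    (holonomy A * l) ^ N * (holonomy A * l) ^ N = l ^ (2 * N) := by
  rw [← mul_pow, mul_mul_mul_comm, holonomy_mul_self, one_mul, ← pow_two, ← pow_mul]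

/-- Evaluating `nodal_eq_of_eigenvector` at the two impurities gives a homogeneous `2 × 2` system
with off-diagonal factor `(σ l)^(n+1)`. Only the square of this factor enters the determinant, so
the sign `σ` disappears. -/
theorem graphEigenspace_ne_bot_iff (hl0 : l ≠ 0) (hl1 : |l| < 1)
    (hl : l + l⁻¹ = 2 * discriminant α E) (hE : 1 < |discriminant α E|) (h2 : γ₂ ≠ 0) :
    graphEigenspace (distantHamiltonian A α γ₁ γ₂ n j) E ≠ ⊥ ↔
      (l - l⁻¹ - edgeSin E Real.pi / 2 * γ₁) * (l - l⁻¹ - edgeSin E Real.pi / 2 * γ₂)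
        = edgeSin E Real.pi / 2 * γ₁ * (edgeSin E Real.pi / 2 * γ₂) * l ^ (2 * (n + 1)) := by
  have hs := edgeSin_pi_ne_zero_of_gap hE
  have hκ := inv_ne_self_of_abs_lt_one hl0 hl1
  have hnat1 : ((j + n + 1 : ℤ) - j).natAbs = n + 1 := by omega
  have hnat2 : (j - (j + n + 1 : ℤ)).natAbs = n + 1 := by omega
  have hpow := holonomy_pow_mul_self A (n + 1) (l : ℂ)
  have hσ := holonomy_mul_self A
  have hσ0 : holonomy A ≠ 0 := fun h0 => by rw [h0, mul_zero] at hσ; exact zero_ne_one hσ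
  constructor
  · intro hne
    obtain ⟨u, hu, hu0⟩ := Submodule.exists_mem_ne_zero_of_ne_bot hne
    obtain ⟨U, W, h⟩ := isLaplacianPair_iff.1 hu
    have hx : U (j, true) 0 ≠ 0 := fun hx =>
      hu0 (left_ne_zero_of_eigenvector hl0 hl1 hl hE h2 h hx)
    have e1 := nodal_eq_of_eigenvector hl0 hl1 hl hE h j
    have e2 := nodal_eq_of_eigenvector hl0 hl1 hl hE h (j + n + 1)
    rw [sub_self, latticeGreen_zero, latticeGreen, hnat2] at e1
    rw [sub_self, latticeGreen_zero, latticeGreen, hnat1] at e2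
    set M := (holonomy A * (l : ℂ)) ^ (n + 1)
    set x := U (j, true) 0
    set y := U (j + n + 1, true) 0
    have : (((l : ℂ) - (l : ℂ)⁻¹ - edgeSin E Real.pi / 2 * γ₁)
        * ((l : ℂ) - (l : ℂ)⁻¹ - edgeSin E Real.pi / 2 * γ₂)
        - edgeSin E Real.pi / 2 * γ₁ * (edgeSin E Real.pi / 2 * γ₂) * (l : ℂ) ^ (2 * (n + 1))) * x = 0 := by
      rw [← hpow]
      push_cast at e1 e2
      linear_combination (↑l - (↑l)⁻¹ - edgeSin E Real.pi / 2 * γ₂) * e1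
        + (edgeSin E Real.pi / 2 * γ₂) * M * e2
    have := (mul_eq_zero.1 this).resolve_right hx
    exact_mod_cast sub_eq_zero.1 this
  · intro hdet
    have hdetc : ((l : ℂ) - (l : ℂ)⁻¹ - edgeSin E Real.pi / 2 * γ₁)
        * ((l : ℂ) - (l : ℂ)⁻¹ - edgeSin E Real.pi / 2 * γ₂)
        = edgeSin E Real.pi / 2 * γ₁ * (edgeSin E Real.pi / 2 * γ₂) * (l : ℂ) ^ (2 * (n + 1)) := by
      exact_mod_cast hdet
    set σ := holonomy A with hσd
    set M := (σ * (l : ℂ)) ^ (n + 1) with hM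
    set κ : ℂ := (l : ℂ) - (l : ℂ)⁻¹ with hκd
    set g₁ : ℂ := (edgeSin E Real.pi : ℂ) / 2 * γ₁ with hg₁
    set g₂ : ℂ := (edgeSin E Real.pi : ℂ) / 2 * γ₂ with hg₂
    have hg20 : g₂ ≠ 0 := mul_ne_zero (div_ne_zero (by exact_mod_cast hs) two_ne_zero)
      (by exact_mod_cast h2)
    have hl0c : (l : ℂ) ≠ 0 := by exact_mod_cast hl0
    have hlc : (l : ℂ) + (l : ℂ)⁻¹ = 2 * (discriminant α E : ℂ) := by exact_mod_cast hl
    have hM0 : M ≠ 0 := pow_ne_zero _ (mul_ne_zero hσ0 hl0c)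
    -- Normalizing the value at `j` to `1`, the first row of the system gives the value `y` at the
    -- other impurity. The second row is then the determinant condition.
    set y := (κ - g₁) / (g₂ * M) with hy
    have hy' : g₂ * y * M = κ - g₁ := by rw [hy]; field_simp
    have hy2 : κ * y = g₁ * M + g₂ * y := by
      have : (g₂ * M) * (κ * y - (g₁ * M + g₂ * y)) = 0 := by
        rw [← hpow] at hdetc
        linear_combination (κ - g₂) * hy' + hdetc
      linear_combination (mul_eq_zero.1 this).resolve_left (mul_ne_zero hg20 hM0)
    set G := latticeGreen (σ * l) with hG
    set V : ℤ → ℂ := fun i => g₁ / κ * G (i - j) + g₂ * y / κ * G (i - (j + n + 1)) with hV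
    have hμ : ‖σ * l‖ < 1 := by rwa [norm_mul, norm_holonomy, one_mul, Complex.norm_real]
    have hVs : Summable fun i => ‖V i‖ ^ 2 :=
      summable_norm_sq_add (summable_latticeGreen hμ _) (summable_latticeGreen hμ _) _ _
    have hVj : V j = 1 := by
      simp only [hV, sub_self]
      rw [hG, latticeGreen_zero, latticeGreen, hnat2, ← hM]
      field_simp
      linear_combination hy'
    have hVj' : V (j + n + 1) = y := by
      simp only [hV, sub_self]
      rw [hG, latticeGreen_zero, latticeGreen, hnat1, ← hM]
      field_simp
      linear_combination -hy2
    obtain ⟨K, hK, hb⟩ := exists_domain_element_of_nodal A hs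
    obtain ⟨u, f, U, W, hrep, hU, -, hn⟩ := hb (distantCoupling α γ₁ γ₂ n j) V hVs 0
      (fun i => by
        have d1 := latticeGreen_difference hσ hl0c hlc (i - j)
        have d2 := latticeGreen_difference hσ hl0c hlc (i - (j + n + 1))
        rw [show i - j + 1 = i + 1 - j by ring, show i - j - 1 = i - 1 - j by ring] at d1
        rw [show i - (j + n + 1) + 1 = i + 1 - (j + n + 1) by ring,
          show i - (j + n + 1) - 1 = i - 1 - (j + n + 1) by ring] at d2
        have hrhs : edgeSin E Real.pi / 2 * (distantCoupling α γ₁ γ₂ n j i - α) * V i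
            = g₁ / κ * (if i - j = 0 then κ else 0)
              + g₂ * y / κ * (if i - (j + n + 1) = 0 then κ else 0) := by
          by_cases k1 : i = j
          · subst k1
            rw [distantCoupling_left, if_pos (by ring), if_neg (by omega), hVj, hg₁]
            push_cast
            field_simp
            ring
          · by_cases k2 : i = j + n + 1
            · subst k2
              rw [distantCoupling_right, if_neg (by omega), if_pos (by ring), hVj', hg₂]
              push_cast
              field_simp
              ring
            · rw [distantCoupling_of_not_mem _ _ _ _ _ _ (by simp [k1, k2]), if_neg (by omega),
                if_neg (by omega)]
              simp
        have hdisc : (4 * edgeCos E Real.pi + edgeSin E Real.pi * distantCoupling α γ₁ γ₂ n j i : ℂ)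
            = 4 * discriminant α E + 2 * (edgeSin E Real.pi / 2
              * (distantCoupling α γ₁ γ₂ n j i - α)) := by
          rw [discriminant]
          push_cast
          ring
        rw [hdisc]
        simp only [Pi.zero_apply]
        have hVi : V i = g₁ / κ * G (i - j) + g₂ * y / κ * G (i - (j + n + 1)) := rfl
        have hVp : V (i + 1) = g₁ / κ * G (i + 1 - j) + g₂ * y / κ * G (i + 1 - (j + n + 1)) := rfl
        have hVm : V (i - 1) = g₁ / κ * G (i - 1 - j) + g₂ * y / κ * G (i - 1 - (j + n + 1)) := rfl
        rw [← hκd, ← hG] at d1 d2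
        rw [hVp, hVm]
        linear_combination 2 * (g₁ / κ) * d1 + 2 * (g₂ * y / κ) * d2 - 2 * hrhs
          - 4 * (discriminant α E : ℂ) * hVi) (by simp)
    have hfu : f = (E : ℂ) • u := by
      have hn' : ‖f - (E : ℂ) • u‖ ^ 2 ≤ 0 := hn.trans_eq (by simp)
      exact sub_eq_zero.1 (norm_eq_zero.1
        (pow_eq_zero_iff two_ne_zero |>.1 (le_antisymm hn' (sq_nonneg _))))
    subst hfu
    intro hbot
    have hu0 : u = 0 := by
      rw [← Submodule.mem_bot ℂ, ← hbot]
      exact ⟨U, W, hrep⟩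
    obtain ⟨K', hK', hb'⟩ := exists_nodal_bound A
    have := hb' _ _ _ _ _ hrep (j, true)
    rw [hU, hu0] at this
    simp [hVj] at this
    linarith

/-- The vertex value at `j` is a linear functional that is injective on the eigenspace. -/
theorem finrank_graphEigenspace (hl0 : l ≠ 0) (hl1 : |l| < 1)
    (hl : l + l⁻¹ = 2 * discriminant α E) (hE : 1 < |discriminant α E|) (h2 : γ₂ ≠ 0)
    (hne : graphEigenspace (distantHamiltonian A α γ₁ γ₂ n j) E ≠ ⊥) :
    Module.finrank ℂ (graphEigenspace (distantHamiltonian A α γ₁ γ₂ n j) E) = 1 := by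
  obtain ⟨u₀, hu₀, hu₀0⟩ := Submodule.exists_mem_ne_zero_of_ne_bot hne
  obtain ⟨g₁, g₂, hg⟩ := exists_nodal_functional A (j, true)
  have inj : ∀ u ∈ graphEigenspace (distantHamiltonian A α γ₁ γ₂ n j) E,
      inner ℂ g₁ u + inner ℂ g₂ ((E : ℂ) • u) = 0 → u = 0 := by
    intro u hu h0
    obtain ⟨U, W, h⟩ := isLaplacianPair_iff.1 hu
    refine left_ne_zero_of_eigenvector hl0 hl1 hl hE h2 h ?_
    exact (hg _ _ _ _ _ h).trans h0
  set φ : ChainL2 → ℂ := fun u => inner ℂ g₁ u + inner ℂ g₂ ((E : ℂ) • u) with hφ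
  have hφ0 : φ u₀ ≠ 0 := fun h => hu₀0 (inj u₀ hu₀ h)
  rw [finrank_eq_one_iff_of_nonzero' (⟨u₀, hu₀⟩ : graphEigenspace _ E)
    (fun h => hu₀0 (congrArg Subtype.val h))]
  rintro ⟨u, hu⟩
  refine ⟨φ u / φ u₀, Subtype.ext ?_⟩
  have hmem := Submodule.sub_mem _ (Submodule.smul_mem _ (φ u / φ u₀) hu₀) hu
  have := inj _ hmem (by
    have e : φ ((φ u / φ u₀) • u₀ - u) = φ u / φ u₀ * φ u₀ - φ u := by
      simp only [hφ, inner_sub_right, inner_smul_right]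
      ring
    change φ ((φ u / φ u₀) • u₀ - u) = 0
    rw [e]
    field_simp
    ring)
  exact sub_eq_zero.1 this

theorem graphEigenspace_eq_bot_of_no_impurity (hl0 : l ≠ 0) (hl1 : |l| < 1)
    (hl : l + l⁻¹ = 2 * discriminant α E) (hE : 1 < |discriminant α E|) :
    graphEigenspace (distantHamiltonian A α 0 0 n j) E = ⊥ := by
  rw [Submodule.eq_bot_iff]
  intro u hu
  obtain ⟨U, W, h⟩ := isLaplacianPair_iff.1 hu
  refine eq_zero_of_nodal_eq_zero (edgeSin_pi_ne_zero_of_gap hE) h fun i => ?_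
  have := nodal_eq_of_eigenvector hl0 hl1 hl hE h i
  simpa [inv_ne_self_of_abs_lt_one hl0 hl1] using this

end TwoImpurities

/-! ### Monotonicity of the secular branches -/

/-- In the induction step the slack is `(1 - x)(1 - x^(N+1))(1 - x^(N+2)) ≥ 0`. -/
theorem mul_pow_pred_mul_le {x : ℝ} (h0 : 0 ≤ x) (h1 : x ≤ 1) (N : ℕ) :
    (N + 1) * x ^ N * (1 - x ^ 2) ≤ 1 - (x ^ (N + 1)) ^ 2 := by
  induction N with
  | zero => simp
  | succ N ih =>
    have e1 : x ^ (N + 1) ≤ 1 := pow_le_one₀ h0 h1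
    have e2 : x ^ (N + 2) ≤ 1 := pow_le_one₀ h0 h1
    have e3 := mul_nonneg (mul_nonneg (sub_nonneg.2 h1) (sub_nonneg.2 e1)) (sub_nonneg.2 e2)
    have e4 := mul_le_mul_of_nonneg_left ih h0
    push_cast
    have e5 : (1 - x) * (1 - x ^ (N + 1)) * (1 - x ^ (N + 2))
        = 1 - (x ^ (N + 1 + 1)) ^ 2 - x * (1 - (x ^ (N + 1)) ^ 2) - x ^ (N + 1) * (1 - x ^ 2) := by
      ring
    have e6 : (N + 1 + 1 : ℝ) * x ^ (N + 1) * (1 - x ^ 2)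
        = x * ((N + 1) * x ^ N * (1 - x ^ 2)) + x ^ (N + 1) * (1 - x ^ 2) := by ring
    rw [e6]
    linarith

/-- The numerator of the derivative is `s (N+1) x^N (1 - x²) + 2 (1 + s x^(N+1))`. With `y =
|x|^(N+1)`, the first term is at most `1 - y²` in modulus by `mul_pow_pred_mul_le` and the second is
at least `2 (1 - y)`, which is strictly larger. -/
theorem strictMonoOn_resolvent_branch {s : ℝ} (hs : |s| = 1) (N : ℕ) :
    StrictMonoOn (fun x : ℝ => (1 + s * x ^ (N + 1)) * (1 + x) / (1 - x)) (Ioo (-1) 1) := by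
  have hd : ∀ x ∈ Ioo (-1 : ℝ) 1, HasDerivAt (fun x : ℝ => (1 + s * x ^ (N + 1)) * (1 + x) / (1 - x))
      ((s * ((N + 1) * x ^ N * (1 - x ^ 2)) + 2 * (1 + s * x ^ (N + 1))) / (1 - x) ^ 2) x := by
    intro x hx
    have h1 : 1 - x ≠ 0 := by linarith [hx.2]
    have := (((((hasDerivAt_pow (N + 1) x).const_mul s).const_add 1).mul
      ((hasDerivAt_id x).const_add 1)).div ((hasDerivAt_id x).const_sub 1) h1)
    refine this.congr_deriv ?_
    simp only [id, Pi.mul_apply, Nat.add_sub_cancel]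
    push_cast
    ring
  refine strictMonoOn_of_deriv_pos (convex_Ioo _ _)
    (fun x hx => (hd x hx).continuousAt.continuousWithinAt) fun x hx => ?_
  rw [interior_Ioo] at hx
  rw [(hd x hx).deriv]
  have hx1 : |x| < 1 := abs_lt.2 hx
  have h1 : 0 < 1 - x := by linarith [hx.2]
  refine div_pos ?_ (by positivity)
  have k1 := mul_pow_pred_mul_le (abs_nonneg x) hx1.le N
  have hN : |x| ^ (N + 1) < 1 := pow_lt_one₀ (abs_nonneg x) hx1 (by omega)
  have hN0 : 0 ≤ |x| ^ (N + 1) := by positivity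
  have k2 : |s * ((N + 1) * x ^ N * (1 - x ^ 2))| ≤ 1 - (|x| ^ (N + 1)) ^ 2 := by
    rw [abs_mul, hs, one_mul, abs_mul, abs_mul, abs_pow,
      abs_of_nonneg (by nlinarith [sq_abs x, abs_nonneg x] : 0 ≤ 1 - x ^ 2),
      abs_of_nonneg (by positivity : (0 : ℝ) ≤ N + 1), ← sq_abs x]
    exact k1
  have k3 : |s * x ^ (N + 1)| = |x| ^ (N + 1) := by rw [abs_mul, hs, one_mul, abs_pow]
  have k4 := (abs_le.1 k2).1
  have k5 := neg_abs_le (s * x ^ (N + 1))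
  rw [k3] at k5
  nlinarith

/-- The reflection amplitude in terms of the two half-edge parameters. -/
noncomputable def decayRate (a b : ℝ) : ℝ := (b - a) / (b + a)

theorem abs_decayRate_lt_one {a b : ℝ} (ha : 0 < a) (hb : 0 < b) : |decayRate a b| < 1 := by
  rw [decayRate, abs_div, abs_of_pos (add_pos hb ha), div_lt_one (add_pos hb ha), abs_lt]
  constructor <;> linarith

theorem decayRate_swap (a b : ℝ) : decayRate b a = -decayRate a b := by
  rw [decayRate, decayRate, ← neg_div, neg_sub, add_comm]

/-- For `x = decayRate a b` one has `(1 + x)/(1 - x) = b / a`. Hence for fixed `b` the quantity is,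
up to the factor `b⁻²`, the function of `strictMonoOn_resolvent_branch`, while `x` decreases in `a`.
-/
theorem resolvent_branch_lt_of_lt_left {s : ℝ} (hs : |s| = 1) (N : ℕ) {a a' b : ℝ} (ha : 0 < a)
    (haa : a < a') (hb : 0 < b) :
    (1 + s * decayRate a' b ^ (N + 1)) / (a' * b) < (1 + s * decayRate a b ^ (N + 1)) / (a * b) := by
  have ha' : 0 < a' := ha.trans haa
  have key : ∀ c, 0 < c → (1 + s * decayRate c b ^ (N + 1)) / (c * b)
      = (1 + s * decayRate c b ^ (N + 1)) * (1 + decayRate c b) / (1 - decayRate c b) / b ^ 2 := by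
    intro c hc
    have h1 : (1 + decayRate c b) = 2 * b / (b + c) := by unfold decayRate; field_simp; ring
    have h2 : (1 - decayRate c b) = 2 * c / (b + c) := by unfold decayRate; field_simp; ring
    rw [mul_div_assoc, h1, h2]
    field_simp
  rw [key a ha, key a' ha']
  refine div_lt_div_of_pos_right ?_ (by positivity)
  refine strictMonoOn_resolvent_branch hs N (abs_lt.1 (abs_decayRate_lt_one ha' hb))
    (abs_lt.1 (abs_decayRate_lt_one ha hb)) ?_
  unfold decayRate
  rw [div_lt_div_iff₀ (by positivity) (by positivity)]
  nlinarith

/-- Increase one parameter after the other. Exchanging `a` and `b` changes the sign of the decay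
rate, and the resulting `(-1)^(N+1)` is absorbed into `s`. -/
theorem resolvent_branch_lt {s : ℝ} (hs : |s| = 1) (N : ℕ) {a a' b b' : ℝ} (ha : 0 < a)
    (haa : a < a') (hb : 0 < b) (hbb : b < b') :
    (1 + s * decayRate a' b' ^ (N + 1)) / (a' * b')
      < (1 + s * decayRate a b ^ (N + 1)) / (a * b) := by
  refine lt_trans ?_ (resolvent_branch_lt_of_lt_left hs N ha haa hb)
  have hs' : |s * (-1) ^ (N + 1)| = 1 := by simp [abs_mul, hs]
  have := resolvent_branch_lt_of_lt_left hs' N hb hbb (ha.trans haa)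
  rw [decayRate_swap, decayRate_swap a', mul_comm b', mul_comm b, mul_assoc, mul_assoc, ← mul_pow,
    ← mul_pow] at this
  simpa using this

theorem abs_sqrt_add_sq_sub_le (D x y : ℝ) : |√(D ^ 2 + x ^ 2) - √(D ^ 2 + y ^ 2)| ≤ |x - y| := by
  have key : ∀ x y : ℝ, √(D ^ 2 + x ^ 2) - √(D ^ 2 + y ^ 2) ≤ |x - y| := by
    intro x y
    rw [sub_le_iff_le_add]
    refine Real.sqrt_le_iff.2 ⟨by positivity, ?_⟩
    have h1 : |y| ≤ √(D ^ 2 + y ^ 2) := Real.abs_le_sqrt (by nlinarith [sq_nonneg D])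
    have h2 := Real.sq_sqrt (by positivity : 0 ≤ D ^ 2 + y ^ 2)
    have h3 : (x - y) * y ≤ |x - y| * √(D ^ 2 + y ^ 2) :=
      (le_abs_self _).trans (by rw [abs_mul]; gcongr)
    have h4 := sq_abs (x - y)
    nlinarith
  rw [abs_le]
  constructor
  · have := key y x
    rw [abs_sub_comm] at this
    linarith
  · exact key x y

/-- The two branches of the secular equation of two impurities, solved for the mean coupling. -/
noncomputable def secularBranch (s D : ℝ) (N : ℕ) (a b : ℝ) : ℝ :=
  1 / (4 * (a * b)) - s * √(D ^ 2 + (decayRate a b ^ (N + 1) / (4 * (a * b))) ^ 2)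

/-- The two signs of `resolvent_branch_lt` say that `q / τ` varies strictly less than `1 / τ`, where
`τ = 4ab` and `q` is the power of the decay rate. As `x ↦ √(D² + x²)` is a contraction, the root
cannot compensate the decrease of `1 / τ`. -/
theorem secularBranch_lt {s : ℝ} (hs : |s| = 1) (D : ℝ) (N : ℕ) {a a' b b' : ℝ} (ha : 0 < a)
    (haa : a < a') (hb : 0 < b) (hbb : b < b') :
    secularBranch s D N a' b' < secularBranch s D N a b := by
  have h1 := resolvent_branch_lt (s := 1) (by simp) N ha haa hb hbb
  have h2 := resolvent_branch_lt (s := -1) (by simp) N ha haa hb hbb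
  have e : ∀ s x c : ℝ, (1 + s * x) / c = 4 * (1 / (4 * c)) + 4 * s * (x / (4 * c)) := by
    intro s x c
    rw [add_div, mul_div_assoc]
    ring
  rw [e, e] at h1 h2
  unfold secularBranch
  have h3 := abs_sqrt_add_sq_sub_le D (decayRate a' b' ^ (N + 1) / (4 * (a' * b')))
    (decayRate a b ^ (N + 1) / (4 * (a * b)))
  have h4 : |decayRate a' b' ^ (N + 1) / (4 * (a' * b')) - decayRate a b ^ (N + 1) / (4 * (a * b))|
      < 1 / (4 * (a * b)) - 1 / (4 * (a' * b')) := by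
    rw [abs_lt]
    constructor <;> linarith
  have h5 : s * (√(D ^ 2 + (decayRate a b ^ (N + 1) / (4 * (a * b))) ^ 2)
      - √(D ^ 2 + (decayRate a' b' ^ (N + 1) / (4 * (a' * b'))) ^ 2))
      ≤ |√(D ^ 2 + (decayRate a' b' ^ (N + 1) / (4 * (a' * b'))) ^ 2)
        - √(D ^ 2 + (decayRate a b ^ (N + 1) / (4 * (a * b))) ^ 2)| := by
    refine (le_abs_self _).trans_eq ?_
    rw [abs_mul, hs, one_mul, abs_sub_comm]
  linarith

/-- Division by `β₁ β₂ τ²` turns the equation into `(1/β₁ - 1/τ)(1/β₂ - 1/τ) = (q/τ)²`. In terms of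
the half sum `M` and the half difference `D` of the `1/βᵢ` this is `(1/τ - M)² = D² + (q/τ)²`. -/
theorem secular_iff {β₁ β₂ : ℝ} (h1 : β₁ ≠ 0) (h2 : β₂ ≠ 0) (N : ℕ) {a b : ℝ} (ha : 0 < a)
    (hb : 0 < b) :
    (4 * (a * b) - β₁) * (4 * (a * b) - β₂) = β₁ * β₂ * decayRate a b ^ (2 * (N + 1)) ↔
      secularBranch 1 ((1 / β₁ - 1 / β₂) / 2) N a b = (1 / β₁ + 1 / β₂) / 2 ∨
      secularBranch (-1) ((1 / β₁ - 1 / β₂) / 2) N a b = (1 / β₁ + 1 / β₂) / 2 := by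
  set D := (1 / β₁ - 1 / β₂) / 2 with hD
  set M := (1 / β₁ + 1 / β₂) / 2 with hM
  set τ := 4 * (a * b) with hτ
  have hτ0 : τ ≠ 0 := by positivity
  set q := decayRate a b ^ (N + 1) with hq
  have hsq := Real.sq_sqrt (by positivity : 0 ≤ D ^ 2 + (q / τ) ^ 2)
  have hiff : (τ - β₁) * (τ - β₂) = β₁ * β₂ * decayRate a b ^ (2 * (N + 1)) ↔
      (1 / τ - M) ^ 2 = √(D ^ 2 + (q / τ) ^ 2) ^ 2 := by
    rw [hsq, mul_comm 2, pow_mul, ← hq, hM, hD]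
    field_simp
    constructor
    · intro h
      linear_combination 4 * β₁ * β₂ * h
    · intro h
      refine mul_left_cancel₀ (mul_ne_zero h1 h2) ?_
      linear_combination 1 / 4 * h
  rw [hiff, sq_eq_sq_iff_eq_or_eq_neg]
  unfold secularBranch
  rw [← hq, ← hτ]
  constructor
  · rintro (h | h)
    · left; linarith
    · right; linarith
  · rintro (h | h)
    · left; linarith
    · right; linarith

theorem secularBranch_neg_one_gt (D : ℝ) (N : ℕ) {a b : ℝ} (ha : 0 < a) (hb : 0 < b) :
    |D| < secularBranch (-1) D N a b := by
  unfold secularBranch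
  have h1 : |D| ≤ √(D ^ 2 + (decayRate a b ^ (N + 1) / (4 * (a * b))) ^ 2) :=
    Real.abs_le_sqrt (by nlinarith [sq_nonneg (decayRate a b ^ (N + 1) / (4 * (a * b)))])
  have h2 : 0 < 1 / (4 * (a * b)) := by positivity
  linarith

theorem secularBranch_one_le (D : ℝ) (N : ℕ) (a b : ℝ) :
    secularBranch 1 D N a b ≤ 1 / (4 * (a * b)) - |D| := by
  unfold secularBranch
  have h1 : |D| ≤ √(D ^ 2 + (decayRate a b ^ (N + 1) / (4 * (a * b))) ^ 2) :=
    Real.abs_le_sqrt (by nlinarith [sq_nonneg (decayRate a b ^ (N + 1) / (4 * (a * b)))])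
  linarith

theorem sqrt_secular_le (D : ℝ) (N : ℕ) (a b : ℝ) :
    √(D ^ 2 + (decayRate a b ^ (N + 1) / (4 * (a * b))) ^ 2)
      ≤ |D| + |decayRate a b| ^ (N + 1) / |4 * (a * b)| := by
  have := abs_sqrt_add_sq_sub_le D (decayRate a b ^ (N + 1) / (4 * (a * b))) 0
  rw [zero_pow two_ne_zero, add_zero, Real.sqrt_sq_eq_abs, sub_zero, abs_div, abs_pow] at this
  linarith [le_abs_self (√(D ^ 2 + (decayRate a b ^ (N + 1) / (4 * (a * b))) ^ 2) - |D|)]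

theorem secularBranch_neg_one_le (D : ℝ) (N : ℕ) {a b : ℝ} (ha : 0 < a) (hb : 0 < b) :
    secularBranch (-1) D N a b ≤ 2 * (1 / (4 * (a * b))) + |D| := by
  have h := sqrt_secular_le D N a b
  have h2 : |decayRate a b| ^ (N + 1) / |4 * (a * b)| ≤ 1 / (4 * (a * b)) := by
    rw [abs_of_pos (by positivity : 0 < 4 * (a * b))]
    exact div_le_div_of_nonneg_right (pow_le_one₀ (abs_nonneg _) (abs_decayRate_lt_one ha hb).le)
      (by positivity)
  unfold secularBranch
  linarith

theorem secularBranch_one_le_neg_one (D : ℝ) (N : ℕ) (a b : ℝ) :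
    secularBranch 1 D N a b ≤ secularBranch (-1) D N a b := by
  unfold secularBranch
  linarith [Real.sqrt_nonneg (D ^ 2 + (decayRate a b ^ (N + 1) / (4 * (a * b))) ^ 2)]

theorem secularBranch_one_lt_neg_one (D : ℝ) (N : ℕ) {a b : ℝ} (ha : 0 < a) (hb : 0 < b)
    (hab : a ≠ b) : secularBranch 1 D N a b < secularBranch (-1) D N a b := by
  have hr : decayRate a b ≠ 0 := div_ne_zero (sub_ne_zero.2 hab.symm) (by positivity)
  have : 0 < √(D ^ 2 + (decayRate a b ^ (N + 1) / (4 * (a * b))) ^ 2) := Real.sqrt_pos.2 (by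
    have : decayRate a b ^ (N + 1) / (4 * (a * b)) ≠ 0 :=
      div_ne_zero (pow_ne_zero _ hr) (by positivity)
    positivity)
  unfold secularBranch
  linarith

/-! ### Counting and locating the roots in a gap -/

/-- The half-edge parameters on a spectral gap: they increase or decrease together, and their
product sweeps out the whole half-line. -/
structure IsGapParametrization (I : Set ℝ) (a b : ℝ → ℝ) : Prop where
  preconnected : IsPreconnected I
  cont_left : ContinuousOn a I
  cont_right : ContinuousOn b I
  pos_left : ∀ E ∈ I, 0 < a E
  pos_right : ∀ E ∈ I, 0 < b E
  ne : ∀ E ∈ I, a E ≠ b E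
  monotone : (StrictMonoOn a I ∧ StrictMonoOn b I) ∨ (StrictAntiOn a I ∧ StrictAntiOn b I)
  small : ∀ ε > 0, ∃ E ∈ I, a E * b E < ε
  large : ∀ R : ℝ, ∃ E ∈ I, R < a E * b E
  slope : ∀ E₁ ∈ I, ∀ E₂ ∈ I, ∃ k > 0, ∀ E ∈ uIcc E₁ E₂, ∀ F ∈ uIcc E₁ E₂,
    k * |E - F| ≤ |(a E * b E) ^ 2 - (a F * b F) ^ 2|

/-- The solutions of the secular equation of two impurities. -/
def secularSet (I : Set ℝ) (a b : ℝ → ℝ) (β₁ β₂ : ℝ) (N : ℕ) : Set ℝ :=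
  {E | E ∈ I ∧ (4 * (a E * b E) - β₁) * (4 * (a E * b E) - β₂)
    = β₁ * β₂ * decayRate (a E) (b E) ^ (2 * (N + 1))}

namespace IsGapParametrization

variable {I : Set ℝ} {a b : ℝ → ℝ}

theorem comparable (h : IsGapParametrization I a b) {E F : ℝ} (hE : E ∈ I) (hF : F ∈ I)
    (hne : E ≠ F) : (a E < a F ∧ b E < b F) ∨ (a F < a E ∧ b F < b E) := by
  rcases h.monotone with ⟨m1, m2⟩ | ⟨m1, m2⟩ <;> rcases lt_or_gt_of_ne hne with hlt | hlt
  · exact Or.inl ⟨m1 hE hF hlt, m2 hE hF hlt⟩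
  · exact Or.inr ⟨m1 hF hE hlt, m2 hF hE hlt⟩
  · exact Or.inr ⟨m1 hE hF hlt, m2 hE hF hlt⟩
  · exact Or.inl ⟨m1 hF hE hlt, m2 hF hE hlt⟩

theorem ordConnected (h : IsGapParametrization I a b) : OrdConnected I :=
  isPreconnected_iff_ordConnected.1 h.preconnected

theorem injOn_branch (h : IsGapParametrization I a b) {s : ℝ} (hs : |s| = 1) (D : ℝ) (N : ℕ) :
    InjOn (fun E => secularBranch s D N (a E) (b E)) I := by
  intro E hE F hF heq
  by_contra hne
  rcases h.comparable hE hF hne with ⟨h1, h2⟩ | ⟨h1, h2⟩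
  · exact (secularBranch_lt hs D N (h.pos_left E hE) h1 (h.pos_right E hE) h2).ne heq.symm
  · exact (secularBranch_lt hs D N (h.pos_left F hF) h1 (h.pos_right F hF) h2).ne heq

theorem continuousOn_branch (h : IsGapParametrization I a b) (s D : ℝ) (N : ℕ) :
    ContinuousOn (fun E => secularBranch s D N (a E) (b E)) I := by
  unfold secularBranch decayRate
  have h0 : ∀ E ∈ I, 4 * (a E * b E) ≠ 0 := fun E hE => by
    have := h.pos_left E hE
    have := h.pos_right E hE
    positivity
  have h1 : ∀ E ∈ I, b E + a E ≠ 0 := fun E hE => by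
    have := h.pos_left E hE
    have := h.pos_right E hE
    positivity
  have ca := h.cont_left
  have cb := h.cont_right
  have c0 : ContinuousOn (fun E => 4 * (a E * b E)) I := continuousOn_const.mul (ca.mul cb)
  exact (continuousOn_const.div c0 h0).sub (continuousOn_const.mul (Real.continuous_sqrt.comp_continuousOn
    (continuousOn_const.add (((((cb.sub ca).div (cb.add ca) h1).pow _).div c0 h0).pow 2))))

theorem exists_branch_eq (h : IsGapParametrization I a b) (s D : ℝ) (N : ℕ) {M E₁ E₂ : ℝ}
    (h1 : E₁ ∈ I) (h2 : E₂ ∈ I) (hlow : secularBranch s D N (a E₁) (b E₁) ≤ M)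
    (hhigh : M ≤ secularBranch s D N (a E₂) (b E₂)) :
    ∃ E ∈ I, secularBranch s D N (a E) (b E) = M :=
  h.preconnected.intermediate_value h1 h2 (h.continuousOn_branch s D N) ⟨hlow, hhigh⟩

/-- The point must be chosen before `N`: for fixed `N` the branch may stay bounded as `a E * b E`
tends to zero, because the decay rate may tend to `±1` there. This is why the impurities have to be
distant. -/
theorem exists_high (h : IsGapParametrization I a b) (D M : ℝ) : ∃ E ∈ I, ∃ N₀ : ℕ, ∀ N ≥ N₀,
    M < secularBranch 1 D N (a E) (b E) := by
  obtain ⟨E, hE, hsm⟩ := h.small (1 / (4 * (|M| + |D| + 1))) (by positivity)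
  have ha := h.pos_left E hE
  have hb := h.pos_right E hE
  refine ⟨E, hE, ?_⟩
  have hlim : Tendsto (fun N : ℕ => |decayRate (a E) (b E)| ^ (N + 1) / |4 * (a E * b E)|) atTop
      (𝓝 (0 / |4 * (a E * b E)|)) :=
    ((tendsto_pow_atTop_nhds_zero_of_lt_one (abs_nonneg _)
      (abs_decayRate_lt_one ha hb)).comp (tendsto_add_atTop_nat 1)).div_const _
  rw [zero_div] at hlim
  obtain ⟨N₀, hN₀⟩ := (hlim.eventually (gt_mem_nhds one_pos)).exists_forall_of_atTop
  refine ⟨N₀, fun N hN => ?_⟩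
  have h1 := hN₀ N hN
  have h2 := sqrt_secular_le D N (a E) (b E)
  have h3 : |M| + |D| + 1 < 1 / (4 * (a E * b E)) := by
    rw [lt_div_iff₀ (by positivity)]
    rw [lt_div_iff₀ (by positivity)] at hsm
    linarith
  unfold secularBranch
  linarith [le_abs_self M]

theorem exists_low (h : IsGapParametrization I a b) {ε : ℝ} (hε : 0 < ε) :
    ∃ E ∈ I, 1 / (4 * (a E * b E)) < ε := by
  obtain ⟨E, hE, hl⟩ := h.large (1 / (4 * ε))
  have ha := h.pos_left E hE
  have hb := h.pos_right E hE
  refine ⟨E, hE, ?_⟩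
  rw [div_lt_iff₀ (by positivity)] at hl ⊢
  linarith

theorem secularSet_eq (h : IsGapParametrization I a b) {β₁ β₂ : ℝ} (h1 : β₁ ≠ 0) (h2 : β₂ ≠ 0)
    (N : ℕ) : secularSet I a b β₁ β₂ N = {E | E ∈ I ∧
      (secularBranch 1 ((1 / β₁ - 1 / β₂) / 2) N (a E) (b E) = (1 / β₁ + 1 / β₂) / 2 ∨
      secularBranch (-1) ((1 / β₁ - 1 / β₂) / 2) N (a E) (b E) = (1 / β₁ + 1 / β₂) / 2)} := by
  ext E
  exact and_congr_right fun hE => secular_iff h1 h2 N (h.pos_left E hE) (h.pos_right E hE)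

/-- Opposite signs mean `M² - D² = 1 / (β₁ β₂) < 0`. The branch with `s = -1` stays above `|D| > M`,
while the branch with `s = 1` takes values on both sides of `M`. -/
theorem encard_secularSet_of_mul_neg (h : IsGapParametrization I a b) {β₁ β₂ : ℝ}
    (hβ : β₁ * β₂ < 0) : ∃ N₀ : ℕ, ∀ N ≥ N₀, (secularSet I a b β₁ β₂ N).encard = 1 := by
  have h1 : β₁ ≠ 0 := fun h0 => by simp [h0] at hβ
  have h2 : β₂ ≠ 0 := fun h0 => by simp [h0] at hβ
  set D := (1 / β₁ - 1 / β₂) / 2 with hD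
  set M := (1 / β₁ + 1 / β₂) / 2 with hM
  have hMD : |M| < |D| := by
    rw [← sq_lt_sq]
    have : M ^ 2 - D ^ 2 = 1 / (β₁ * β₂) := by rw [hM, hD]; field_simp; ring
    have := one_div_neg.2 hβ
    linarith
  obtain ⟨hM1, hM2⟩ := abs_lt.1 hMD
  obtain ⟨E₂, hE₂, N₀, hN₀⟩ := h.exists_high D M
  obtain ⟨E₁, hE₁, hlow⟩ := h.exists_low (ε := M + |D|) (by linarith)
  refine ⟨N₀, fun N hN => ?_⟩
  obtain ⟨E, hE, heq⟩ := h.exists_branch_eq 1 D N hE₁ hE₂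
    ((secularBranch_one_le D N _ _).trans (by linarith)) (hN₀ N hN).le
  rw [Set.encard_eq_one]
  refine ⟨E, ?_⟩
  rw [h.secularSet_eq h1 h2]
  ext F
  constructor
  · rintro ⟨hF, hF1 | hF1⟩
    · exact h.injOn_branch (by simp) D N hF hE (hF1.trans heq.symm)
    · have := secularBranch_neg_one_gt D N (h.pos_left F hF) (h.pos_right F hF)
      rw [← hD, ← hM] at hF1
      linarith
  · rintro rfl
    exact ⟨hE, Or.inl heq⟩

/-- Now `|D| < M`, and both branches cross the level `M` once. The two roots differ since `a E ≠ b
E` makes the decay rate nonzero, which separates the branches pointwise. -/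
theorem encard_secularSet_of_pos (h : IsGapParametrization I a b) {β₁ β₂ : ℝ}
    (h1 : 0 < β₁) (h2 : 0 < β₂) : ∃ N₀ : ℕ, ∀ N ≥ N₀, (secularSet I a b β₁ β₂ N).encard = 2 := by
  set D := (1 / β₁ - 1 / β₂) / 2 with hD
  set M := (1 / β₁ + 1 / β₂) / 2 with hM
  have i1 : 0 < 1 / β₁ := by positivity
  have i2 : 0 < 1 / β₂ := by positivity
  have hMD : |D| < M := by
    rw [abs_lt, hD, hM]
    constructor <;> linarith
  obtain ⟨E₂, hE₂, N₀, hN₀⟩ := h.exists_high D M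
  obtain ⟨E₁, hE₁, hlow⟩ := h.exists_low (ε := (M - |D|) / 2) (by linarith)
  have hDn := abs_nonneg D
  refine ⟨N₀, fun N hN => ?_⟩
  obtain ⟨E, hE, heq⟩ := h.exists_branch_eq 1 D N hE₁ hE₂
    ((secularBranch_one_le D N _ _).trans (by linarith)) (hN₀ N hN).le
  obtain ⟨F, hF, hFeq⟩ := h.exists_branch_eq (-1) D N hE₁ hE₂
    ((secularBranch_neg_one_le D N (h.pos_left _ hE₁) (h.pos_right _ hE₁)).trans (by linarith))
    ((hN₀ N hN).le.trans (secularBranch_one_le_neg_one D N _ _))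
  rw [Set.encard_eq_two]
  refine ⟨E, F, ?_, ?_⟩
  · rintro rfl
    have := secularBranch_one_lt_neg_one D N (h.pos_left _ hE) (h.pos_right _ hE) (h.ne _ hE)
    linarith
  · rw [h.secularSet_eq h1.ne' h2.ne']
    ext G
    constructor
    · rintro ⟨hG, hG1 | hG1⟩
      · exact Or.inl (h.injOn_branch (by simp) D N hG hE (hG1.trans heq.symm))
      · exact Or.inr (h.injOn_branch (by simp) D N hG hF (hG1.trans hFeq.symm))
    · rintro (rfl | rfl)
      · exact ⟨hE, Or.inl heq⟩
      · exact ⟨hF, Or.inr hFeq⟩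

/-- For negative parameters the left side of the secular equation exceeds `β₁ β₂`, while the right
side is at most `β₁ β₂`. -/
theorem secularSet_eq_empty (h : IsGapParametrization I a b) {β₁ β₂ : ℝ}
    (h1 : β₁ < 0) (h2 : β₂ < 0) (N : ℕ) : secularSet I a b β₁ β₂ N = ∅ := by
  rw [Set.eq_empty_iff_forall_notMem]
  rintro E ⟨hE, heq⟩
  have ha := h.pos_left E hE
  have hb := h.pos_right E hE
  have hτ : 0 < a E * b E := mul_pos ha hb
  have hr : decayRate (a E) (b E) ^ (2 * (N + 1)) ≤ 1 := by
    rw [← (even_two_mul (N + 1)).pow_abs]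
    exact pow_le_one₀ (abs_nonneg _) (abs_decayRate_lt_one ha hb).le
  nlinarith [mul_pos_of_neg_of_neg h1 h2, mul_pos hτ (neg_pos.2 h1), mul_pos hτ (neg_pos.2 h2)]

/-- For equal parameters the equation is `|4ab - β| = β |decayRate|^(N+1)`. The roots stay in a
compact part of the gap, where the decay rate is bounded away from one in modulus and the slope of
`(ab)²` from zero. -/
theorem secularSet_close (h : IsGapParametrization I a b) {β : ℝ} (hβ : 0 < β) :
    ∃ C > 0, ∃ c > 0, ∃ N₀ : ℕ, ∀ N ≥ N₀, ∀ E ∈ secularSet I a b β β N,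
      ∀ F ∈ secularSet I a b β β N, |E - F| ≤ C * Real.exp (-c * N) := by
  have hM : (1 / β + 1 / β) / 2 = 1 / β := by ring
  have hD : (1 / β - 1 / β) / 2 = 0 := by ring
  obtain ⟨E₂, hE₂, N₀, hN₀⟩ := h.exists_high 0 (1 / β)
  obtain ⟨E₁, hE₁, hlow⟩ := h.exists_low (ε := 1 / (2 * β)) (by positivity)
  have p1 := h.pos_left E₁ hE₁
  have q1 := h.pos_right E₁ hE₁
  have hτ1 : 2 * β < 4 * (a E₁ * b E₁) := by
    rwa [one_div_lt_one_div (by positivity) (by positivity)] at hlow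
  have hsubI : uIcc E₁ E₂ ⊆ I := h.ordConnected.uIcc_subset hE₁ hE₂
  have hle : ∀ N, ∀ E ∈ secularSet I a b β β N,
      |4 * (a E * b E) - β| = β * |decayRate (a E) (b E)| ^ (N + 1) := by
    rintro N E ⟨hE, heq⟩
    rw [← abs_of_pos hβ, ← abs_pow, ← abs_mul, ← sq_eq_sq_iff_abs_eq_abs, abs_of_pos hβ]
    rw [mul_comm 2, pow_mul] at heq
    linear_combination heq
  -- Every root has `4ab ≤ 2β`, which fails at `E₁` and beyond. At `E₂` both branches already exceed
  -- the level `1 / β`, and they are larger still further out.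
  have hloc : ∀ N ≥ N₀, secularSet I a b β β N ⊆ uIcc E₁ E₂ := by
    intro N hN E hEs
    have hE := hEs.1
    have pE := h.pos_left E hE
    have qE := h.pos_right E hE
    have hne1 : ¬(a E₁ < a E ∧ b E₁ < b E) := by
      rintro ⟨h1, h2⟩
      have h3 : a E₁ * b E₁ ≤ a E * b E := mul_le_mul h1.le h2.le q1.le pE.le
      have h4 := hle N E hEs
      have h5 : |decayRate (a E) (b E)| ^ (N + 1) ≤ 1 :=
        pow_le_one₀ (abs_nonneg _) (abs_decayRate_lt_one pE qE).le
      have h6 := le_abs_self (4 * (a E * b E) - β)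
      nlinarith
    have hne2 : ¬(a E < a E₂ ∧ b E < b E₂) := by
      rintro ⟨h1, h2⟩
      have h3 := hEs
      rw [h.secularSet_eq hβ.ne' hβ.ne', hM, hD] at h3
      have h4 := secularBranch_lt (s := 1) (by simp) 0 N pE h1 qE h2
      have h5 := hN₀ N hN
      have h6 := secularBranch_one_le_neg_one 0 N (a E) (b E)
      rcases h3.2 with h7 | h7 <;> linarith
    rw [mem_uIcc]
    rcases h.monotone with ⟨m1, m2⟩ | ⟨m1, m2⟩
    · refine Or.inr ⟨?_, ?_⟩
      · by_contra hlt
        exact hne2 ⟨m1 hE hE₂ (not_le.1 hlt), m2 hE hE₂ (not_le.1 hlt)⟩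
      · by_contra hlt
        exact hne1 ⟨m1 hE₁ hE (not_le.1 hlt), m2 hE₁ hE (not_le.1 hlt)⟩
    · refine Or.inl ⟨?_, ?_⟩
      · by_contra hlt
        exact hne1 ⟨m1 hE hE₁ (not_le.1 hlt), m2 hE hE₁ (not_le.1 hlt)⟩
      · by_contra hlt
        exact hne2 ⟨m1 hE₂ hE (not_le.1 hlt), m2 hE₂ hE (not_le.1 hlt)⟩
  obtain ⟨ρ, hρ0, hρ1, hρ⟩ : ∃ ρ : ℝ, 0 < ρ ∧ ρ < 1 ∧
      ∀ E ∈ uIcc E₁ E₂, |decayRate (a E) (b E)| ≤ ρ := by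
    have hc : ContinuousOn (fun E => |decayRate (a E) (b E)|) (uIcc E₁ E₂) := by
      have ca := h.cont_left.mono hsubI
      have cb := h.cont_right.mono hsubI
      exact ((cb.sub ca).div (cb.add ca) fun E hE => (add_pos (h.pos_right E (hsubI hE))
        (h.pos_left E (hsubI hE))).ne').abs
    obtain ⟨E, hE, hmax⟩ := isCompact_uIcc.exists_isMaxOn nonempty_uIcc hc
    refine ⟨max |decayRate (a E) (b E)| (1 / 2), lt_max_of_lt_right (by norm_num), max_lt
      (abs_decayRate_lt_one (h.pos_left _ (hsubI hE)) (h.pos_right _ (hsubI hE))) (by norm_num),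
      fun F hF => (hmax hF).trans (le_max_left _ _)⟩
  obtain ⟨k, hk, hslope⟩ := h.slope E₁ hE₁ E₂ hE₂
  -- For a root, `(4ab)²` differs from `β²` by at most `3 β² ρ^N`. Hence the values of `(ab)²` at
  -- two roots differ by at most `6/16` of `β² ρ^N`.
  refine ⟨β ^ 2 / k, by positivity, -Real.log ρ, neg_pos.2 (Real.log_neg hρ0 hρ1), N₀,
    fun N hN E hEs F hFs => ?_⟩
  have hE := hloc N hN hEs
  have hF := hloc N hN hFs
  have hexp : Real.exp (-(-Real.log ρ) * N) = ρ ^ N := by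
    rw [neg_neg, mul_comm, Real.exp_nat_mul, Real.exp_log hρ0]
  rw [hexp, div_mul_eq_mul_div, le_div_iff₀ hk, mul_comm]
  refine (hslope E hE F hF).trans ?_
  have hρN : 0 ≤ ρ ^ N := by positivity
  have bound : ∀ G ∈ uIcc E₁ E₂, G ∈ secularSet I a b β β N →
      |(4 * (a G * b G)) ^ 2 - β ^ 2| ≤ 3 * β ^ 2 * ρ ^ N := by
    intro G hG hGs
    have h1 := hle N G hGs
    have pG := abs_decayRate_lt_one (h.pos_left _ (hsubI hG)) (h.pos_right _ (hsubI hG))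
    have h2 : |decayRate (a G) (b G)| ^ (N + 1) ≤ ρ ^ N := by
      rw [pow_succ]
      calc _ ≤ ρ ^ N * 1 := mul_le_mul (pow_le_pow_left₀ (abs_nonneg _) (hρ G hG) N) pG.le
            (abs_nonneg _) hρN
        _ = _ := mul_one _
    have h3 : |decayRate (a G) (b G)| ^ (N + 1) ≤ 1 := pow_le_one₀ (abs_nonneg _) pG.le
    have h4 : |4 * (a G * b G) - β| ≤ β * ρ ^ N := by rw [h1]; gcongr
    have h5 : |4 * (a G * b G) - β| ≤ β := by rw [h1]; nlinarith
    have hτ : 0 < 4 * (a G * b G) := by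
      have := h.pos_left _ (hsubI hG)
      have := h.pos_right _ (hsubI hG)
      positivity
    have h6 : |4 * (a G * b G) + β| ≤ 3 * β := by
      rw [abs_of_pos (by linarith)]
      linarith [(abs_le.1 h5).2]
    rw [sq_sub_sq, abs_mul]
    calc _ ≤ 3 * β * (β * ρ ^ N) := mul_le_mul h6 h4 (abs_nonneg _) (by positivity)
      _ = _ := by ring
  have b1 := abs_le.1 (bound E hE hEs)
  have b2 := abs_le.1 (bound F hF hFs)
  have hβρ : 0 ≤ β ^ 2 * ρ ^ N := by positivity
  rw [abs_le]
  constructor <;> nlinarith [b1.1, b1.2, b2.1, b2.2]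

end IsGapParametrization

/-! ### Zeros of the half-edge solutions and the factors of the discriminant -/

theorem exists_odd_of_edgeCos_eq_zero {E : ℝ} (h : edgeCos E (Real.pi / 2) = 0) :
    ∃ m : ℕ, Odd m ∧ E = (m : ℝ) ^ 2 := by
  rcases lt_or_ge E 0 with hE | hE
  · rw [edgeCos_of_nonpos hE.le] at h
    exact absurd h (Real.cosh_pos _).ne'
  · rw [edgeCos_of_nonneg hE, Real.cos_eq_zero_iff] at h
    obtain ⟨k, hk⟩ := h
    have hs : √E = 2 * k + 1 := by
      have := Real.pi_pos.ne'
      field_simp at hk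
      linarith
    have hk0 : 0 ≤ k := by
      have h1 := Real.sqrt_nonneg E
      rw [hs] at h1
      by_contra hneg
      have : (k : ℝ) ≤ -1 := by exact_mod_cast (by omega : k ≤ -1)
      linarith
    lift k to ℕ using hk0
    refine ⟨2 * k + 1, ⟨k, rfl⟩, ?_⟩
    rw [← Real.sq_sqrt hE, hs]
    push_cast
    ring

theorem exists_even_of_edgeSin_eq_zero {E : ℝ} (h : edgeSin E (Real.pi / 2) = 0) :
    ∃ m : ℕ, Even m ∧ m ≠ 0 ∧ E = (m : ℝ) ^ 2 := by
  have hπ := Real.pi_pos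
  rcases lt_trichotomy E 0 with hE | hE | hE
  · have hq := Real.sqrt_pos.2 (neg_pos.2 hE)
    rw [edgeSin_of_neg hE] at h
    exact absurd h (div_pos (Real.sinh_pos_iff.2 (by positivity)) hq).ne'
  · rw [hE, edgeSin_zero_left] at h
    linarith
  · have hq := Real.sqrt_pos.2 hE
    rw [edgeSin_of_pos hE, div_eq_zero_iff, or_iff_left hq.ne', Real.sin_eq_zero_iff] at h
    obtain ⟨k, hk⟩ := h
    have hs : √E = 2 * k := by
      field_simp at hk
      linarith
    have hk0 : 0 < k := by
      rw [hs] at hq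
      by_contra hneg
      have : (k : ℝ) ≤ 0 := by exact_mod_cast (by omega : k ≤ 0)
      linarith
    lift k to ℕ using hk0.le
    refine ⟨2 * k, even_two_mul k, by omega, ?_⟩
    rw [← Real.sq_sqrt hE.le, hs]
    push_cast
    ring

theorem edgeCos_odd_sq {m : ℕ} (hm : Odd m) : edgeCos ((m : ℝ) ^ 2) (Real.pi / 2) = 0 := by
  obtain ⟨k, rfl⟩ := hm
  rw [edgeCos_of_nonneg (by positivity), Real.sqrt_sq (by positivity), Real.cos_eq_zero_iff]
  exact ⟨k, by push_cast; ring⟩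

theorem edgeSin_even_sq {m : ℕ} (hm : Even m) (h0 : m ≠ 0) :
    edgeSin ((m : ℝ) ^ 2) (Real.pi / 2) = 0 := by
  obtain ⟨k, rfl⟩ := hm
  have : 0 < ((k + k : ℕ) : ℝ) := by exact_mod_cast Nat.pos_of_ne_zero h0
  rw [edgeSin_of_pos (by positivity), Real.sqrt_sq this.le, div_eq_zero_iff]
  left
  rw [Real.sin_eq_zero_iff]
  exact ⟨k, by push_cast; ring⟩

/-- The two factors of `ξ ^ 2 - 1`, normalized: `ξ - 1 = s * lowerFactor` and
`ξ + 1 = s * upperFactor`. -/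
noncomputable def lowerFactor (α E : ℝ) : ℝ := α / 4 - edgeTan E

noncomputable def upperFactor (α E : ℝ) : ℝ := α / 4 + edgeCot E

theorem discriminant_sub_one (α : ℝ) {E : ℝ} (hC : edgeCos E (Real.pi / 2) ≠ 0) :
    discriminant α E - 1 = edgeSin E Real.pi * lowerFactor α E := by
  have h := edgeCos_sq_add E (Real.pi / 2)
  rw [discriminant, lowerFactor, edgeTan, edgeCos_pi, edgeSin_pi]
  field_simp
  linear_combination 4 * h

theorem discriminant_add_one (α : ℝ) {E : ℝ} (hS : edgeSin E (Real.pi / 2) ≠ 0) :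
    discriminant α E + 1 = edgeSin E Real.pi * upperFactor α E := by
  have h := edgeCos_sq_add E (Real.pi / 2)
  rw [discriminant, upperFactor, edgeCot, edgeCos_pi, edgeSin_pi]
  field_simp
  linear_combination -4 * h

theorem edgeSin_mul_factor_sub (α : ℝ) {E : ℝ} (hC : edgeCos E (Real.pi / 2) ≠ 0)
    (hS : edgeSin E (Real.pi / 2) ≠ 0) :
    edgeSin E Real.pi * (upperFactor α E - lowerFactor α E) = 2 := by
  linear_combination discriminant_sub_one α hC - discriminant_add_one α hS

theorem one_lt_abs_discriminant_iff (α : ℝ) {E : ℝ} (hC : edgeCos E (Real.pi / 2) ≠ 0)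
    (hS : edgeSin E (Real.pi / 2) ≠ 0) :
    1 < |discriminant α E| ↔ 0 < lowerFactor α E * upperFactor α E := by
  have hs : 0 < edgeSin E Real.pi ^ 2 := by
    rw [edgeSin_pi]
    positivity
  have e : discriminant α E ^ 2 - 1 = edgeSin E Real.pi ^ 2 * (lowerFactor α E * upperFactor α E) := by
    linear_combination (discriminant α E + 1) * discriminant_sub_one α hC
      + edgeSin E Real.pi * lowerFactor α E * discriminant_add_one α hS
  rw [← one_lt_sq_iff₀ (abs_nonneg _), sq_abs, ← sub_pos, e, mul_pos_iff_of_pos_left hs]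

theorem hasDerivAt_lowerFactor (α : ℝ) {E : ℝ} (hC : edgeCos E (Real.pi / 2) ≠ 0) :
    HasDerivAt (lowerFactor α) (-deriv edgeTan E) E :=
  ((hasDerivAt_edgeTan hC).differentiableAt.hasDerivAt).const_sub (α / 4)

theorem hasDerivAt_upperFactor (α : ℝ) {E : ℝ} (hS : edgeSin E (Real.pi / 2) ≠ 0) :
    HasDerivAt (upperFactor α) (deriv edgeCot E) E :=
  ((hasDerivAt_edgeCot hS).differentiableAt.hasDerivAt).const_add (α / 4)

theorem continuousOn_lowerFactor (α : ℝ) {s : Set ℝ} (h : ∀ E ∈ s, edgeCos E (Real.pi / 2) ≠ 0) :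
    ContinuousOn (lowerFactor α) s :=
  fun E hE => (hasDerivAt_lowerFactor α (h E hE)).continuousAt.continuousWithinAt

theorem continuousOn_upperFactor (α : ℝ) {s : Set ℝ} (h : ∀ E ∈ s, edgeSin E (Real.pi / 2) ≠ 0) :
    ContinuousOn (upperFactor α) s :=
  fun E hE => (hasDerivAt_upperFactor α (h E hE)).continuousAt.continuousWithinAt

theorem strictAntiOn_lowerFactor (α : ℝ) {s : Set ℝ} (hs : Convex ℝ s)
    (h : ∀ E ∈ s, edgeCos E (Real.pi / 2) ≠ 0) : StrictAntiOn (lowerFactor α) s :=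
  strictAntiOn_of_deriv_neg hs (continuousOn_lowerFactor α h) fun E hE => by
    rw [(hasDerivAt_lowerFactor α (h E (interior_subset hE))).deriv]
    exact neg_neg_of_pos (deriv_edgeTan_pos (h E (interior_subset hE)))

theorem strictAntiOn_upperFactor (α : ℝ) {s : Set ℝ} (hs : Convex ℝ s)
    (h : ∀ E ∈ s, edgeSin E (Real.pi / 2) ≠ 0) : StrictAntiOn (upperFactor α) s :=
  strictAntiOn_of_deriv_neg hs (continuousOn_upperFactor α h) fun E hE => by
    rw [(hasDerivAt_upperFactor α (h E (interior_subset hE))).deriv]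
    exact deriv_edgeCot_neg (h E (interior_subset hE))

theorem tendsto_abs_div_atTop {N D : ℝ → ℝ} {r : ℝ} {L : Filter ℝ} (hL : L ≤ 𝓝 r)
    (hN : ContinuousAt N r) (hN0 : N r ≠ 0) (hD : ContinuousAt D r) (hD0 : D r = 0)
    (hne : ∀ᶠ E in L, D E ≠ 0) : Tendsto (fun E => |N E / D E|) L atTop := by
  have h1 : Tendsto (fun E => |N E|) L (𝓝 |N r|) := (hN.abs.tendsto).mono_left hL
  have h2 : Tendsto (fun E => |D E|) L (𝓝[>] 0) := by
    refine tendsto_nhdsWithin_iff.2 ⟨?_, hne.mono fun E h => abs_pos.2 h⟩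
    have := (hD.abs.tendsto).mono_left hL
    rwa [hD0, abs_zero] at this
  have h3 := h1.pos_mul_atTop (abs_pos.2 hN0) (tendsto_inv_nhdsGT_zero.comp h2)
  refine h3.congr fun E => ?_
  rw [abs_div, div_eq_mul_inv]
  rfl

theorem tendsto_abs_lowerFactor (α : ℝ) {r : ℝ} {L : Filter ℝ} (hL : L ≤ 𝓝 r)
    (hr : edgeCos r (Real.pi / 2) = 0) (hne : ∀ᶠ E in L, edgeCos E (Real.pi / 2) ≠ 0) :
    Tendsto (fun E => |lowerFactor α E|) L atTop := by
  have h1 : Tendsto (fun E => |edgeTan E|) L atTop := by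
    refine tendsto_abs_div_atTop (N := fun E => E * edgeSin E (Real.pi / 2))
      (D := fun E => edgeCos E (Real.pi / 2)) hL
      (continuous_id.mul (continuous_edgeSin_left _)).continuousAt ?_
      (continuous_edgeCos_left _).continuousAt hr hne
    intro h0
    have := edgeCos_sq_add r (Real.pi / 2)
    rw [hr] at this
    rw [pow_two (edgeSin r (Real.pi / 2)), ← mul_assoc, h0] at this
    norm_num at this
  refine tendsto_atTop_mono (fun E => ?_) (tendsto_atTop_add_const_right L (-|α / 4|) h1)
  have := abs_sub_abs_le_abs_sub (edgeTan E) (α / 4)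
  rw [abs_sub_comm] at this
  exact this

theorem tendsto_abs_upperFactor (α : ℝ) {r : ℝ} {L : Filter ℝ} (hL : L ≤ 𝓝 r)
    (hr : edgeSin r (Real.pi / 2) = 0) (hne : ∀ᶠ E in L, edgeSin E (Real.pi / 2) ≠ 0) :
    Tendsto (fun E => |upperFactor α E|) L atTop := by
  have h1 : Tendsto (fun E => |edgeCot E|) L atTop := by
    refine tendsto_abs_div_atTop hL (continuous_edgeCos_left _).continuousAt ?_
      (continuous_edgeSin_left _).continuousAt hr hne
    intro h0
    have := edgeCos_sq_add r (Real.pi / 2)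
    rw [hr, h0] at this
    norm_num at this
  refine tendsto_atTop_mono (fun E => ?_) (tendsto_atTop_add_const_right L (-|α / 4|) h1)
  have := abs_sub_abs_le_abs_sub (edgeCot E) (-(α / 4))
  rw [abs_neg, sub_neg_eq_add, add_comm (edgeCot E)] at this
  exact this

/-- A decreasing function whose modulus blows up at the right end can only tend to minus infinity:
to the right of `F` it stays below `f F`, so a modulus above `|R| + |f F|` has to come from a
negative value. -/
theorem exists_lt_of_tendsto_abs {J : Set ℝ} {r : ℝ} {f : ℝ → ℝ} (hJ : ∀ᶠ E in 𝓝[<] r, E ∈ J)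
    (hf : StrictAntiOn f J) (h : Tendsto (fun E => |f E|) (𝓝[<] r) atTop) (R : ℝ) :
    ∃ E ∈ J, f E < R := by
  obtain ⟨F, hF, hFr⟩ := (hJ.and self_mem_nhdsWithin).exists
  obtain ⟨E, ⟨hEJ, hE⟩, hFE⟩ := ((hJ.and (h.eventually_gt_atTop (|R| + |f F|))).and
    (mem_nhdsWithin_of_mem_nhds (Ioi_mem_nhds hFr))).exists
  refine ⟨E, hEJ, ?_⟩
  have h1 := hf hF hEJ hFE
  have h2 := abs_nonneg R
  have h3 := abs_nonneg (f F)
  rcases abs_cases (f E) with ⟨h4, _⟩ | ⟨h4, _⟩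
  · linarith [le_abs_self (f F)]
  · linarith [neg_abs_le R]

theorem exists_gt_of_tendsto_abs {J : Set ℝ} {l : ℝ} {f : ℝ → ℝ} (hJ : ∀ᶠ E in 𝓝[>] l, E ∈ J)
    (hf : StrictAntiOn f J) (h : Tendsto (fun E => |f E|) (𝓝[>] l) atTop) (R : ℝ) :
    ∃ E ∈ J, R < f E := by
  obtain ⟨F, hF, hFl⟩ := (hJ.and self_mem_nhdsWithin).exists
  obtain ⟨E, ⟨hEJ, hE⟩, hFE⟩ := ((hJ.and (h.eventually_gt_atTop (|R| + |f F|))).and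
    (mem_nhdsWithin_of_mem_nhds (Iio_mem_nhds hFl))).exists
  refine ⟨E, hEJ, ?_⟩
  have h1 := hf hEJ hF hFE
  have h2 := abs_nonneg R
  have h3 := abs_nonneg (f F)
  rcases abs_cases (f E) with ⟨h4, _⟩ | ⟨h4, _⟩
  · linarith [le_abs_self R]
  · linarith [neg_abs_le (f F)]

/-! ### Position of the gaps between consecutive squares -/

/-- The intervals between consecutive infinitely degenerate eigenvalues. -/
def bandSet (m : ℕ) : Set ℝ := {E | (m = 0 ∨ (m : ℝ) ^ 2 < E) ∧ E < ((m + 1 : ℕ) : ℝ) ^ 2}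

theorem bandSet_ordConnected (m : ℕ) : OrdConnected (bandSet m) :=
  ⟨fun _ hx _ hy _ hz => ⟨hx.1.imp_right fun h => h.trans_le hz.1, hz.2.trans_lt hy.2⟩⟩

theorem sq_strip {m k : ℕ} {E : ℝ} (h1 : m = 0 ∨ (m : ℝ) ^ 2 ≤ E) (h2 : E ≤ ((m + 1 : ℕ) : ℝ) ^ 2)
    (hk : E = (k : ℝ) ^ 2) : m ≤ k ∧ k ≤ m + 1 := by
  subst hk
  refine ⟨?_, ?_⟩
  · rcases h1 with rfl | h1
    · exact Nat.zero_le _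
    · have : m ^ 2 ≤ k ^ 2 := by exact_mod_cast h1
      exact (Nat.pow_le_pow_iff_left two_ne_zero).1 this
  · have : k ^ 2 ≤ (m + 1) ^ 2 := by exact_mod_cast h2
    exact (Nat.pow_le_pow_iff_left two_ne_zero).1 this

theorem edgeCos_ne_zero_of_even {m : ℕ} (hm : Even m) {E : ℝ} (h1 : m = 0 ∨ (m : ℝ) ^ 2 ≤ E)
    (h2 : E < ((m + 1 : ℕ) : ℝ) ^ 2) : edgeCos E (Real.pi / 2) ≠ 0 := by
  intro h
  obtain ⟨k, hk, hkE⟩ := exists_odd_of_edgeCos_eq_zero h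
  obtain ⟨h3, h4⟩ := sq_strip h1 h2.le hkE
  rcases Nat.eq_or_lt_of_le h4 with h5 | h5
  · rw [hkE, h5] at h2
    exact lt_irrefl _ h2
  · have : k = m := by omega
    subst this
    exact (Nat.not_even_iff_odd.2 hk) hm

theorem edgeCos_ne_zero_of_odd {m : ℕ} (hm : Odd m) {E : ℝ} (h1 : (m : ℝ) ^ 2 < E)
    (h2 : E ≤ ((m + 1 : ℕ) : ℝ) ^ 2) : edgeCos E (Real.pi / 2) ≠ 0 := by
  intro h
  obtain ⟨k, hk, hkE⟩ := exists_odd_of_edgeCos_eq_zero h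
  obtain ⟨h3, h4⟩ := sq_strip (Or.inr h1.le) h2 hkE
  rcases Nat.eq_or_lt_of_le h3 with h5 | h5
  · rw [hkE, h5] at h1
    exact lt_irrefl _ h1
  · have : k = m + 1 := by omega
    subst this
    exact (Nat.not_even_iff_odd.2 hk) hm.add_one

theorem edgeSin_ne_zero_of_even {m : ℕ} (hm : Even m) {E : ℝ} (h1 : m = 0 ∨ (m : ℝ) ^ 2 < E)
    (h2 : E ≤ ((m + 1 : ℕ) : ℝ) ^ 2) : edgeSin E (Real.pi / 2) ≠ 0 := by
  intro h
  obtain ⟨k, hk, hk0, hkE⟩ := exists_even_of_edgeSin_eq_zero h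
  obtain ⟨h3, h4⟩ := sq_strip (h1.imp_right le_of_lt) h2 hkE
  have h5 : k ≠ m := by
    rintro rfl
    rcases h1 with h1 | h1
    · exact hk0 h1
    · exact (hkE ▸ h1).ne rfl
  have : k = m + 1 := by omega
  subst this
  exact (Nat.not_even_iff_odd.2 hm.add_one) hk

theorem edgeSin_ne_zero_of_odd {m : ℕ} (hm : Odd m) {E : ℝ} (h1 : (m : ℝ) ^ 2 ≤ E)
    (h2 : E < ((m + 1 : ℕ) : ℝ) ^ 2) : edgeSin E (Real.pi / 2) ≠ 0 := by
  intro h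
  obtain ⟨k, hk, hk0, hkE⟩ := exists_even_of_edgeSin_eq_zero h
  obtain ⟨h3, h4⟩ := sq_strip (Or.inr h1) h2.le hkE
  rcases Nat.eq_or_lt_of_le h4 with h5 | h5
  · rw [hkE, h5] at h2
    exact lt_irrefl _ h2
  · have : k = m := by omega
    subst this
    exact (Nat.not_even_iff_odd.2 hm) hk

theorem edge_ne_zero_of_mem_bandSet {m : ℕ} {E : ℝ} (hE : E ∈ bandSet m) :
    edgeCos E (Real.pi / 2) ≠ 0 ∧ edgeSin E (Real.pi / 2) ≠ 0 := by
  rcases Nat.even_or_odd m with hm | hm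
  · exact ⟨edgeCos_ne_zero_of_even hm (hE.1.imp_right le_of_lt) hE.2,
      edgeSin_ne_zero_of_even hm hE.1 hE.2.le⟩
  · have h1 : (m : ℝ) ^ 2 < E := hE.1.resolve_left hm.pos.ne'
    exact ⟨edgeCos_ne_zero_of_odd hm h1 hE.2.le, edgeSin_ne_zero_of_odd hm h1.le hE.2⟩

/-- Hence no gap contains a positive square, and every gap lies in a single `bandSet m`. -/
theorem discriminant_sq_boundary (α : ℝ) {m : ℕ} (hm : m ≠ 0) : |discriminant α ((m : ℝ) ^ 2)| = 1 := by
  have hs : edgeSin ((m : ℝ) ^ 2) Real.pi = 0 := by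
    rw [edgeSin_pi]
    rcases Nat.even_or_odd m with h | h
    · rw [edgeSin_even_sq h hm]; ring
    · rw [edgeCos_odd_sq h]; ring
  have h1 := edgeCos_sq_add ((m : ℝ) ^ 2) Real.pi
  rw [hs] at h1
  rw [discriminant, hs, mul_zero, add_zero, ← sq_eq_sq₀ (abs_nonneg _) zero_le_one, sq_abs]
  linarith

theorem exists_mem_bandSet {α E : ℝ} (hE : 1 < |discriminant α E|) : ∃ m, E ∈ bandSet m := by
  have hne : ∀ m : ℕ, m ≠ 0 → E ≠ (m : ℝ) ^ 2 := fun m hm h => by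
    rw [h, discriminant_sq_boundary α hm] at hE
    exact lt_irrefl _ hE
  refine ⟨⌊√E⌋₊, ?_, ?_⟩
  · rw [or_iff_not_imp_left]
    intro h0
    have h1 : 0 < √E := by
      by_contra hcon
      exact h0 (Nat.floor_of_nonpos (not_lt.1 hcon))
    have h2 := Nat.floor_le h1.le
    have h3 : (⌊√E⌋₊ : ℝ) ^ 2 ≤ E := by
      rw [← Real.sq_sqrt (Real.sqrt_pos.1 h1).le]
      have := pow_le_pow_left₀ (Nat.cast_nonneg _) h2 2
      simpa using this
    exact lt_of_le_of_ne h3 (hne _ h0).symm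
  · have h2 := Nat.lt_floor_add_one √E
    push_cast
    exact (Real.sqrt_lt' (by positivity)).1 h2

theorem edgeSin_pi_pos_of_lt_one {E : ℝ} (hE : E < 1) : 0 < edgeSin E Real.pi := by
  have hπ := Real.pi_pos
  rcases lt_trichotomy E 0 with h | h | h
  · have hq := Real.sqrt_pos.2 (neg_pos.2 h)
    rw [edgeSin_of_neg h]
    exact div_pos (Real.sinh_pos_iff.2 (by positivity)) hq
  · rw [h, edgeSin_zero_left]
    exact hπ
  · have hq := Real.sqrt_pos.2 h
    have h1 : √E < 1 := (Real.sqrt_lt' one_pos).2 (by simpa using hE)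
    rw [edgeSin_of_pos h]
    exact div_pos (Real.sin_pos_of_pos_of_lt_pi (by positivity) (by nlinarith)) hq

/-- At energy `-q²` the cotangent term is `q coth (qπ/2) ≥ q`. This replaces the pole at the left
end, which the lowest interval lacks. -/
theorem exists_upperFactor_gt (α R : ℝ) : ∃ E ∈ bandSet 0, R < upperFactor α E := by
  set q := |R - α / 4| + 1 with hq
  have hq0 : 0 < q := by positivity
  have hE : -q ^ 2 < 0 := by nlinarith
  refine ⟨-q ^ 2, ⟨Or.inl rfl, by push_cast; nlinarith⟩, ?_⟩
  have hs : √(-(-q ^ 2)) = q := by rw [neg_neg, Real.sqrt_sq hq0.le]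
  rw [upperFactor, edgeCot, edgeSin_of_neg hE, edgeCos_of_nonpos hE.le, hs]
  have h1 : 0 < Real.sinh (q * (Real.pi / 2)) := Real.sinh_pos_iff.2 (by positivity)
  have h2 : q ≤ Real.cosh (q * (Real.pi / 2)) / (Real.sinh (q * (Real.pi / 2)) / q) := by
    rw [le_div_iff₀ (by positivity), mul_div_cancel₀ _ hq0.ne']
    exact (Real.sinh_lt_cosh _).le
  have h3 := le_abs_self (R - α / 4)
  linarith

/-- Two decreasing functions on an interval whose common sign singles out the gaps in it. -/
structure IsBandPair (J : Set ℝ) (X Y : ℝ → ℝ) : Prop where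
  ordConnected : OrdConnected J
  cont_left : ContinuousOn X J
  cont_right : ContinuousOn Y J
  anti_left : StrictAntiOn X J
  anti_right : StrictAntiOn Y J
  pos_of_pos : ∀ E ∈ J, 0 < X E → 0 < Y E
  neg_of_neg : ∀ E ∈ J, Y E < 0 → X E < 0
  unbounded_below : ∀ R : ℝ, ∃ E ∈ J, X E < R
  unbounded_above : ∀ R : ℝ, ∃ E ∈ J, R < Y E

theorem bandSet_mem_left (m : ℕ) : ∀ᶠ E in 𝓝[>] ((m : ℝ) ^ 2), E ∈ bandSet m := by
  have : (m : ℝ) ^ 2 < ((m + 1 : ℕ) : ℝ) ^ 2 := by push_cast; nlinarith [Nat.cast_nonneg (α := ℝ) m]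
  filter_upwards [self_mem_nhdsWithin, mem_nhdsWithin_of_mem_nhds (Iio_mem_nhds this)] with E h1 h2
  exact ⟨Or.inr h1, h2⟩

theorem bandSet_mem_right (m : ℕ) : ∀ᶠ E in 𝓝[<] (((m + 1 : ℕ) : ℝ) ^ 2), E ∈ bandSet m := by
  have : (m : ℝ) ^ 2 < ((m + 1 : ℕ) : ℝ) ^ 2 := by push_cast; nlinarith [Nat.cast_nonneg (α := ℝ) m]
  filter_upwards [self_mem_nhdsWithin, mem_nhdsWithin_of_mem_nhds (Ioi_mem_nhds this)] with E h1 h2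
  exact ⟨Or.inr h2, h1⟩

/-- For even `m ≥ 2` the sine vanishes at the left end and the cosine at the right end. There
`lowerFactor`, respectively `upperFactor`, equals `α / 4`, so monotonicity gives `lowerFactor < α /
4 < upperFactor` inside, and the poles lie at the opposite ends. For `m = 0` the order follows from
`edgeSin E π > 0` and `edgeSin_mul_factor_sub`. -/
theorem isBandPair_even (α : ℝ) {m : ℕ} (hm : Even m) :
    IsBandPair (bandSet m) (lowerFactor α) (upperFactor α) := by
  have hJ := bandSet_ordConnected m
  have hC : ∀ E ∈ bandSet m, edgeCos E (Real.pi / 2) ≠ 0 := fun E hE =>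
    (edge_ne_zero_of_mem_bandSet hE).1
  have hS : ∀ E ∈ bandSet m, edgeSin E (Real.pi / 2) ≠ 0 := fun E hE =>
    (edge_ne_zero_of_mem_bandSet hE).2
  have aX := strictAntiOn_lowerFactor α hJ.convex hC
  have aY := strictAntiOn_upperFactor α hJ.convex hS
  have hord : ∀ E ∈ bandSet m, (0 < lowerFactor α E → 0 < upperFactor α E) ∧
      (upperFactor α E < 0 → lowerFactor α E < 0) := by
    intro E hE
    by_cases h0 : m = 0
    · subst h0
      have h1 := edgeSin_mul_factor_sub α (hC E hE) (hS E hE)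
      have h2 := edgeSin_pi_pos_of_lt_one (E := E) (by simpa using hE.2)
      have h3 : lowerFactor α E < upperFactor α E := by
        by_contra hcon
        nlinarith
      exact ⟨fun h => h.trans h3, fun h => h3.trans h⟩
    · have hmE : (m : ℝ) ^ 2 < E := hE.1.resolve_left h0
      have hm1 : (m : ℝ) ^ 2 < ((m + 1 : ℕ) : ℝ) ^ 2 := hmE.trans hE.2
      have bX : lowerFactor α E < α / 4 := by
        have := strictAntiOn_lowerFactor α (convex_Ico ((m : ℝ) ^ 2) (((m + 1 : ℕ) : ℝ) ^ 2))
          (fun F hF => edgeCos_ne_zero_of_even hm (Or.inr hF.1) hF.2) ⟨le_rfl, hm1⟩ ⟨hmE.le, hE.2⟩ hmE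
        rwa [lowerFactor, lowerFactor, edgeTan, edgeTan, edgeSin_even_sq hm h0, mul_zero, zero_div,
          sub_zero] at this
      have bY : α / 4 < upperFactor α E := by
        have := strictAntiOn_upperFactor α (convex_Ioc ((m : ℝ) ^ 2) (((m + 1 : ℕ) : ℝ) ^ 2))
          (fun F hF => edgeSin_ne_zero_of_even hm (Or.inr hF.1) hF.2) ⟨hmE, hE.2.le⟩ ⟨hm1, le_rfl⟩ hE.2
        rwa [upperFactor, upperFactor, edgeCot, edgeCot, edgeCos_odd_sq hm.add_one, zero_div,
          add_zero] at this
      exact ⟨fun h => (h.trans bX).trans bY, fun h => bX.trans (bY.trans h)⟩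
  refine ⟨hJ, continuousOn_lowerFactor α hC, continuousOn_upperFactor α hS, aX, aY,
    fun E hE => (hord E hE).1, fun E hE => (hord E hE).2, ?_, ?_⟩
  · exact exists_lt_of_tendsto_abs (bandSet_mem_right m) aX (tendsto_abs_lowerFactor α
      nhdsWithin_le_nhds (edgeCos_odd_sq hm.add_one) ((bandSet_mem_right m).mono hC))
  · by_cases h0 : m = 0
    · subst h0
      exact exists_upperFactor_gt α
    · exact exists_gt_of_tendsto_abs (bandSet_mem_left m) aY (tendsto_abs_upperFactor α
        nhdsWithin_le_nhds (edgeSin_even_sq hm h0) ((bandSet_mem_left m).mono hS))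

/-- For odd `m` sine and cosine exchange their zeros at the ends, hence the two factors exchange
their roles. -/
theorem isBandPair_odd (α : ℝ) {m : ℕ} (hm : Odd m) :
    IsBandPair (bandSet m) (upperFactor α) (lowerFactor α) := by
  have hJ := bandSet_ordConnected m
  have h0 : m ≠ 0 := hm.pos.ne'
  have hC : ∀ E ∈ bandSet m, edgeCos E (Real.pi / 2) ≠ 0 := fun E hE =>
    (edge_ne_zero_of_mem_bandSet hE).1
  have hS : ∀ E ∈ bandSet m, edgeSin E (Real.pi / 2) ≠ 0 := fun E hE =>
    (edge_ne_zero_of_mem_bandSet hE).2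
  have aX := strictAntiOn_upperFactor α hJ.convex hS
  have aY := strictAntiOn_lowerFactor α hJ.convex hC
  have hbd : ∀ E ∈ bandSet m, upperFactor α E < α / 4 ∧ α / 4 < lowerFactor α E := by
    intro E hE
    have hmE : (m : ℝ) ^ 2 < E := hE.1.resolve_left h0
    have hm1 : (m : ℝ) ^ 2 < ((m + 1 : ℕ) : ℝ) ^ 2 := hmE.trans hE.2
    constructor
    · have := strictAntiOn_upperFactor α (convex_Ico ((m : ℝ) ^ 2) (((m + 1 : ℕ) : ℝ) ^ 2))
        (fun F hF => edgeSin_ne_zero_of_odd hm hF.1 hF.2) ⟨le_rfl, hm1⟩ ⟨hmE.le, hE.2⟩ hmE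
      rwa [upperFactor, upperFactor, edgeCot, edgeCot, edgeCos_odd_sq hm, zero_div,
        add_zero] at this
    · have := strictAntiOn_lowerFactor α (convex_Ioc ((m : ℝ) ^ 2) (((m + 1 : ℕ) : ℝ) ^ 2))
        (fun F hF => edgeCos_ne_zero_of_odd hm hF.1 hF.2) ⟨hmE, hE.2.le⟩ ⟨hm1, le_rfl⟩ hE.2
      rwa [lowerFactor, lowerFactor, edgeTan, edgeTan, edgeSin_even_sq hm.add_one (by omega),
        mul_zero, zero_div, sub_zero] at this
  refine ⟨hJ, continuousOn_upperFactor α hS, continuousOn_lowerFactor α hC, aX, aY,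
    fun E hE h => (h.trans (hbd E hE).1).trans (hbd E hE).2,
    fun E hE h => (hbd E hE).1.trans ((hbd E hE).2.trans h), ?_, ?_⟩
  · exact exists_lt_of_tendsto_abs (bandSet_mem_right m) aX (tendsto_abs_upperFactor α
      nhdsWithin_le_nhds (edgeSin_even_sq hm.add_one (by omega)) ((bandSet_mem_right m).mono hS))
  · exact exists_gt_of_tendsto_abs (bandSet_mem_left m) aY (tendsto_abs_lowerFactor α
      nhdsWithin_le_nhds (edgeCos_odd_sq hm) ((bandSet_mem_left m).mono hC))

namespace IsBandPair

variable {J : Set ℝ} {X Y : ℝ → ℝ}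

/-- The shape of the lower gap of a band interval. -/
theorem lower_gap (h : IsBandPair J X Y) {E₀ : ℝ} (hE₀ : E₀ ∈ J) (h0 : 0 < X E₀) :
    ∃ e ∈ J, X e = 0 ∧ E₀ < e ∧ (∀ E ∈ J, 0 < X E ↔ E < e) ∧
      (∀ ε > 0, ∃ E ∈ J, 0 < X E ∧ X E * Y E < ε) ∧
      (∀ R : ℝ, ∃ E ∈ J, 0 < X E ∧ R < X E * Y E) := by
  obtain ⟨E₁, hE₁, h1⟩ := h.unbounded_below 0
  have hlt : E₀ < E₁ := (h.anti_left.lt_iff_gt hE₁ hE₀).1 (h1.trans h0)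
  have hsub : Icc E₀ E₁ ⊆ J := h.ordConnected.out hE₀ hE₁
  obtain ⟨e, he, hXe⟩ := intermediate_value_Icc' hlt.le (h.cont_left.mono hsub) ⟨h1.le, h0.le⟩
  have heJ := hsub he
  have hEe : E₀ < e := (h.anti_left.lt_iff_gt heJ hE₀).1 (by rwa [hXe])
  have hiff : ∀ E ∈ J, 0 < X E ↔ E < e := fun E hE => by
    rw [← hXe, h.anti_left.lt_iff_gt heJ hE]
  have hY0 := h.pos_of_pos E₀ hE₀ h0
  refine ⟨e, heJ, hXe, hEe, hiff, fun ε hε => ?_, fun R => ?_⟩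
  · have hsub' : Icc E₀ e ⊆ J := h.ordConnected.out hE₀ heJ
    set v := min ε (X E₀ * Y E₀) / 2 with hv
    have hv0 : 0 < min ε (X E₀ * Y E₀) := lt_min hε (mul_pos h0 hY0)
    have hv1 := min_le_left ε (X E₀ * Y E₀)
    have hv2 := min_le_right ε (X E₀ * Y E₀)
    obtain ⟨E, hE, hXY⟩ := intermediate_value_Icc' hEe.le
      ((h.cont_left.mul h.cont_right).mono hsub') (show v ∈ Icc (X e * Y e) (X E₀ * Y E₀) by
        rw [hXe, zero_mul]
        constructor <;> linarith)
    change X E * Y E = v at hXY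
    refine ⟨E, hsub' hE, (hiff E (hsub' hE)).2 (lt_of_le_of_ne hE.2 ?_), by linarith⟩
    rintro rfl
    rw [hXe, zero_mul] at hXY
    linarith
  -- Moving left, `Y` grows without bound while `X` stays above `X E₀ > 0`.
  · obtain ⟨E, hE, hYE⟩ := h.unbounded_above (Y E₀ + |R| / X E₀)
    have hnn : 0 ≤ |R| / X E₀ := by positivity
    have hEE : E < E₀ := (h.anti_right.lt_iff_gt hE₀ hE).1 (by linarith)
    have hXE := h.anti_left hE hE₀ hEE
    refine ⟨E, hE, h0.trans hXE, ?_⟩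
    have h2 : |R| < Y E * X E₀ := (div_lt_iff₀ h0).1 (by linarith)
    nlinarith [le_abs_self R]

/-- The shape of the upper gap of a band interval. -/
theorem upper_gap (h : IsBandPair J X Y) {E₀ : ℝ} (hE₀ : E₀ ∈ J) (h0 : Y E₀ < 0) :
    ∃ e ∈ J, Y e = 0 ∧ e < E₀ ∧ (∀ E ∈ J, Y E < 0 ↔ e < E) ∧
      (∀ ε > 0, ∃ E ∈ J, Y E < 0 ∧ X E * Y E < ε) ∧
      (∀ R : ℝ, ∃ E ∈ J, Y E < 0 ∧ R < X E * Y E) := by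
  obtain ⟨E₁, hE₁, h1⟩ := h.unbounded_above 0
  have hlt : E₁ < E₀ := (h.anti_right.lt_iff_gt hE₀ hE₁).1 (h0.trans h1)
  have hsub : Icc E₁ E₀ ⊆ J := h.ordConnected.out hE₁ hE₀
  obtain ⟨e, he, hYe⟩ := intermediate_value_Icc' hlt.le (h.cont_right.mono hsub) ⟨h0.le, h1.le⟩
  have heJ := hsub he
  have hEe : e < E₀ := (h.anti_right.lt_iff_gt hE₀ heJ).1 (by rwa [hYe])
  have hiff : ∀ E ∈ J, Y E < 0 ↔ e < E := fun E hE => by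
    rw [← hYe, h.anti_right.lt_iff_gt hE heJ]
  have hX0 := h.neg_of_neg E₀ hE₀ h0
  refine ⟨e, heJ, hYe, hEe, hiff, fun ε hε => ?_, fun R => ?_⟩
  · have hsub' : Icc e E₀ ⊆ J := h.ordConnected.out heJ hE₀
    set v := min ε (X E₀ * Y E₀) / 2 with hv
    have hv0 : 0 < min ε (X E₀ * Y E₀) := lt_min hε (mul_pos_of_neg_of_neg hX0 h0)
    have hv1 := min_le_left ε (X E₀ * Y E₀)
    have hv2 := min_le_right ε (X E₀ * Y E₀)
    obtain ⟨E, hE, hXY⟩ := intermediate_value_Icc hEe.le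
      ((h.cont_left.mul h.cont_right).mono hsub') (show v ∈ Icc (X e * Y e) (X E₀ * Y E₀) by
        rw [hYe, mul_zero]
        constructor <;> linarith)
    change X E * Y E = v at hXY
    refine ⟨E, hsub' hE, (hiff E (hsub' hE)).2 (lt_of_le_of_ne hE.1 ?_), by linarith⟩
    rintro rfl
    rw [hYe, mul_zero] at hXY
    linarith
  · obtain ⟨E, hE, hXE⟩ := h.unbounded_below (X E₀ + |R| / Y E₀)
    have hnn : |R| / Y E₀ ≤ 0 := div_nonpos_of_nonneg_of_nonpos (abs_nonneg _) h0.le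
    have hEE : E₀ < E := (h.anti_left.lt_iff_gt hE hE₀).1 (by linarith)
    have hYE := h.anti_right hE₀ hE hEE
    refine ⟨E, hE, hYE.trans h0, ?_⟩
    have h2 : X E < |R| / Y E₀ := by linarith
    rw [lt_div_iff_of_neg h0] at h2
    nlinarith [le_abs_self R]

end IsBandPair

theorem connectedComponentIn_eq_of_separated {F K : Set ℝ} {E₀ : ℝ} (hK : IsPreconnected K)
    (hE₀ : E₀ ∈ K) (hKF : K ⊆ F) (hsep : ∀ y ∉ K, ∃ z ∈ uIcc E₀ y, z ∉ F) :
    connectedComponentIn F E₀ = K := by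
  refine Subset.antisymm (fun y hy => ?_) (hK.subset_connectedComponentIn hE₀ hKF)
  by_contra hyK
  obtain ⟨z, hz, hzF⟩ := hsep y hyK
  have hord : OrdConnected (connectedComponentIn F E₀) :=
    isPreconnected_connectedComponentIn.ordConnected
  exact hzF (connectedComponentIn_subset F E₀
    (hord.uIcc_subset (mem_connectedComponentIn (hKF hE₀)) hy hz))

/-- Since `(√P √Q)² = P Q`, the slope condition does not involve the roots. As `P` and `Q` vary in
the same direction, the increment of `P Q` is at least that of `P` times the minimum of `Q` on the
compact interval. -/
theorem isGapParametrization_sqrt {I : Set ℝ} {P Q : ℝ → ℝ} (hI : IsPreconnected I)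
    (cP : ContinuousOn P I) (cQ : ContinuousOn Q I) (hP : ∀ E ∈ I, 0 < P E)
    (hQ : ∀ E ∈ I, 0 < Q E) (hne : ∀ E ∈ I, P E ≠ Q E)
    (hmono : (StrictMonoOn P I ∧ StrictMonoOn Q I) ∨ (StrictAntiOn P I ∧ StrictAntiOn Q I))
    (small : ∀ ε > 0, ∃ E ∈ I, P E * Q E < ε) (large : ∀ R : ℝ, ∃ E ∈ I, R < P E * Q E)
    (slope : ∀ E₁ ∈ I, ∀ E₂ ∈ I, ∃ k > 0, ∀ E ∈ uIcc E₁ E₂, ∀ F ∈ uIcc E₁ E₂,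
      k * |E - F| ≤ |P E - P F|) :
    IsGapParametrization I (fun E => √(P E)) (fun E => √(Q E)) := by
  have hsq : ∀ E ∈ I, (√(P E) * √(Q E)) ^ 2 = P E * Q E := fun E hE => by
    rw [mul_pow, Real.sq_sqrt (hP E hE).le, Real.sq_sqrt (hQ E hE).le]
  have hprod : ∀ E ∈ I, √(P E) * √(Q E) = √(P E * Q E) := fun E hE =>
    (Real.sqrt_mul (hP E hE).le _).symm
  refine ⟨hI, cP.sqrt, cQ.sqrt, fun E hE => Real.sqrt_pos.2 (hP E hE),
    fun E hE => Real.sqrt_pos.2 (hQ E hE), fun E hE h => hne E hE ?_, ?_, fun ε hε => ?_,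
    fun R => ?_, fun E₁ h₁ E₂ h₂ => ?_⟩
  · exact (Real.sqrt_inj (hP E hE).le (hQ E hE).le).1 h
  · refine hmono.imp (fun h => ⟨fun E hE F hF hEF => ?_, fun E hE F hF hEF => ?_⟩)
      fun h => ⟨fun E hE F hF hEF => ?_, fun E hE F hF hEF => ?_⟩
    · exact Real.sqrt_lt_sqrt (hP E hE).le (h.1 hE hF hEF)
    · exact Real.sqrt_lt_sqrt (hQ E hE).le (h.2 hE hF hEF)
    · exact Real.sqrt_lt_sqrt (hP F hF).le (h.1 hE hF hEF)
    · exact Real.sqrt_lt_sqrt (hQ F hF).le (h.2 hE hF hEF)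
  · obtain ⟨E, hE, h⟩ := small (ε ^ 2) (by positivity)
    refine ⟨E, hE, ?_⟩
    rw [hprod E hE]
    exact (Real.sqrt_lt' hε).2 h
  · obtain ⟨E, hE, h⟩ := large (R ^ 2)
    refine ⟨E, hE, ?_⟩
    rw [hprod E hE]
    exact Real.lt_sqrt_of_sq_lt h
  · have hsub : uIcc E₁ E₂ ⊆ I := hI.ordConnected.uIcc_subset h₁ h₂
    obtain ⟨k, hk, hkP⟩ := slope E₁ h₁ E₂ h₂
    obtain ⟨G, hG, hGQ⟩ := isCompact_uIcc.exists_isMinOn nonempty_uIcc (cQ.mono hsub)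
    have hq := hQ G (hsub hG)
    refine ⟨k * Q G, mul_pos hk hq, fun E hE F hF => ?_⟩
    rw [hsq E (hsub hE), hsq F (hsub hF)]
    have h1 := hkP E hE F hF
    have h2 : Q G ≤ Q E := hGQ hE
    have h3 := hP F (hsub hF)
    have h4 : 0 ≤ (P E - P F) * (Q E - Q F) := by
      have aux : ∀ x ∈ uIcc E₁ E₂, ∀ y ∈ uIcc E₁ E₂, x < y →
          0 ≤ (P x - P y) * (Q x - Q y) := fun x hx y hy hxy => by
        rcases hmono with h | h
        · have u1 := h.1 (hsub hx) (hsub hy) hxy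
          have u2 := h.2 (hsub hx) (hsub hy) hxy
          nlinarith
        · have u1 := h.1 (hsub hx) (hsub hy) hxy
          have u2 := h.2 (hsub hx) (hsub hy) hxy
          nlinarith
      rcases lt_trichotomy E F with h | rfl | h
      · exact aux E hE F hF h
      · simp
      · linarith [aux F hF E hE h]
    have h5 : |P E - P F| * Q G ≤ |P E * Q E - P F * Q F| := by
      have e : P E * Q E - P F * Q F = (P E - P F) * Q E + P F * (Q E - Q F) := by ring
      rw [e]
      rcases lt_trichotomy (P E - P F) 0 with h | h | h
      · have h6 : Q E - Q F ≤ 0 := by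
          by_contra hcon
          nlinarith
        rw [abs_of_neg h]
        refine le_trans ?_ (neg_le_abs _)
        nlinarith
      · rw [h, abs_zero, zero_mul]
        exact abs_nonneg _
      · have h6 : 0 ≤ Q E - Q F := by
          by_contra hcon
          nlinarith
        rw [abs_of_pos h]
        refine le_trans ?_ (le_abs_self _)
        nlinarith
    calc k * Q G * |E - F| = k * |E - F| * Q G := by ring
      _ ≤ |P E - P F| * Q G := mul_le_mul_of_nonneg_right h1 hq.le
      _ ≤ _ := h5

/-! ### Numbering and parametrization of the gaps -/

theorem sq_ne_of_mem_bandSet {m k : ℕ} {e : ℝ} (he : e ∈ bandSet m) (hk : 1 ≤ k) :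
    (k : ℝ) ^ 2 ≠ e := by
  rintro rfl
  have h2 : k ^ 2 < (m + 1) ^ 2 := by exact_mod_cast he.2
  have h3 : k < m + 1 := lt_of_pow_lt_pow_left₀ 2 (by omega) h2
  rcases he.1 with rfl | h1
  · omega
  · have h4 : m ^ 2 < k ^ 2 := by exact_mod_cast h1
    have h5 : m < k := lt_of_pow_lt_pow_left₀ 2 (by omega) h4
    omega

theorem natCast_sq_inj {m k : ℕ} (h : (k : ℝ) ^ 2 = (m : ℝ) ^ 2) : k = m := by
  have : k ^ 2 = m ^ 2 := by exact_mod_cast h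
  exact Nat.pow_left_injective two_ne_zero this

/-- The inner end `e` lies strictly between consecutive squares and therefore never matches a
numbering rule. Only the outer end, a square or minus infinity, determines the number. -/
theorem isGapNumber_lower_iff {m : ℕ} {e : ℝ} (he : e ∈ bandSet m) (l : ℕ) :
    IsGapNumber {E | E ∈ bandSet m ∧ E < e} l ↔ l = 2 * m := by
  rcases Nat.eq_zero_or_pos m with rfl | hm
  · have hset : {E | E ∈ bandSet 0 ∧ E < e} = Iio e := by
      ext E
      exact ⟨fun h => h.2, fun h => ⟨⟨Or.inl rfl, lt_trans h he.2⟩, h⟩⟩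
    rw [hset]
    constructor
    · rintro (⟨h, -⟩ | ⟨k, hk, ⟨-, h⟩ | ⟨-, h⟩⟩)
      · exact h
      · exact absurd (h.unique isLUB_Iio) (sq_ne_of_mem_bandSet he hk)
      · exact absurd h.bddBelow (not_bddBelow_Iio e)
    · exact fun h => Or.inl ⟨by simpa using h, not_bddBelow_Iio e⟩
  · have hme : (m : ℝ) ^ 2 < e := he.1.resolve_left hm.ne'
    have hset : {E | E ∈ bandSet m ∧ E < e} = Ioo ((m : ℝ) ^ 2) e := by
      ext E
      exact ⟨fun h => ⟨h.1.1.resolve_left hm.ne', h.2⟩,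
        fun h => ⟨⟨Or.inr h.1, h.2.trans he.2⟩, h.2⟩⟩
    rw [hset]
    constructor
    · rintro (⟨-, h⟩ | ⟨k, hk, ⟨-, h⟩ | ⟨hl, h⟩⟩)
      · exact absurd bddBelow_Ioo h
      · exact absurd (h.unique (isLUB_Ioo hme)) (sq_ne_of_mem_bandSet he hk)
      · rw [hl, natCast_sq_inj (h.unique (isGLB_Ioo hme))]
    · exact fun h => Or.inr ⟨m, hm, Or.inr ⟨h, isGLB_Ioo hme⟩⟩

theorem isGapNumber_upper_iff {m : ℕ} {e : ℝ} (he : e ∈ bandSet m) (l : ℕ) :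
    IsGapNumber {E | E ∈ bandSet m ∧ e < E} l ↔ l = 2 * m + 1 := by
  have hset : {E | E ∈ bandSet m ∧ e < E} = Ioo e (((m + 1 : ℕ) : ℝ) ^ 2) := by
    ext E
    exact ⟨fun h => ⟨h.2, h.1.2⟩, fun h => ⟨⟨he.1.imp_right fun k => k.trans h.1, h.2⟩, h.1⟩⟩
  rw [hset]
  constructor
  · rintro (⟨-, h⟩ | ⟨k, hk, ⟨hl, h⟩ | ⟨-, h⟩⟩)
    · exact absurd bddBelow_Ioo h
    · have := natCast_sq_inj (h.unique (isLUB_Ioo he.2))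
      omega
    · exact absurd (h.unique (isGLB_Ioo he.2)) (sq_ne_of_mem_bandSet he hk)
  · exact fun h => Or.inr ⟨m + 1, by omega, Or.inl ⟨by omega, isLUB_Ioo he.2⟩⟩

theorem isSpectralGap_iff (A : ℤ) (α : ℝ) (I : Set ℝ) :
    IsSpectralGap (periodicHamiltonian A α) I ↔
      ∃ E, 1 < |discriminant α E| ∧ I = connectedComponentIn {E | 1 < |discriminant α E|} E := by
  have h : (essentialSpectrum (periodicHamiltonian A α))ᶜ = {E | 1 < |discriminant α E|} := by
    rw [periodicHamiltonian, essentialSpectrum_chainHamiltonian A (F := ∅) (fun _ _ => rfl)]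
    ext E
    simp
  rw [IsSpectralGap, h]
  rfl

theorem exists_isBandPair (α : ℝ) (m : ℕ) : ∃ X Y : ℝ → ℝ, IsBandPair (bandSet m) X Y ∧
    ((X = lowerFactor α ∧ Y = upperFactor α) ∨ (X = upperFactor α ∧ Y = lowerFactor α)) := by
  rcases Nat.even_or_odd m with hm | hm
  · exact ⟨_, _, isBandPair_even α hm, Or.inl ⟨rfl, rfl⟩⟩
  · exact ⟨_, _, isBandPair_odd α hm, Or.inr ⟨rfl, rfl⟩⟩

theorem lowerFactor_slope (α : ℝ) {m : ℕ} {ε : ℝ} (hε : |ε| = 1) {I : Set ℝ} (hI : I ⊆ bandSet m) :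
    ∀ E₁ ∈ I, ∀ E₂ ∈ I, ∃ k > 0, ∀ E ∈ uIcc E₁ E₂, ∀ F ∈ uIcc E₁ E₂,
      k * |E - F| ≤ |ε * lowerFactor α E - ε * lowerFactor α F| := by
  intro E₁ h₁ E₂ h₂
  obtain ⟨k, hk, h⟩ := exists_edgeTan_slope (l := min E₁ E₂) (r := max E₁ E₂) fun E hE =>
    (edge_ne_zero_of_mem_bandSet ((bandSet_ordConnected m).uIcc_subset (hI h₁) (hI h₂) hE)).1
  refine ⟨k, hk, fun E hE F hF => (h E hE F hF).trans_eq ?_⟩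
  rw [← mul_sub, abs_mul, hε, one_mul, lowerFactor, lowerFactor, sub_sub_sub_cancel_left,
    abs_sub_comm]

/-- Every gap of the periodic chain lies between consecutive infinitely degenerate eigenvalues; the
sign of the two factors of `ξ ^ 2 - 1` on it determines the parity of its number. -/
theorem exists_gap_parametrization (α : ℝ) {E₀ : ℝ} (hE₀ : 1 < |discriminant α E₀|) {I : Set ℝ}
    (hI : I = connectedComponentIn {E | 1 < |discriminant α E|} E₀) :
    ∃ (ε : ℝ) (l : ℕ), ((ε = 1 ∧ Even l) ∨ (ε = -1 ∧ Odd l)) ∧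
      (∀ l', IsGapNumber I l' ↔ l' = l) ∧ (∃ m, I ⊆ bandSet m) ∧
      (∀ E ∈ I, 0 < ε * lowerFactor α E ∧ 0 < ε * upperFactor α E) ∧
      IsGapParametrization I (fun E => √(ε * lowerFactor α E)) (fun E => √(ε * upperFactor α E)) := by
  obtain ⟨m, hm⟩ := exists_mem_bandSet hE₀
  obtain ⟨X, Y, hXY, hor⟩ := exists_isBandPair α m
  have hiff : ∀ E ∈ bandSet m, 1 < |discriminant α E| ↔ 0 < X E * Y E := fun E hE => by
    obtain ⟨hC, hS⟩ := edge_ne_zero_of_mem_bandSet hE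
    rw [one_lt_abs_discriminant_iff α hC hS]
    rcases hor with ⟨rfl, rfl⟩ | ⟨rfl, rfl⟩
    · rfl
    · rw [mul_comm]
  have hprod : ∀ {ε : ℝ}, |ε| = 1 → ∀ E,
      ε * lowerFactor α E * (ε * upperFactor α E) = X E * Y E := fun {ε} hε E => by
    have h1 : ε ^ 2 = 1 := by rw [← sq_abs, hε, one_pow]
    rcases hor with ⟨rfl, rfl⟩ | ⟨rfl, rfl⟩
    · linear_combination lowerFactor α E * upperFactor α E * h1
    · linear_combination lowerFactor α E * upperFactor α E * h1
  have key : ∀ {ε : ℝ}, (ε = 1 ∨ ε = -1) → ∀ {K : Set ℝ}, IsPreconnected K → K ⊆ bandSet m →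
      (∀ E ∈ K, 0 < ε * X E ∧ 0 < ε * Y E) → (∀ δ > 0, ∃ E ∈ K, X E * Y E < δ) →
      (∀ R : ℝ, ∃ E ∈ K, R < X E * Y E) →
      (∀ E ∈ K, 0 < ε * lowerFactor α E ∧ 0 < ε * upperFactor α E) ∧
      IsGapParametrization K (fun E => √(ε * lowerFactor α E))
        (fun E => √(ε * upperFactor α E)) := by
    intro ε hε K hK hKJ hpos small large
    have hε1 : |ε| = 1 := by rcases hε with rfl | rfl <;> simp
    have hε0 : ε ≠ 0 := by rcases hε with rfl | rfl <;> norm_num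
    have hpos' : ∀ E ∈ K, 0 < ε * lowerFactor α E ∧ 0 < ε * upperFactor α E := by
      rcases hor with ⟨rfl, rfl⟩ | ⟨rfl, rfl⟩
      · exact hpos
      · exact fun E hE => (hpos E hE).symm
    have hC : ∀ E ∈ K, edgeCos E (Real.pi / 2) ≠ 0 := fun E hE =>
      (edge_ne_zero_of_mem_bandSet (hKJ hE)).1
    have hS : ∀ E ∈ K, edgeSin E (Real.pi / 2) ≠ 0 := fun E hE =>
      (edge_ne_zero_of_mem_bandSet (hKJ hE)).2
    have aL := strictAntiOn_lowerFactor α hK.ordConnected.convex hC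
    have aU := strictAntiOn_upperFactor α hK.ordConnected.convex hS
    refine ⟨hpos', isGapParametrization_sqrt hK
      (continuousOn_const.mul (continuousOn_lowerFactor α hC))
      (continuousOn_const.mul (continuousOn_upperFactor α hS))
      (fun E hE => (hpos' E hE).1) (fun E hE => (hpos' E hE).2) (fun E hE h => ?_) ?_
      (fun δ hδ => ?_) (fun R => ?_) (lowerFactor_slope α hε1 hKJ)⟩
    · have h1 := edgeSin_mul_factor_sub α (hC E hE) (hS E hE)
      rw [mul_left_cancel₀ hε0 h, sub_self, mul_zero] at h1
      norm_num at h1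
    · rcases hε with rfl | rfl
      · right
        simpa only [one_mul] using And.intro aL aU
      · left
        simpa only [neg_one_mul] using And.intro aL.neg aU.neg
    · simpa only [hprod hε1] using small δ hδ
    · simpa only [hprod hε1] using large R
  have h0 := (hiff E₀ hm).1 hE₀
  -- A positive `X` forces a positive `Y`: this is the gap at the left end, with `ε = 1`. Otherwise
  -- both are negative: the gap at the right end, with `ε = -1`.
  by_cases hX0 : 0 < X E₀
  · obtain ⟨e, heJ, hXe, hEe, hlt, small, large⟩ := hXY.lower_gap hm hX0
    set K := {E | E ∈ bandSet m ∧ E < e} with hKdef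
    have hK : IsPreconnected K :=
      ((bandSet_ordConnected m).inter ordConnected_Iio).isPreconnected
    have hIK : I = K := by
      rw [hI]
      refine connectedComponentIn_eq_of_separated hK ⟨hm, hEe⟩ (fun E hE => ?_) fun y hy => ?_
      · have h1 := (hlt E hE.1).2 hE.2
        exact (hiff E hE.1).2 (mul_pos h1 (hXY.pos_of_pos E hE.1 h1))
      · rcases le_or_gt e y with h | h
        · refine ⟨e, mem_uIcc.2 (Or.inl ⟨hEe.le, h⟩), fun hcon => ?_⟩
          have := (hiff e heJ).1 hcon
          rw [hXe, zero_mul] at this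
          exact lt_irrefl _ this
        · have h1 : ¬ (m = 0 ∨ (m : ℝ) ^ 2 < y) := fun h2 => hy ⟨⟨h2, h.trans heJ.2⟩, h⟩
          push Not at h1
          refine ⟨(m : ℝ) ^ 2, mem_uIcc.2 (Or.inr ⟨h1.2, (hm.1.resolve_left h1.1).le⟩),
            fun hcon => ?_⟩
          exact absurd hcon (by simp [discriminant_sq_boundary α h1.1])
    obtain ⟨k1, k2⟩ := key (Or.inl rfl) hK (fun E hE => hE.1)
      (fun E hE => by
        have h1 := (hlt E hE.1).2 hE.2
        simpa using And.intro h1 (hXY.pos_of_pos E hE.1 h1))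
      (fun δ hδ => by
        obtain ⟨E, hE, h1, h2⟩ := small δ hδ
        exact ⟨E, ⟨hE, (hlt E hE).1 h1⟩, h2⟩)
      (fun R => by
        obtain ⟨E, hE, h1, h2⟩ := large R
        exact ⟨E, ⟨hE, (hlt E hE).1 h1⟩, h2⟩)
    exact ⟨1, 2 * m, Or.inl ⟨rfl, even_two_mul m⟩, hIK ▸ isGapNumber_lower_iff heJ,
      ⟨m, hIK ▸ fun E hE => hE.1⟩, hIK ▸ k1, hIK ▸ k2⟩
  · have hY0 : Y E₀ < 0 := by
      by_contra hcon
      have := mul_nonpos_of_nonpos_of_nonneg (not_lt.1 hX0) (not_lt.1 hcon)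
      linarith
    obtain ⟨e, heJ, hYe, hEe, hlt, small, large⟩ := hXY.upper_gap hm hY0
    set K := {E | E ∈ bandSet m ∧ e < E} with hKdef
    have hK : IsPreconnected K :=
      ((bandSet_ordConnected m).inter ordConnected_Ioi).isPreconnected
    have hIK : I = K := by
      rw [hI]
      refine connectedComponentIn_eq_of_separated hK ⟨hm, hEe⟩ (fun E hE => ?_) fun y hy => ?_
      · have h1 := (hlt E hE.1).2 hE.2
        exact (hiff E hE.1).2 (mul_pos_of_neg_of_neg (hXY.neg_of_neg E hE.1 h1) h1)
      · rcases le_or_gt y e with h | h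
        · refine ⟨e, mem_uIcc.2 (Or.inr ⟨h, hEe.le⟩), fun hcon => ?_⟩
          have := (hiff e heJ).1 hcon
          rw [hYe, mul_zero] at this
          exact lt_irrefl _ this
        · have h1 : ((m + 1 : ℕ) : ℝ) ^ 2 ≤ y := by
            by_contra h2
            exact hy ⟨⟨heJ.1.imp_right fun h3 => h3.trans h, not_le.1 h2⟩, h⟩
          refine ⟨((m + 1 : ℕ) : ℝ) ^ 2, mem_uIcc.2 (Or.inl ⟨hm.2.le, h1⟩), fun hcon => ?_⟩
          change 1 < |discriminant α (((m + 1 : ℕ) : ℝ) ^ 2)| at hcon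
          rw [discriminant_sq_boundary α m.succ_ne_zero] at hcon
          exact lt_irrefl _ hcon
    obtain ⟨k1, k2⟩ := key (Or.inr rfl) hK (fun E hE => hE.1)
      (fun E hE => by
        have h1 := (hlt E hE.1).2 hE.2
        simpa using And.intro (hXY.neg_of_neg E hE.1 h1) h1)
      (fun δ hδ => by
        obtain ⟨E, hE, h1, h2⟩ := small δ hδ
        exact ⟨E, ⟨hE, (hlt E hE).1 h1⟩, h2⟩)
      (fun R => by
        obtain ⟨E, hE, h1, h2⟩ := large R
        exact ⟨E, ⟨hE, (hlt E hE).1 h1⟩, h2⟩)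
    exact ⟨-1, 2 * m + 1, Or.inr ⟨rfl, odd_two_mul_add_one m⟩, hIK ▸ isGapNumber_upper_iff heJ,
      ⟨m, hIK ▸ fun E hE => hE.1⟩, hIK ▸ k1, hIK ▸ k2⟩

/-! ### From eigenvalues to the secular equation, and conclusion -/

/-- With `s = edgeSin E π`, the factors satisfy `s (b² - a²) = 2 ε` and `ξ = 1 + s ε a²`. So `l +
l⁻¹ = 2 (a² + b²)/(b² - a²)` is `2 ξ`, and `l - l⁻¹ = -4ab/(b² - a²)` is proportional to `s`. -/
theorem decayRate_add_inv {α ε E : ℝ} (hε : ε = 1 ∨ ε = -1) (hC : edgeCos E (Real.pi / 2) ≠ 0)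
    (hS : edgeSin E (Real.pi / 2) ≠ 0) (hl : 0 < ε * lowerFactor α E)
    (hu : 0 < ε * upperFactor α E) {l : ℝ}
    (hld : l = decayRate √(ε * lowerFactor α E) √(ε * upperFactor α E)) :
    l ≠ 0 ∧ |l| < 1 ∧ l + l⁻¹ = 2 * discriminant α E ∧
      l - l⁻¹ = -ε * (√(ε * lowerFactor α E) * √(ε * upperFactor α E)) * (2 * edgeSin E Real.pi) := by
  have hε2 : ε * ε = 1 := by rcases hε with rfl | rfl <;> norm_num
  have ha := Real.sqrt_pos.2 hl
  have hb := Real.sqrt_pos.2 hu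
  have ha2 := Real.sq_sqrt hl.le
  have hb2 := Real.sq_sqrt hu.le
  set a := √(ε * lowerFactor α E)
  set b := √(ε * upperFactor α E)
  have hs := edgeSin_mul_factor_sub α hC hS
  have hd := discriminant_sub_one α hC
  have hs' : edgeSin E Real.pi * (b ^ 2 - a ^ 2) = 2 * ε := by
    rw [ha2, hb2]
    linear_combination ε * hs
  have hd' : discriminant α E = 1 + edgeSin E Real.pi * ε * a ^ 2 := by
    rw [ha2]
    linear_combination hd - edgeSin E Real.pi * lowerFactor α E * hε2
  have hne : b - a ≠ 0 := fun h => by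
    have h1 : b ^ 2 - a ^ 2 = (b - a) * (b + a) := by ring
    rw [h1, h, zero_mul, mul_zero] at hs'
    rcases hε with rfl | rfl <;> norm_num at hs'
  have hsum : b + a ≠ 0 := (add_pos hb ha).ne'
  have hl0 : l ≠ 0 := by
    rw [hld, decayRate]
    exact div_ne_zero hne hsum
  have hinv : l⁻¹ = (b + a) / (b - a) := by rw [hld, decayRate, inv_div]
  have hsE : edgeSin E Real.pi = 2 * ε / ((b - a) * (b + a)) := by
    rw [eq_div_iff (mul_ne_zero hne hsum), ← hs']
    ring
  refine ⟨hl0, hld ▸ abs_decayRate_lt_one ha hb, ?_, ?_⟩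
  · rw [hinv, hld, decayRate, hd', hsE]
    field_simp
    linear_combination -4 * a ^ 2 * hε2
  · rw [hinv, hld, decayRate, hsE]
    field_simp
    linear_combination 4 * a * b * hε2

/-- On a gap, the eigenvalues of the chain with two impurities are the solutions of the secular
equation. -/
theorem eigenvaluesIn_distantHamiltonian (A : ℤ) {α ε γ₁ γ₂ : ℝ} (hε : ε = 1 ∨ ε = -1)
    (h2 : γ₂ ≠ 0) {I : Set ℝ} {m : ℕ} (hI : I ⊆ bandSet m)
    (hpos : ∀ E ∈ I, 0 < ε * lowerFactor α E ∧ 0 < ε * upperFactor α E) (n : ℕ) (j : ℤ) :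
    eigenvaluesIn (distantHamiltonian A α γ₁ γ₂ n j) I =
        secularSet I (fun E => √(ε * lowerFactor α E)) (fun E => √(ε * upperFactor α E))
          (-ε * γ₁) (-ε * γ₂) n ∧
      ∀ E ∈ eigenvaluesIn (distantHamiltonian A α γ₁ γ₂ n j) I,
        Module.finrank ℂ (graphEigenspace (distantHamiltonian A α γ₁ γ₂ n j) E) = 1 := by
  have hε2 : ε * ε = 1 := by rcases hε with rfl | rfl <;> norm_num
  have hdisc : ∀ E ∈ I, 1 < |discriminant α E| := fun E hE => by
    obtain ⟨hC, hS⟩ := edge_ne_zero_of_mem_bandSet (hI hE)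
    rw [one_lt_abs_discriminant_iff α hC hS]
    have := mul_pos (hpos E hE).1 (hpos E hE).2
    linear_combination this + lowerFactor α E * upperFactor α E * hε2
  refine ⟨?_, fun E hE => ?_⟩
  · ext E
    refine and_congr_right fun hE => ?_
    obtain ⟨hC, hS⟩ := edge_ne_zero_of_mem_bandSet (hI hE)
    obtain ⟨k0, k1, k2, k3⟩ := decayRate_add_inv hε hC hS (hpos E hE).1 (hpos E hE).2 rfl
    rw [graphEigenspace_ne_bot_iff k0 k1 k2 (hdisc E hE) h2, k3]
    have hs := edgeSin_pi_ne_zero_of_gap (hdisc E hE)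
    set s := edgeSin E Real.pi
    set p := √(ε * lowerFactor α E) * √(ε * upperFactor α E)
    set L := decayRate √(ε * lowerFactor α E) √(ε * upperFactor α E) ^ (2 * (n + 1))
    have hs4 : s ^ 2 / 4 ≠ 0 := by positivity
    -- Each factor of the determinant is `-ε s / 2` times `4 p - (-ε γᵢ)`, so `s² / 4` cancels and
    -- the sign `ε` passes to the coupling parameters.
    rw [← mul_right_inj' hs4 (b := (4 * p - -ε * γ₁) * (4 * p - -ε * γ₂))]
    have e1 : (-ε * p * (2 * s) - s / 2 * γ₁) * (-ε * p * (2 * s) - s / 2 * γ₂)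
        = s ^ 2 / 4 * ((4 * p - -ε * γ₁) * (4 * p - -ε * γ₂)) := by
      linear_combination s ^ 2 / 4 * (16 * p ^ 2 - γ₁ * γ₂) * hε2
    have e2 : s / 2 * γ₁ * (s / 2 * γ₂) * L = s ^ 2 / 4 * (-ε * γ₁ * (-ε * γ₂) * L) := by
      linear_combination -s ^ 2 / 4 * γ₁ * γ₂ * L * hε2
    rw [e1, e2]
  · obtain ⟨hC, hS⟩ := edge_ne_zero_of_mem_bandSet (hI hE.1)
    obtain ⟨k0, k1, k2, -⟩ := decayRate_add_inv hε hC hS (hpos E hE.1).1 (hpos E hE.1).2 rfl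
    exact finrank_graphEigenspace k0 k1 k2 (hdisc E hE.1) h2 hE.2

theorem eigenvaluesIn_distantHamiltonian_zero (A : ℤ) {α ε : ℝ} (hε : ε = 1 ∨ ε = -1)
    {I : Set ℝ} {m : ℕ} (hI : I ⊆ bandSet m)
    (hpos : ∀ E ∈ I, 0 < ε * lowerFactor α E ∧ 0 < ε * upperFactor α E) (n : ℕ) (j : ℤ) :
    eigenvaluesIn (distantHamiltonian A α 0 0 n j) I = ∅ := by
  have hε2 : ε * ε = 1 := by rcases hε with rfl | rfl <;> norm_num
  rw [eq_empty_iff_forall_notMem]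
  rintro E ⟨hE, hne⟩
  obtain ⟨hC, hS⟩ := edge_ne_zero_of_mem_bandSet (hI hE)
  obtain ⟨k0, k1, k2, -⟩ := decayRate_add_inv hε hC hS (hpos E hE).1 (hpos E hE).2 rfl
  refine hne (graphEigenspace_eq_bot_of_no_impurity k0 k1 k2 ?_)
  rw [one_lt_abs_discriminant_iff α hC hS]
  have := mul_pos (hpos E hE).1 (hpos E hE).2
  linear_combination this + lowerFactor α E * upperFactor α E * hε2

/-- The secular parameters are `-ε γᵢ`, with `ε = 1` exactly for even gap numbers. So positive
impurities yield positive parameters in the odd gaps and negative ones in the even gaps, and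
conversely for negative impurities. -/
theorem mainTheorem12 (A : ℤ) (α γ₁ γ₂ : ℝ) :
    (∀ (n : ℕ) (j : ℤ), essentialSpectrum (distantHamiltonian A α γ₁ γ₂ n j)
      = essentialSpectrum (periodicHamiltonian A α)) ∧
    ∀ I : Set ℝ, IsSpectralGap (periodicHamiltonian A α) I →
      (∃! l : ℕ, IsGapNumber I l) ∧
      (γ₁ * γ₂ < 0 → ∃ N : ℕ, ∀ n ≥ N, ∀ j : ℤ,
        HasSimpleEigenvalues (distantHamiltonian A α γ₁ γ₂ n j) I 1) ∧
      (0 < γ₁ → 0 < γ₂ → ∃ N : ℕ, ∀ n ≥ N, ∀ j : ℤ, ∀ l : ℕ, IsGapNumber I l →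
        (Odd l → HasSimpleEigenvalues (distantHamiltonian A α γ₁ γ₂ n j) I 2) ∧
        (Even l → eigenvaluesIn (distantHamiltonian A α γ₁ γ₂ n j) I = ∅)) ∧
      (γ₁ < 0 → γ₂ < 0 → ∃ N : ℕ, ∀ n ≥ N, ∀ j : ℤ, ∀ l : ℕ, IsGapNumber I l →
        (Even l → HasSimpleEigenvalues (distantHamiltonian A α γ₁ γ₂ n j) I 2) ∧
        (Odd l → eigenvaluesIn (distantHamiltonian A α γ₁ γ₂ n j) I = ∅)) ∧
      (γ₁ = γ₂ → ∃ C > 0, ∃ c > 0, ∃ N : ℕ, ∀ n ≥ N, ∀ j : ℤ,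
        ∀ E ∈ eigenvaluesIn (distantHamiltonian A α γ₁ γ₂ n j) I,
        ∀ E' ∈ eigenvaluesIn (distantHamiltonian A α γ₁ γ₂ n j) I,
          |E - E'| ≤ C * Real.exp (-c * n)) := by
  refine ⟨fun n j => ?_, fun I hI => ?_⟩
  · rw [distantHamiltonian, periodicHamiltonian,
      essentialSpectrum_chainHamiltonian A (distantCoupling_of_not_mem α γ₁ γ₂ n j),
      essentialSpectrum_chainHamiltonian A (F := ∅) (fun _ _ => rfl)]
  obtain ⟨E₀, hE₀, hIE⟩ := (isSpectralGap_iff A α I).1 hI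
  obtain ⟨ε, l₀, hor, hnum, ⟨m, hm⟩, hpos, hpar⟩ := exists_gap_parametrization α hE₀ hIE
  have hε : ε = 1 ∨ ε = -1 := hor.imp And.left And.left
  have hε2 : ε * ε = 1 := by rcases hε with rfl | rfl <;> norm_num
  have heig := fun (h2 : γ₂ ≠ 0) n j =>
    eigenvaluesIn_distantHamiltonian A (γ₁ := γ₁) hε h2 hm hpos n j
  have two : 0 < -ε * γ₁ → 0 < -ε * γ₂ → ∃ N : ℕ, ∀ n ≥ N, ∀ j : ℤ,
      HasSimpleEigenvalues (distantHamiltonian A α γ₁ γ₂ n j) I 2 := fun h1 h2 => by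
    obtain ⟨N, hN⟩ := hpar.encard_secularSet_of_pos h1 h2
    have h0 : γ₂ ≠ 0 := right_ne_zero_of_mul h2.ne'
    exact ⟨N, fun n hn j => ⟨by rw [(heig h0 n j).1, hN n hn]; rfl, (heig h0 n j).2⟩⟩
  have none : -ε * γ₁ < 0 → -ε * γ₂ < 0 → ∀ n (j : ℤ),
      eigenvaluesIn (distantHamiltonian A α γ₁ γ₂ n j) I = ∅ := fun h1 h2 n j => by
    rw [(heig (right_ne_zero_of_mul h2.ne) n j).1, hpar.secularSet_eq_empty h1 h2]
  refine ⟨⟨l₀, (hnum l₀).2 rfl, fun l hl => (hnum l).1 hl⟩, fun h => ?_, fun h1 h2 => ?_,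
    fun h1 h2 => ?_, fun h => ?_⟩
  · obtain ⟨N, hN⟩ := hpar.encard_secularSet_of_mul_neg (β₁ := -ε * γ₁) (β₂ := -ε * γ₂)
      (by linear_combination h + γ₁ * γ₂ * hε2)
    have h0 : γ₂ ≠ 0 := right_ne_zero_of_mul h.ne
    exact ⟨N, fun n hn j => ⟨by rw [(heig h0 n j).1, hN n hn]; rfl, (heig h0 n j).2⟩⟩
  · rcases hor with ⟨rfl, hl⟩ | ⟨rfl, hl⟩
    · refine ⟨0, fun n _ j l hln => ?_⟩
      rw [(hnum l).1 hln]
      exact ⟨fun hl' => absurd hl (Nat.not_even_iff_odd.2 hl'),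
        fun _ => none (by linarith) (by linarith) n j⟩
    · obtain ⟨N, hN⟩ := two (by linarith) (by linarith)
      refine ⟨N, fun n hn j l hln => ?_⟩
      rw [(hnum l).1 hln]
      exact ⟨fun _ => hN n hn j, fun hl' => absurd hl' (Nat.not_even_iff_odd.2 hl)⟩
  · rcases hor with ⟨rfl, hl⟩ | ⟨rfl, hl⟩
    · obtain ⟨N, hN⟩ := two (by linarith) (by linarith)
      refine ⟨N, fun n hn j l hln => ?_⟩
      rw [(hnum l).1 hln]
      exact ⟨fun _ => hN n hn j, fun hl' => absurd hl (Nat.not_even_iff_odd.2 hl')⟩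
    · refine ⟨0, fun n _ j l hln => ?_⟩
      rw [(hnum l).1 hln]
      exact ⟨fun hl' => absurd hl' (Nat.not_even_iff_odd.2 hl),
        fun _ => none (by linarith) (by linarith) n j⟩
  · subst h
    -- Only positive parameters need the estimate: negative ones leave no eigenvalue, and neither
    -- does `γ₁ = 0`, where the reduction to the secular equation is not available.
    rcases lt_trichotomy (-ε * γ₁) 0 with h0 | h0 | h0
    · exact ⟨1, one_pos, 1, one_pos, 0, fun n _ j E hE =>
        absurd (none h0 h0 n j ▸ hE) (notMem_empty E)⟩
    · have h1 : γ₁ = 0 := by rcases hε with rfl | rfl <;> linarith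
      subst h1
      exact ⟨1, one_pos, 1, one_pos, 0, fun n _ j E hE =>
        absurd (eigenvaluesIn_distantHamiltonian_zero A hε hm hpos n j ▸ hE) (notMem_empty E)⟩
    · obtain ⟨C, hC, c, hc, N, hN⟩ := hpar.secularSet_close h0
      refine ⟨C, hC, c, hc, N, fun n hn j E hE E' hE' => ?_⟩
      rw [(heig (right_ne_zero_of_mul h0.ne') n j).1] at hE hE'
      exact hN n hn E hE E' hE'
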